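/- **Setting.** An $L$-layer parametrized circuit on $n$ qubits has layers $\mathcal U_i(\theta_i)$, each a product of Pauli rotations $\exp(-i\frac{\theta_{i,j}}2\sigma_{i,j})$ ($\sigma_{i,j}$ a non-identity Pauli word) and Clifford gates from $\{\mathrm H,\mathrm S,\mathrm{CNOT}\}$ that act on mutually disjoint qubits. Let $\mathcal V_i$ be the product of the Clifford gates of layer $i$ and $\bar\sigma_{i,j}=\mathcal V_1^\dagger\cdots\mathcal V_{i-1}^\dagger\sigma_{i,j}\mathcal V_{i-1}\cdots\mathcal V_1$; the circuit is called *generating* if the $\bar\sigma_{i,j}$ generate all Pauli words up to phases $i^k$. For $\lambda\in[0,1]$ let $\mathcal N(\phi)=(1-\lambda)\phi+\lambda\frac{\mathrm{Tr}\,\phi}{2}\mathbb I$ and $$\widehat{\mathcal L}(\theta)=\mathrm{Tr}\bigl(H\,\mathcal N^{\otimes n}(\mathcal U_L\,\mathcal N^{\otimes n}(\cdots\mathcal U_1\mathcal N^{\otimes n}(\rho)\,\mathcal U_1^\dagger\cdots)\,\mathcal U_L^\dagger)\bigr).$$ A Pauli path $s=(s_0,\dots,s_L)$ consists of Pauli words,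 normalized by a factor $1/\sqrt2$ per qubit; $|s|$ is the total number of its non-identity tensor factors, and $$\hat f(\theta,s)=\mathrm{Tr}(H\mathcal N^{\otimes n}(s_L))\prod_{i=1}^L\mathrm{Tr}\bigl(s_i\,\mathcal U_i\,\mathcal N^{\otimes n}(s_{i-1})\,\mathcal U_i^\dagger\bigr)\,\mathrm{Tr}(s_0\rho),\qquad \widetilde{\mathcal L}_M(\theta)=\sum_{|s|\le M}\hat f(\theta,s).$$ Let $\mathrm{MSE}(M)=\mathbb E_\theta|\widetilde{\mathcal L}_M-\widehat{\mathcal L}|^2$, the angles being independent and uniform on $(-\pi,\pi]$. The *method with cutoff $M$* chooses $s_L$ among the Pauli words of $H$, then enumerates successively the at most $2^{|s_i|}$ candidates for $s_{i-1}$ that layer $i$ allows for $s_i$, for $i=L,\dots,1$, discards a partial path as soon as its weight plus the least possible weight of the remaining words exceeds $M$, and adds up the contributions of the completed paths. Time is the number of elementary steps of this procedure, with exact arithmetic, sine and cosine at unit cost; $H$ is given as a list of real coefficients and Pauli words, and $\rho$ as a list of entries in the computational basis. **Proposition.** 1. Let the lengths of the lists for $H$ and $\rho$ be bounded by a fixed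 polynomial in $n$, let $\|H\|_\infty\le B$ with $B$ fixed, and fix $\nu>0$ and $\kappa>0$. There are a polynomial in $n$ and $L$ and a choice of cutoff $M=M(\lambda)$, depending only on these data, such that for every $n$, every $L\ge2$, every generating circuit, every such $H$, every such density matrix $\rho$, and every $\lambda\in[0,1]$ with $\lambda\ge\kappa/\log L$ (that is, $\lambda=\Omega(1/\log L)$): the method with cutoff $M$ outputs $\widetilde{\mathcal L}_M(\theta)$ for every $\theta$, in time at most the polynomial (so in time $\mathrm{Poly}(n,L)$), and $\mathrm{MSE}(M)<\nu$. 2. Consider the ansatz with a layer of $R_Z$ gates on each qubit, then a layer of $R_X$ gates on each qubit, then $L-2$ layers with an $R_X$ gate on the first qubit, with $\rho=|0\rangle\langle0|^{\otimes n}$ and $H=Z_1+Y_1$. It is generating, and $\|H\|_\infty=\sqrt2$. For every $K>0$ there are $\nu_0>0$ and $L_0$ such that for all $n\ge1$, $L\ge\max(2,L_0)$ and $\lambda\in[0,1]$ with $\lambda\le K/L$ (that is, $\lambda=O(1/L)$): the truncation to weight at most $L$ has error $\mathrm{MSE}(L)\ge\nu_0$ (so it is $\Omega(1)$); the method outputs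 $\widetilde{\mathcal L}_M(\theta)$ for every $M$ and $\theta$; and whenever $\mathrm{MSE}(M)<\nu_0$, the method with cutoff $M$ takes at least $2^{L-1}$ steps for every $\theta$, which is exponential in $L$. -/

import Mathlib

open MeasureTheory
open scoped Matrix ComplexOrder

noncomputable section

namespace PauliPath

/-! ### Pauli words and operators on `n` qubits -/

/-- Labels of the four single-qubit Pauli matrices. -/
inductive Pauli where
  | I
  | X
  | Y
  | Z
  deriving DecidableEq

instance : Fintype Pauli where
  elems := {.I, .X, .Y, .Z}
  complete p := by cases p <;> decide

/-- The single-qubit Pauli matrices. -/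
def Pauli.mat : Pauli → Matrix (Fin 2) (Fin 2) ℂ
  | .I => 1
  | .X => !![0, 1; 1, 0]
  | .Y => !![0, -Complex.I; Complex.I, 0]
  | .Z => !![1, 0; 0, -1]

/-- Labels of the computational basis of `n` qubits. -/
abbrev Bits (n : ℕ) : Type := Fin n → Fin 2

/-- Operators on `n` qubits; the entry at `(x, y)` is `⟨x| A |y⟩`. -/
abbrev Op (n : ℕ) : Type := Matrix (Bits n) (Bits n) ℂ

/-- `n`-qubit Pauli words. -/
abbrev Word (n : ℕ) : Type := Fin n → Pauli

/-- The operator of a Pauli word: the tensor product of its single-qubit Pauli matrices. -/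
def wordOp {n : ℕ} (w : Word n) : Op n :=
  Matrix.of fun x y => ∏ q, (w q).mat (x q) (y q)

/-- The normalized Pauli word, with a factor `1 / √2` on each qubit. -/
def normOp {n : ℕ} (w : Word n) : Op n :=
  (((Real.sqrt 2 : ℝ) : ℂ) ^ n)⁻¹ • wordOp w

/-- The qubits on which a Pauli word is not the identity. -/
def wordSupport {n : ℕ} (w : Word n) : Finset (Fin n) :=
  Finset.univ.filter fun q => w q ≠ Pauli.I

/-- Hamming weight of a Pauli word. -/
def weight {n : ℕ} (w : Word n) : ℕ := (wordSupport w).card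

/-- The identity word. -/
def idWord (n : ℕ) : Word n := fun _ => Pauli.I

/-- The word with the Pauli matrix `p` on qubit `q` and the identity elsewhere. -/
def singleWord {n : ℕ} (q : Fin n) (p : Pauli) : Word n :=
  Function.update (idWord n) q p

/-- The operator acting as `u` on qubit `a` and as the identity on the others. -/
def onQubit {n : ℕ} (a : Fin n) (u : Matrix (Fin 2) (Fin 2) ℂ) : Op n :=
  Matrix.of fun x y => if ∀ q, q ≠ a → x q = y q then u (x a) (y a) else 0

/-! ### Parametrized circuits -/

/-- The Clifford gates `H(a)`, `S(a)` and `CNOT(a, b)`. -/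
inductive Clifford (n : ℕ) where
  | had (a : Fin n)
  | phase (a : Fin n)
  | cnot (a b : Fin n) (hab : a ≠ b)

/-- The unitary of a Clifford gate; `CNOT(a, b)` sends `|y_a, y_b⟩` to `|y_a, y_a ⊕ y_b⟩`. -/
def Clifford.op {n : ℕ} : Clifford n → Op n
  | .had a => onQubit a ((((Real.sqrt 2 : ℝ) : ℂ))⁻¹ • !![1, 1; 1, -1])
  | .phase a => onQubit a !![1, 0; 0, Complex.I]
  | .cnot a b _ =>
      Matrix.of fun x y => if x = Function.update y b (y a + y b) then 1 else 0

/-- The qubits on which a Clifford gate acts. -/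
def Clifford.support {n : ℕ} : Clifford n → Finset (Fin n)
  | .had a => {a}
  | .phase a => {a}
  | .cnot a b _ => {a, b}

/-- A circuit layer: `R` Pauli rotation gates and `C` Clifford gates that act on mutually
disjoint (nonempty) sets of qubits. -/
structure Layer (n : ℕ) where
  R : ℕ
  word : Fin R → Word n
  C : ℕ
  gate : Fin C → Clifford n
  word_ne : ∀ j, word j ≠ idWord n
  rot_disjoint : ∀ j j', j ≠ j' → Disjoint (wordSupport (word j)) (wordSupport (word j'))
  gate_disjoint : ∀ k k', k ≠ k' → Disjoint (gate k).support (gate k').support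
  rot_gate_disjoint : ∀ j k, Disjoint (wordSupport (word j)) (gate k).support

/-- The rotation gate `exp(-i (θ / 2) σ)`. -/
def rotation {n : ℕ} (σ : Word n) (θ : ℝ) : Op n :=
  NormedSpace.exp ((-Complex.I * ((θ / 2 : ℝ) : ℂ)) • wordOp σ)

/-- The product of the Clifford gates of a layer (they commute). -/
def Layer.cliffordOp {n : ℕ} (l : Layer n) : Op n :=
  (List.ofFn fun k => (l.gate k).op).prod

/-- The unitary of a layer (all of its gates commute). -/
def Layer.unitary {n : ℕ} (l : Layer n) (θ : Fin l.R → ℝ) : Op n :=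
  (List.ofFn fun j => rotation (l.word j) (θ j)).prod * l.cliffordOp

/-- Circuits on `n` qubits with `L` layers, the layer with index `0` acting first. -/
abbrev Circuit (n L : ℕ) : Type := Fin L → Layer n

/-- Parameters of a circuit: one angle for each rotation gate. -/
abbrev Params {n L : ℕ} (c : Circuit n L) : Type := (i : Fin L) → Fin (c i).R → ℝ

/-- The law of independent angles, each uniform on `(-π, π]`. -/
def paramLaw {n L : ℕ} (c : Circuit n L) : Measure (Params c) :=
  Measure.pi fun i => Measure.pi fun _ : Fin (c i).R =>
    ProbabilityTheory.cond (volume : Measure ℝ) (Set.Ioc (-Real.pi) Real.pi)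

/-- The product `V_{i-1} ⋯ V_1` of the Clifford parts of the layers before layer `i`. -/
def cliffordBefore {n L : ℕ} (c : Circuit n L) (i : Fin L) : Op n :=
  (((List.ofFn fun k => (c k).cliffordOp).take i).reverse).prod

/-- The Clifford effected Pauli word of the `j`-th rotation gate of layer `i`. -/
def effectedWord {n L : ℕ} (c : Circuit n L) (i : Fin L) (j : Fin (c i).R) : Op n :=
  (cliffordBefore c i)ᴴ * wordOp ((c i).word j) * cliffordBefore c i

/-- The Clifford effected Pauli words generate all Pauli words up to a phase `i ^ k`. (They are
involutions, so the finite products of them form a group.) -/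
def Generates {n L : ℕ} (c : Circuit n L) : Prop :=
  ∀ w : Word n, ∃ k : ℕ, Complex.I ^ k • wordOp w ∈
    Submonoid.closure {A : Op n | ∃ i j, A = effectedWord c i j}

/-! ### Noise, cost functions, Pauli paths -/

/-- The depolarizing channel `φ ↦ (1 - λ) φ + λ (Tr φ / 2) 𝕀` applied to qubit `q`. -/
def depolarizeAt {n : ℕ} (lam : ℝ) (q : Fin n) (φ : Op n) : Op n :=
  Matrix.of fun x y => ((1 - lam : ℝ) : ℂ) * φ x y + (lam : ℂ) *
    (if x q = y q then
      (∑ b : Fin 2, φ (Function.update x q b) (Function.update y q b)) / 2 else 0)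

/-- The depolarizing channel applied to every qubit. -/
def noise {n : ℕ} (lam : ℝ) (φ : Op n) : Op n :=
  (List.finRange n).foldr (depolarizeAt lam) φ

/-- The noisy cost function `Tr (H 𝒩(U_L 𝒩(⋯ U_1 𝒩(ρ) U_1† ⋯) U_L†))`. -/
def noisyCost {n L : ℕ} (c : Circuit n L) (lam : ℝ) (H ρ : Op n) (θ : Params c) : ℂ :=
  (H * Fin.foldl L
    (fun φ i => noise lam ((c i).unitary (θ i) * φ * ((c i).unitary (θ i))ᴴ))
    (noise lam ρ)).trace

/-- Pauli paths `(s_0, …, s_L)`. -/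
abbrev Path (n L : ℕ) : Type := Fin (L + 1) → Word n

/-- Hamming weight of a Pauli path. -/
def pathWeight {n L : ℕ} (s : Path n L) : ℕ := ∑ i, weight (s i)

/-- The contribution of a Pauli path to the noisy cost function. -/
def noisyTerm {n L : ℕ} (c : Circuit n L) (lam : ℝ) (H ρ : Op n) (θ : Params c)
    (s : Path n L) : ℂ :=
  (H * noise lam (normOp (s (Fin.last L)))).trace *
    (∏ i : Fin L, (normOp (s i.succ) * (c i).unitary (θ i) *
      noise lam (normOp (s i.castSucc)) * ((c i).unitary (θ i))ᴴ).trace) *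
    (normOp (s 0) * ρ).trace

/-- The approximate noisy cost function: the sum over the paths of weight at most `M`. -/
def truncatedCost {n L : ℕ} (c : Circuit n L) (lam : ℝ) (H ρ : Op n) (M : ℕ)
    (θ : Params c) : ℂ :=
  ∑ s ∈ Finset.univ.filter (fun s : Path n L => pathWeight s ≤ M), noisyTerm c lam H ρ θ s

/-- The squared truncation error at the parameters `θ`. -/
def sqError {n L : ℕ} (c : Circuit n L) (lam : ℝ) (H ρ : Op n) (M : ℕ)
    (θ : Params c) : ℝ :=
  ‖truncatedCost c lam H ρ M θ - noisyCost c lam H ρ θ‖ ^ 2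

/-- The mean-square truncation error. -/
def mse {n L : ℕ} (c : Circuit n L) (lam : ℝ) (H ρ : Op n) (M : ℕ) : ℝ :=
  ∫ θ, sqError c lam H ρ M θ ∂(paramLaw c)

/-- A Hamiltonian given as a list of coefficients and Pauli words. -/
abbrev HamData (n : ℕ) : Type := List (ℝ × Word n)

/-- The operator of a Hamiltonian. -/
def hamOp {n : ℕ} (H : HamData n) : Op n :=
  (H.map fun t => (t.1 : ℂ) • wordOp t.2).sum

/-- An initial state given as a list of entries `(r, a, b)`, standing for `r |a⟩⟨b|`. -/
abbrev StateData (n : ℕ) : Type := List (ℂ × Bits n × Bits n)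

/-- The operator of a list of entries. -/
def stateOp {n : ℕ} (ρ : StateData n) : Op n :=
  (ρ.map fun e => Matrix.single e.2.1 e.2.2 e.1).sum

/-- Density matrices. -/
def IsDensity {n : ℕ} (A : Op n) : Prop := A.PosSemidef ∧ A.trace = 1

/-- The operator norm on the Hilbert space of `n` qubits. -/
def opNorm {n : ℕ} (A : Op n) : ℝ :=
  ‖Matrix.toEuclideanCLM (n := Bits n) (𝕜 := ℂ) A‖

/-! ### Computations with a step count

The machine has exact arithmetic at unit cost. One elementary step (`elem`) is one arithmetic
operation, comparison or evaluation of sine or cosine, one look-up in a table of constant size,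
reading one array entry, or reading or creating one list cell with the tuple that it holds. Arrays are immutable: a
new array is written entry by entry (`tabulate`). -/

/-- A computed value together with the number of steps that were made to compute it. -/
structure Timed (α : Type) where
  val : α
  steps : ℕ

instance : Monad Timed where
  pure a := ⟨a, 0⟩
  bind x f := ⟨(f x.val).val, x.steps + (f x.val).steps⟩

/-- One elementary step with result `a`. -/
def elem {α : Type} (a : α) : Timed α := ⟨a, 1⟩

/-- A loop through a list, with a step for each cell. -/
def loop {α β : Type} (g : β → α → Timed β) : List α → β → Timed β
  | [], b => elem b
  | a :: l, b => do
      let a ← elem a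
      let b ← g b a
      loop g l b

/-- Writing a new array whose entries are computed by `g`, with a step for each write. -/
def tabulate {n : ℕ} {α : Type} (g : Fin n → Timed α) : Timed (Fin n → α) :=
  ⟨fun q => (g q).val, ∑ q, ((g q).steps + 1)⟩

/-- The sum of the numbers computed by `g` along a list. -/
def sumLoop {α : Type} (g : α → Timed ℂ) : List α → Timed ℂ
  | [] => elem 0
  | a :: l => do
      let a ← elem a
      let x ← g a
      let y ← sumLoop g l
      elem (x + y)

/-- Powers by repeated multiplication. -/
def power (x : ℂ) : ℕ → Timed ℂ
  | 0 => elem 1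
  | k + 1 => do
      let y ← power x k
      elem (x * y)

/-! ### Tables for Pauli matrices -/

/-- The product of two Pauli matrices, up to a phase. -/
def Pauli.mul : Pauli → Pauli → Pauli
  | .I, p => p
  | p, .I => p
  | .X, .X => .I
  | .X, .Y => .Z
  | .X, .Z => .Y
  | .Y, .X => .Z
  | .Y, .Y => .I
  | .Y, .Z => .X
  | .Z, .X => .Y
  | .Z, .Y => .X
  | .Z, .Z => .I

/-- The phase of the product of two Pauli matrices. -/
def Pauli.mulPhase : Pauli → Pauli → ℂ
  | .X, .Y => Complex.I
  | .Y, .Z => Complex.I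
  | .Z, .X => Complex.I
  | .Y, .X => -Complex.I
  | .Z, .Y => -Complex.I
  | .X, .Z => -Complex.I
  | _, _ => 1

/-- Whether two Pauli matrices anti-commute. -/
def Pauli.anti (p r : Pauli) : Bool :=
  decide (p ≠ Pauli.I ∧ r ≠ Pauli.I ∧ p ≠ r)

/-- `H† p H = hadSign p • hadWord p` for the Hadamard gate. -/
def Pauli.hadWord : Pauli → Pauli
  | .I => .I
  | .X => .Z
  | .Y => .Y
  | .Z => .X

def Pauli.hadSign : Pauli → ℂ
  | .Y => -1
  | _ => 1

/-- `S† p S = phaseSign p • phaseWord p` for the phase gate. -/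
def Pauli.phaseWord : Pauli → Pauli
  | .I => .I
  | .X => .Y
  | .Y => .X
  | .Z => .Z

def Pauli.phaseSign : Pauli → ℂ
  | .X => -1
  | _ => 1

/-- The image of `p ⊗ 𝕀` under conjugation with CNOT (control first). -/
def Pauli.cnotControl : Pauli → Pauli × Pauli
  | .I => (.I, .I)
  | .X => (.X, .X)
  | .Y => (.Y, .X)
  | .Z => (.Z, .I)

/-- The image of `𝕀 ⊗ p` under conjugation with CNOT (control first). -/
def Pauli.cnotTarget : Pauli → Pauli × Pauli
  | .I => (.I, .I)
  | .X => (.I, .X)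
  | .Y => (.Z, .Y)
  | .Z => (.Z, .Z)

/-- The image of `p ⊗ r` under conjugation with CNOT, up to a sign. -/
def Pauli.cnotWord (p r : Pauli) : Pauli × Pauli :=
  (p.cnotControl.1.mul r.cnotTarget.1, p.cnotControl.2.mul r.cnotTarget.2)

/-- The sign of the image of `p ⊗ r` under conjugation with CNOT. -/
def Pauli.cnotSign (p r : Pauli) : ℂ :=
  p.cnotControl.1.mulPhase r.cnotTarget.1 * p.cnotControl.2.mulPhase r.cnotTarget.2

/-! ### The simulation method -/

/-- Computing the Hamming weight of a word. -/
def weightT {n : ℕ} (s : Word n) : Timed ℕ :=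
  loop (fun k q => do
    let p ← elem (s q)
    if ← elem (decide (p = Pauli.I)) then pure k else elem (k + 1)) (List.finRange n) 0

/-- Testing whether two words anti-commute. -/
def antiT {n : ℕ} (σ s : Word n) : Timed Bool :=
  loop (fun b q => do
    let p ← elem (σ q)
    let r ← elem (s q)
    let a ← elem (p.anti r)
    elem (xor b a)) (List.finRange n) false

/-- The product of two words, up to its phase. -/
def mulWordT {n : ℕ} (σ s : Word n) : Timed (Word n) :=
  tabulate fun q => do
    let p ← elem (σ q)
    let r ← elem (s q)
    elem (p.mul r)

/-- The phase of the product of two words. -/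
def mulPhaseT {n : ℕ} (σ s : Word n) : Timed ℂ :=
  loop (fun z q => do
    let p ← elem (σ q)
    let r ← elem (s q)
    let y ← elem (p.mulPhase r)
    elem (z * y)) (List.finRange n) 1

/-- A copy of the word `s` with the entry at `a` replaced by `p`. -/
def writeT {n : ℕ} (s : Word n) (a : Fin n) (p : Pauli) : Timed (Word n) :=
  tabulate fun q => do
    if ← elem (decide (q = a)) then elem p else elem (s q)

/-- `V† s V` for a Clifford gate `V`: a sign and a word. -/
def conjGateT {n : ℕ} (s : Word n) : Clifford n → Timed (ℂ × Word n)
  | .had a => do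
      let p ← elem (s a)
      let p' ← elem p.hadWord
      let y ← elem p.hadSign
      let t ← writeT s a p'
      elem (y, t)
  | .phase a => do
      let p ← elem (s a)
      let p' ← elem p.phaseWord
      let y ← elem p.phaseSign
      let t ← writeT s a p'
      elem (y, t)
  | .cnot a b _ => do
      let p ← elem (s a)
      let r ← elem (s b)
      let pr ← elem (p.cnotWord r)
      let y ← elem (p.cnotSign r)
      let t ← writeT s a pr.1
      let t ← writeT t b pr.2
      elem (y, t)

/-- Conjugation of a linear combination of words, given as a list, with a Clifford gate. -/
def cliffordT {n : ℕ} (V : Clifford n) : List (ℂ × Word n) → Timed (List (ℂ × Word n))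
  | [] => elem []
  | a :: l => do
      let a ← elem a
      let u ← conjGateT a.2 V
      let z ← elem (a.1 * u.1)
      let l ← cliffordT V l
      let b ← elem (z, u.2)
      elem (b :: l)

/-- Conjugation of a linear combination of words, given as a list, with a rotation gate
`U = exp(-i (θ / 2) σ)`: a word `s` that commutes with `σ` stays, one that anti-commutes branches,
`U† s U = cos θ • s + sin θ • i σ s`. -/
def rotateT {n : ℕ} (σ : Word n) (θ : ℝ) : List (ℂ × Word n) → Timed (List (ℂ × Word n))
  | [] => elem []
  | a :: l => do
      let a ← elem a
      let l ← rotateT σ θ l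
      if ← antiT σ a.2 then do
        let x ← elem (Real.cos θ)
        let z ← elem (a.1 * (x : ℂ))
        let y ← elem (Real.sin θ)
        let y ← elem (a.1 * (y : ℂ))
        let y ← elem (y * Complex.I)
        let f ← mulPhaseT σ a.2
        let y ← elem (y * f)
        let t ← mulWordT σ a.2
        let b ← elem (y, t)
        let l ← elem (b :: l)
        let b ← elem (z, a.2)
        elem (b :: l)
      else elem (a :: l)

/-- The candidates for `s_{i-1}` that a layer allows for a given `s_i = s`, each with the
coefficient of that transition. -/
def candidatesT {n : ℕ} (l : Layer n) (θ : Fin l.R → ℝ) (s : Word n) :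
    Timed (List (ℂ × Word n)) := do
  let b ← elem ((1 : ℂ), s)
  let u ← elem [b]
  let u ← loop (fun u j => do
    let σ ← elem (l.word j)
    let t ← elem (θ j)
    rotateT σ t u) (List.finRange l.R) u
  loop (fun u k => do
    let V ← elem (l.gate k)
    cliffordT V u) (List.finRange l.C) u

/-- `Tr (s ρ)`, with `Tr (s r |a⟩⟨b|) = r ∏_q ⟨b_q| s_q |a_q⟩`. -/
def expectationT {n : ℕ} (s : Word n) (ρ : StateData n) : Timed ℂ :=
  sumLoop (fun e =>
    loop (fun z q => do
      let p ← elem (s q)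
      let a ← elem (e.2.1 q)
      let b ← elem (e.2.2 q)
      let y ← elem (p.mat b a)
      elem (z * y)) (List.finRange n) e.1) ρ

/-- The test of a new word of weight `w`, with `i` words still to be chosen, when the words before
it have total weight `acc`: every later word has weight at least one unless the new word is the
identity. -/
def keepT (M i acc w : ℕ) : Timed Bool := do
  let b ← elem (decide (w = 0))
  let r ← elem (if b then 0 else i)
  let t ← elem (acc + w)
  let t ← elem (t + r)
  elem (decide (t ≤ M))

/-- The nested loops of the method. The words `s_L, …, s_i = s` are chosen, of total weight `acc`;
`z` is the product of the factors found so far. The result is the sum of the contributions of all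
the paths of weight at most `M` that continue this choice. -/
def descend {n L : ℕ} (c : Circuit n L) (lam : ℝ) (ρ : StateData n) (M : ℕ) (θ : Params c) :
    (i : ℕ) → i ≤ L → ℕ → Word n → ℂ → Timed ℂ
  | 0, _, acc, s, z => do
      let x ← elem (1 - lam)
      let d ← power (x : ℂ) acc
      let e ← expectationT s ρ
      let y ← elem (z * d)
      elem (y * e)
  | i + 1, hi, acc, s, z => do
      let u ← candidatesT (c ⟨i, hi⟩) (θ ⟨i, hi⟩) s
      sumLoop (fun a => do
        let w ← weightT a.2
        if ← keepT M i acc w then do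
          let acc' ← elem (acc + w)
          let z' ← elem (z * a.1)
          descend c lam ρ M θ i (Nat.le_of_succ_le hi) acc' a.2 z'
        else elem 0) u

/-- The simulation method with cutoff `M`: the words of `H` are the candidates for `s_L`. -/
def method {n L : ℕ} (c : Circuit n L) (lam : ℝ) (H : HamData n) (ρ : StateData n) (M : ℕ)
    (θ : Params c) : Timed ℂ :=
  sumLoop (fun a => do
    let w ← weightT a.2
    if ← keepT M L 0 w then descend c lam ρ M θ L le_rfl w a.2 (a.1 : ℂ)
    else elem 0) H

/-! ### The ansatz with one layer of `R_Z` and many layers of `R_X` -/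

theorem wordSupport_singleWord {n : ℕ} (q : Fin n) (p : Pauli) :
    wordSupport (singleWord q p) ⊆ {q} := by
  intro r hr
  refine Finset.mem_singleton.mpr ?_
  by_contra h
  have hr' : singleWord q p r ≠ Pauli.I := (Finset.mem_filter.mp hr).2
  exact hr' (by rw [singleWord, Function.update_of_ne h, idWord])

theorem singleWord_ne {n : ℕ} (q : Fin n) {p : Pauli} (hp : p ≠ Pauli.I) :
    singleWord q p ≠ idWord n := by
  intro h
  exact hp (by simpa [singleWord, idWord] using congrFun h q)

/-- The layer of rotation gates about `p` on every qubit. -/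
def fullLayer (n : ℕ) (p : Pauli) (hp : p ≠ Pauli.I) : Layer n where
  R := n
  word j := singleWord j p
  C := 0
  gate := Fin.elim0
  word_ne j := singleWord_ne j hp
  rot_disjoint j j' h := Finset.disjoint_of_subset_left (wordSupport_singleWord j p)
    (Finset.disjoint_of_subset_right (wordSupport_singleWord j' p)
      (by simpa using h))
  gate_disjoint k := k.elim0
  rot_gate_disjoint _ k := k.elim0

/-- The layer with a single rotation gate about `p`, on qubit `q`. -/
def oneLayer {n : ℕ} (q : Fin n) (p : Pauli) (hp : p ≠ Pauli.I) : Layer n where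
  R := 1
  word _ := singleWord q p
  C := 0
  gate := Fin.elim0
  word_ne _ := singleWord_ne q hp
  rot_disjoint j j' h := absurd (Subsingleton.elim j j') h
  gate_disjoint k := k.elim0
  rot_gate_disjoint _ k := k.elim0

/-- The layers of the ansatz: `R_Z` on each qubit, then `R_X` on each qubit, then `R_X` on the
first qubit in all the remaining layers. -/
def ansatzLayer (n : ℕ) [NeZero n] : ℕ → Layer n
  | 0 => fullLayer n Pauli.Z (by decide)
  | 1 => fullLayer n Pauli.X (by decide)
  | _ + 2 => oneLayer 0 Pauli.X (by decide)

/-- The ansatz with `L` layers. -/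
def ansatz (n L : ℕ) [NeZero n] : Circuit n L := fun i => ansatzLayer n i

/-- The Hamiltonian `Z₁ + Y₁`. -/
def ansatzH (n : ℕ) [NeZero n] : HamData n :=
  [(1, singleWord 0 Pauli.Z), (1, singleWord 0 Pauli.Y)]

/-- The initial state `|0⋯0⟩⟨0⋯0|`. -/
def zeroState (n : ℕ) : StateData n := [(1, fun _ => 0, fun _ => 0)]

end PauliPath

end

/-! The normalized Pauli words are an orthonormal basis for the trace form, and depolarizing noise
is diagonal in it: a word is damped by `1 - lam` for each non-identity factor. Expanding the state
in this basis before the first layer and after every layer writes the noisy cost as the sum over all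
Pauli paths (`noisyCost_eq_sum`), and the term of a path `s` is `(1 - lam) ^ |s|` times its
noiseless term (`noisyTerm_eq_pow`).

In a generating circuit the terms of distinct paths are orthogonal in `L²` of the angles
(`integral_noisyTerm_mul`). This follows from symmetries of the angle law under which each term only
changes sign. Turning one angle by `π` multiplies the term by the commutation sign of the gate's
word with the path word before the layer. Reversing the angles in a layer of the gates that
anti-commute with a word `P` multiplies it by the sign of `P` with the word after the layer and the
sign of `V† P V` with the word before it, `V` being the Clifford part. If two paths share all these
signs, the reflections carry each comparison back to the words `s 0` and `s' 0`, and the half turns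
show that `s 0 * s' 0` commutes with every effected word, hence with everything; so the paths agree
(`path_eq_of_signs`). By Pythagoras the truncation error is at most `(1 - lam) ^ (2 (M + 1))` times
the noiseless second moment, which is at most the squared operator norm of `H` (`mse_le_opNorm`). A
cutoff of order `1 / lam` therefore suffices.

Running time: only gates that anti-commute with `s_i` branch, each meets the support of `s_i`, and
the gates are disjoint, so there are at most `2 ^ |s_i|` candidates. These factors multiply to at
most `2 ^ M` along the search (`descend_steps_le`), and `M = O(log L)` makes this polynomial.
Pruning loses nothing, since a layer never leads from a non-identity word to the identity.

In the ansatz every contributing path keeps one non-identity factor in each of its `L + 1` words.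
Cutoffs `M ≤ L` thus give the zero function, while the cost is `(1 - lam) ^ (L + 1) * (cos Θ - sin
Θ)` with `Θ` the total `R_X` angle on the first qubit, of mean square `(1 - lam) ^ (2 (L + 1))`. For
`lam ≤ K / L` this is bounded below, so a small error forces `M > L`; then nothing on these paths is
pruned and each `R_X` layer doubles their number (`mse_ansatz`, `le_method_steps_ansatz`). -/

namespace PauliPath

/-! ### Tensor products of single-qubit operators. -/

section TensorAlgebra

variable {n : ℕ}

/-- The tensor product of single-qubit operators. -/
def tens (f : Fin n → Matrix (Fin 2) (Fin 2) ℂ) : Op n :=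
  Matrix.of fun x y => ∏ q, f q (x q) (y q)

theorem tens_apply (f : Fin n → Matrix (Fin 2) (Fin 2) ℂ) (x y : Bits n) :
    tens f x y = ∏ q, f q (x q) (y q) := rfl

theorem tens_mul (f g : Fin n → Matrix (Fin 2) (Fin 2) ℂ) :
    tens f * tens g = tens fun q => f q * g q := by
  ext x y
  simp only [Matrix.mul_apply, tens_apply, ← Finset.prod_mul_distrib]
  rw [Finset.prod_univ_sum, Fintype.piFinset_univ]

theorem trace_tens (f : Fin n → Matrix (Fin 2) (Fin 2) ℂ) :
    (tens f).trace = ∏ q, (f q).trace := by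
  simp only [Matrix.trace, Matrix.diag_apply, tens_apply]
  rw [Finset.prod_univ_sum, Fintype.piFinset_univ]

theorem tens_one : tens (fun _ : Fin n => 1) = 1 := by
  ext x y
  simp only [tens_apply, Matrix.one_apply, Finset.prod_ite_zero, Finset.prod_const_one,
    Finset.mem_univ, true_implies, funext_iff]

theorem conjTranspose_tens (f : Fin n → Matrix (Fin 2) (Fin 2) ℂ) :
    (tens f)ᴴ = tens fun q => (f q)ᴴ := by
  ext x y
  simp [tens_apply, Matrix.conjTranspose_apply]

theorem tens_smul (z : Fin n → ℂ) (f : Fin n → Matrix (Fin 2) (Fin 2) ℂ) :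
    (tens fun q => z q • f q) = (∏ q, z q) • tens f := by
  ext x y
  simp [tens_apply, Finset.prod_mul_distrib]

theorem onQubit_eq_tens (a : Fin n) (u : Matrix (Fin 2) (Fin 2) ℂ) :
    onQubit a u = tens (Function.update (fun _ => 1) a u) := by
  ext x y
  simp only [onQubit, Matrix.of_apply, tens_apply]
  rw [← Finset.mul_prod_erase _ _ (Finset.mem_univ a), Function.update_self]
  have : ∏ q ∈ Finset.univ.erase a,
      Function.update (fun _ : Fin n => (1 : Matrix (Fin 2) (Fin 2) ℂ)) a u q (x q) (y q) =
      ∏ q ∈ Finset.univ.erase a, if x q = y q then 1 else 0 :=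
    Finset.prod_congr rfl fun q hq => by
      rw [Function.update_of_ne (Finset.ne_of_mem_erase hq), Matrix.one_apply]
  rw [this, Finset.prod_ite_zero]
  simp

end TensorAlgebra

/-! ### Multiplication, commutation signs and completeness of Pauli words. -/

section Words

variable {n : ℕ}

theorem Pauli.mat_mul (p r : Pauli) : p.mat * r.mat = p.mulPhase r • (p.mul r).mat := by
  cases p <;> cases r <;> ext i j <;> fin_cases i <;> fin_cases j <;>
    simp [Pauli.mat, Pauli.mulPhase, Pauli.mul, Matrix.mul_apply, Fin.sum_univ_two]

theorem Pauli.mat_conjTranspose (p : Pauli) : p.matᴴ = p.mat := by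
  cases p <;> ext i j <;> fin_cases i <;> fin_cases j <;> simp [Pauli.mat]

theorem Pauli.trace_mat (p : Pauli) : p.mat.trace = if p = .I then 2 else 0 := by
  cases p <;> simp [Pauli.mat, Matrix.trace, Fin.sum_univ_two]

/-- The commutation sign of two single-qubit Pauli matrices. -/
def Pauli.sgn (p r : Pauli) : ℂ := if p.anti r then -1 else 1

theorem Pauli.mat_mul_comm (p r : Pauli) : p.mat * r.mat = p.sgn r • (r.mat * p.mat) := by
  rw [Pauli.mat_mul, Pauli.mat_mul]
  cases p <;> cases r <;> simp [Pauli.mulPhase, Pauli.mul, Pauli.sgn, Pauli.anti]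

theorem Pauli.sgn_comm (p r : Pauli) : p.sgn r = r.sgn p := by
  cases p <;> cases r <;> rfl

theorem Pauli.sgn_mul_self (p r : Pauli) : p.sgn r * p.sgn r = 1 := by
  unfold Pauli.sgn; split_ifs <;> norm_num

theorem Pauli.sgn_mul_right (p r t : Pauli) : p.sgn (r.mul t) = p.sgn r * p.sgn t := by
  cases p <;> cases r <;> cases t <;> simp [Pauli.sgn, Pauli.anti, Pauli.mul]

/-- The signs with `X` and `Z` alone already separate the four Pauli matrices. -/
theorem Pauli.eq_of_sgn {p r : Pauli} (h : ∀ t : Pauli, t.sgn p = t.sgn r) : p = r := by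
  have hX := h .X
  have hZ := h .Z
  have h1 : (-1 : ℂ) ≠ 1 := by norm_num
  cases p <;> cases r <;> simp [Pauli.sgn, Pauli.anti, h1, h1.symm] at hX hZ ⊢

/-- The commutation sign of two Pauli words. -/
def sgn (v w : Word n) : ℂ := ∏ q, (v q).sgn (w q)

/-- The product of two Pauli words, up to its phase. -/
def wordMul (v w : Word n) : Word n := fun q => (v q).mul (w q)

/-- The phase of the product of two Pauli words. -/
def wordPhase (v w : Word n) : ℂ := ∏ q, (v q).mulPhase (w q)

theorem wordOp_eq_tens (w : Word n) : wordOp w = tens fun q => (w q).mat := rfl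

theorem wordOp_mul (v w : Word n) :
    wordOp v * wordOp w = wordPhase v w • wordOp (wordMul v w) := by
  simp only [wordOp_eq_tens, tens_mul, Pauli.mat_mul, tens_smul, wordPhase, wordMul]

theorem wordOp_mul_comm (v w : Word n) :
    wordOp v * wordOp w = sgn v w • (wordOp w * wordOp v) := by
  simp only [wordOp_eq_tens, tens_mul, sgn, ← tens_smul, ← Pauli.mat_mul_comm]

theorem wordOp_conjTranspose (w : Word n) : (wordOp w)ᴴ = wordOp w := by
  simp only [wordOp_eq_tens, conjTranspose_tens, Pauli.mat_conjTranspose]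

theorem wordOp_idWord : wordOp (idWord n) = 1 := tens_one

theorem wordOp_mul_self (w : Word n) : wordOp w * wordOp w = 1 := by
  rw [wordOp_mul, ← wordOp_idWord]
  have h1 : wordPhase w w = 1 :=
    Finset.prod_eq_one fun q _ => by cases w q <;> rfl
  have h2 : wordMul w w = idWord n := funext fun q => by
    simp only [wordMul, idWord]; cases w q <;> rfl
  rw [h1, h2, one_smul]

theorem sgn_comm (v w : Word n) : sgn v w = sgn w v :=
  Finset.prod_congr rfl fun _ _ => Pauli.sgn_comm _ _

theorem sgn_mul_self (v w : Word n) : sgn v w * sgn v w = 1 := by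
  rw [sgn, ← Finset.prod_mul_distrib]
  exact Finset.prod_eq_one fun _ _ => Pauli.sgn_mul_self _ _

theorem sgn_eq_or (v w : Word n) : sgn v w = 1 ∨ sgn v w = -1 :=
  mul_self_eq_one_iff.mp (sgn_mul_self v w)

theorem sgn_wordMul (v w w' : Word n) : sgn v (wordMul w w') = sgn v w * sgn v w' := by
  simp only [sgn, wordMul, Pauli.sgn_mul_right, Finset.prod_mul_distrib]

theorem Pauli.sgn_I (p : Pauli) : p.sgn .I = 1 := by cases p <;> rfl

theorem Pauli.I_sgn (p : Pauli) : Pauli.sgn .I p = 1 := by cases p <;> rfl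

theorem sgn_singleWord (q : Fin n) (p : Pauli) (w : Word n) :
    sgn (singleWord q p) w = p.sgn (w q) := by
  rw [sgn, Finset.prod_eq_single q]
  · simp [singleWord]
  · intro r _ hr
    rw [singleWord, Function.update_of_ne hr, idWord, Pauli.I_sgn]
  · simp

theorem eq_of_sgn {w w' : Word n} (h : ∀ v, sgn v w = sgn v w') : w = w' :=
  funext fun q => Pauli.eq_of_sgn fun t => by
    simpa only [sgn_singleWord] using h (singleWord q t)

theorem sgn_eq_one_of_disjoint {v w : Word n}
    (h : Disjoint (wordSupport v) (wordSupport w)) : sgn v w = 1 :=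
  Finset.prod_eq_one fun q _ => by
    by_cases hv : v q = .I
    · rw [hv, Pauli.I_sgn]
    · by_cases hw : w q = .I
      · rw [hw, Pauli.sgn_I]
      · exact absurd (Finset.mem_filter.mpr ⟨Finset.mem_univ q, hw⟩)
          (Finset.disjoint_left.mp h (Finset.mem_filter.mpr ⟨Finset.mem_univ q, hv⟩))

theorem wordOp_commute_of_disjoint {v w : Word n}
    (h : Disjoint (wordSupport v) (wordSupport w)) : Commute (wordOp v) (wordOp w) := by
  rw [Commute, SemiconjBy, wordOp_mul_comm, sgn_eq_one_of_disjoint h, one_smul]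

theorem wordOp_conj (v w : Word n) : wordOp v * wordOp w * wordOp v = sgn v w • wordOp w := by
  rw [wordOp_mul_comm, smul_mul_assoc, mul_assoc, wordOp_mul_self, mul_one]

theorem trace_wordOp (w : Word n) :
    (wordOp w).trace = if w = idWord n then 2 ^ n else 0 := by
  simp only [wordOp_eq_tens, trace_tens, Pauli.trace_mat, Finset.prod_ite_zero,
    Finset.mem_univ, true_implies, Finset.prod_const, Finset.card_univ, Fintype.card_fin,
    funext_iff, idWord]

theorem trace_wordOp_mul (v w : Word n) :
    (wordOp v * wordOp w).trace = if v = w then 2 ^ n else 0 := by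
  split_ifs with h
  · rw [h, wordOp_mul_self, ← wordOp_idWord, trace_wordOp, if_pos rfl]
  · rw [wordOp_mul, Matrix.trace_smul, trace_wordOp, if_neg, smul_zero]
    intro h'
    apply h
    funext q
    have := congrFun h' q
    simp only [wordMul, idWord] at this
    revert this
    cases v q <;> cases w q <;> simp [Pauli.mul]

/-- The entrywise form of `∑ p ⊗ p = 2 SWAP`; its tensor power is the completeness relation behind
the expansion in words. -/
theorem Pauli.sum_mat_mul (a b x y : Fin 2) :
    ∑ p : Pauli, p.mat a b * p.mat x y = if a = y ∧ b = x then 2 else 0 := by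
  have : (Finset.univ : Finset Pauli) = {.I, .X, .Y, .Z} := rfl
  rw [this]
  fin_cases a <;> fin_cases b <;> fin_cases x <;> fin_cases y <;>
    simp [Pauli.mat] <;> norm_num

theorem sum_wordOp_mul (a b x y : Bits n) :
    ∑ w : Word n, wordOp w a b * wordOp w x y = if a = y ∧ b = x then 2 ^ n else 0 := by
  simp only [wordOp, Matrix.of_apply, ← Finset.prod_mul_distrib]
  have := Finset.prod_univ_sum (fun _ : Fin n => (Finset.univ : Finset Pauli))
    (fun q p => p.mat (a q) (b q) * p.mat (x q) (y q))
  rw [Fintype.piFinset_univ] at this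
  rw [← this]
  simp only [Pauli.sum_mat_mul, Finset.prod_ite_zero, Finset.mem_univ, true_implies,
    Finset.prod_const, Finset.card_univ, Fintype.card_fin, funext_iff, forall_and]

/-- Expansion of an operator in Pauli words. -/
theorem sum_trace_wordOp_smul (A : Op n) :
    ∑ w : Word n, (wordOp w * A).trace • wordOp w = (2 : ℂ) ^ n • A := by
  ext x y
  simp only [Matrix.sum_apply, Matrix.smul_apply, smul_eq_mul, Matrix.trace, Matrix.diag_apply,
    Matrix.mul_apply, Finset.sum_mul]
  rw [Finset.sum_comm]
  simp_rw [Finset.sum_comm (s := (Finset.univ : Finset (Word n)))]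
  have : ∀ a b : Bits n, ∑ w : Word n, wordOp w a b * A b a * wordOp w x y =
      A b a * if a = y ∧ b = x then 2 ^ n else 0 := fun a b => by
    rw [← sum_wordOp_mul, Finset.mul_sum]
    exact Finset.sum_congr rfl fun w _ => by ring
  simp only [this]
  rw [Finset.sum_eq_single y, Finset.sum_eq_single x]
  · simp [mul_comm]
  · intro b _ hb; simp [hb]
  · simp
  · intro a _ ha; simp [ha]
  · simp

theorem sqrt_two_pow_mul_self (n : ℕ) :
    (((Real.sqrt 2 : ℝ) : ℂ) ^ n)⁻¹ * (((Real.sqrt 2 : ℝ) : ℂ) ^ n)⁻¹ = ((2 : ℂ) ^ n)⁻¹ := by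
  rw [← mul_inv, ← mul_pow, ← Complex.ofReal_mul, Real.mul_self_sqrt (by norm_num)]
  norm_num

/-- The resolution of the identity that is inserted between layers to produce Pauli paths. -/
theorem sum_trace_normOp_smul (A : Op n) :
    ∑ w : Word n, (normOp w * A).trace • normOp w = A := by
  simp only [normOp, smul_mul_assoc, Matrix.trace_smul, smul_eq_mul, smul_smul]
  have : ∀ w : Word n, (((Real.sqrt 2 : ℝ) : ℂ) ^ n)⁻¹ * (wordOp w * A).trace *
      (((Real.sqrt 2 : ℝ) : ℂ) ^ n)⁻¹ = ((2 : ℂ) ^ n)⁻¹ * (wordOp w * A).trace := fun w => by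
    rw [← sqrt_two_pow_mul_self]; ring
  simp only [this]
  simp only [mul_smul, ← Finset.smul_sum, sum_trace_wordOp_smul]
  rw [smul_smul, inv_mul_cancel₀ (by positivity), one_smul]

end Words

/-! ### Values of timed computations. -/

section Timed

@[simp] theorem pure_val {α : Type} (a : α) : (pure a : Timed α).val = a := rfl

@[simp] theorem pure_steps {α : Type} (a : α) : (pure a : Timed α).steps = 0 := rfl

@[simp] theorem bind_val {α β : Type} (x : Timed α) (f : α → Timed β) :
    (x >>= f).val = (f x.val).val := rfl

@[simp] theorem bind_steps {α β : Type} (x : Timed α) (f : α → Timed β) :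
    (x >>= f).steps = x.steps + (f x.val).steps := rfl

@[simp] theorem elem_val {α : Type} (a : α) : (elem a).val = a := rfl

@[simp] theorem elem_steps {α : Type} (a : α) : (elem a).steps = 1 := rfl

theorem loop_val {α β : Type} (g : β → α → Timed β) (l : List α) (b : β) :
    (loop g l b).val = l.foldl (fun b a => (g b a).val) b := by
  induction l generalizing b with
  | nil => rfl
  | cons a l ih => simp [loop, ih]

@[simp] theorem tabulate_val {n : ℕ} {α : Type} (g : Fin n → Timed α) :
    (tabulate g).val = fun q => (g q).val := rfl

theorem sumLoop_val {α : Type} (g : α → Timed ℂ) (l : List α) :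
    (sumLoop g l).val = (l.map fun a => (g a).val).sum := by
  induction l with
  | nil => rfl
  | cons a l ih => simp [sumLoop, ih]

theorem power_val (x : ℂ) (k : ℕ) : (power x k).val = x ^ k := by
  induction k with
  | zero => rfl
  | succ k ih => simp [power, ih, pow_succ']

end Timed

/-! ### Conjugation of words by Clifford and rotation gates. -/

section Gates

variable {n : ℕ}

theorem writeT_val (s : Word n) (a : Fin n) (p : Pauli) :
    (writeT s a p).val = Function.update s a p := by
  funext q
  by_cases h : q = a <;> simp [writeT, h]

theorem onQubit_conj {a : Fin n} {u : Matrix (Fin 2) (Fin 2) ℂ} {s : Word n} {c : ℂ} {p : Pauli}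
    (h : uᴴ * (s a).mat * u = c • p.mat) :
    (onQubit a u)ᴴ * wordOp s * onQubit a u = c • wordOp (Function.update s a p) := by
  rw [onQubit_eq_tens, wordOp_eq_tens, wordOp_eq_tens, conjTranspose_tens, tens_mul, tens_mul]
  have hc : c = ∏ q, (Function.update (fun _ : Fin n => (1 : ℂ)) a c) q := by
    rw [Finset.prod_update_of_mem (Finset.mem_univ a)]; simp
  conv_rhs => rw [hc]
  rw [← tens_smul]
  congr 1
  funext q
  by_cases hq : q = a
  · subst hq; simpa using h
  · simp [Function.update_of_ne hq]

theorem onQubit_unitary {a : Fin n} {u : Matrix (Fin 2) (Fin 2) ℂ} (hu : uᴴ * u = 1) :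
    (onQubit a u)ᴴ * onQubit a u = 1 := by
  rw [onQubit_eq_tens, conjTranspose_tens, tens_mul, ← tens_one]
  congr 1
  funext q
  by_cases hq : q = a
  · subst hq; simpa using hu
  · simp [Function.update_of_ne hq]

theorem inv_sqrt_two_mul_self :
    (((Real.sqrt 2 : ℝ) : ℂ))⁻¹ * (((Real.sqrt 2 : ℝ) : ℂ))⁻¹ = 1 / 2 := by
  simpa using sqrt_two_pow_mul_self 1

theorem had_conj (A : Matrix (Fin 2) (Fin 2) ℂ) :
    ((((Real.sqrt 2 : ℝ) : ℂ))⁻¹ • !![1, 1; 1, -1])ᴴ * A *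
      ((((Real.sqrt 2 : ℝ) : ℂ))⁻¹ • !![1, 1; 1, -1]) =
      (1 / 2 : ℂ) • (!![1, 1; 1, -1] * A * !![1, 1; 1, -1]) := by
  have h : (!![1, 1; 1, -1] : Matrix (Fin 2) (Fin 2) ℂ)ᴴ = !![1, 1; 1, -1] := by
    ext i j; fin_cases i <;> fin_cases j <;> simp
  rw [Matrix.conjTranspose_smul, h, smul_mul_assoc, smul_mul_assoc, mul_smul_comm, smul_smul,
    ← inv_sqrt_two_mul_self]
  simp

theorem had_unitary :
    ((((Real.sqrt 2 : ℝ) : ℂ))⁻¹ • !![1, 1; 1, -1] : Matrix (Fin 2) (Fin 2) ℂ)ᴴ *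
      ((((Real.sqrt 2 : ℝ) : ℂ))⁻¹ • !![1, 1; 1, -1]) = 1 := by
  have := had_conj 1
  rw [mul_one, mul_one] at this
  rw [this]
  ext i j
  fin_cases i <;> fin_cases j <;> simp <;> norm_num

theorem phase_unitary :
    (!![1, 0; 0, Complex.I] : Matrix (Fin 2) (Fin 2) ℂ)ᴴ * !![1, 0; 0, Complex.I] = 1 := by
  ext i j
  fin_cases i <;> fin_cases j <;> simp [Matrix.mul_apply, Fin.sum_univ_two]

/-- The permutation of the computational basis effected by CNOT. -/
def cnotBits (a b : Fin n) (y : Bits n) : Bits n := Function.update y b (y a + y b)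

theorem cnotBits_cnotBits {a b : Fin n} (hab : a ≠ b) (y : Bits n) :
    cnotBits a b (cnotBits a b y) = y := by
  funext q
  by_cases hq : q = b
  · subst hq
    simp only [cnotBits, Function.update_self, Function.update_of_ne hab]
    generalize y a = u
    generalize y q = v
    revert u v
    decide
  · simp [cnotBits, Function.update_of_ne hq]

theorem cnot_conj {a b : Fin n} (hab : a ≠ b) (A : Op n) (x y : Bits n) :
    ((Clifford.cnot a b hab).opᴴ * A * (Clifford.cnot a b hab).op) x y =
      A (cnotBits a b x) (cnotBits a b y) := by
  have h : ∀ z y : Bits n, (Clifford.cnot a b hab).op z y =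
      if z = cnotBits a b y then 1 else 0 := fun _ _ => rfl
  simp [Matrix.mul_apply, h]

theorem prod_split_pair {a b : Fin n} (hab : a ≠ b) (f : Fin n → ℂ) :
    ∏ q, f q = f a * f b * ∏ q ∈ (Finset.univ.erase a).erase b, f q := by
  rw [mul_assoc, Finset.mul_prod_erase _ _ (Finset.mem_erase.mpr ⟨hab.symm, Finset.mem_univ b⟩),
    Finset.mul_prod_erase _ _ (Finset.mem_univ a)]

/-- CNOT permutes the computational basis, so conjugation by it only relabels entries, and the
tables can be verified entry by entry. -/
theorem Pauli.cnot_mat (p r : Pauli) (x y x' y' : Fin 2) :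
    p.mat x y * r.mat (x + x') (y + y') =
      p.cnotSign r * ((p.cnotWord r).1.mat x y * (p.cnotWord r).2.mat x' y') := by
  have h2 : (1 : Fin 2) + 1 = 0 := rfl
  revert x y x' y'
  cases p <;> cases r <;> simp only [Fin.forall_fin_two] <;>
    simp [Pauli.mat, Matrix.one_apply, Pauli.cnotSign, Pauli.cnotWord, Pauli.cnotControl, Pauli.cnotTarget,
      Pauli.mul, Pauli.mulPhase, h2]

/-- Besides the correctness of the tables, this gives the Clifford property of the gates, on which
the reflection symmetry rests. -/
theorem conjGateT_spec (V : Clifford n) (s : Word n) :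
    V.opᴴ * wordOp s * V.op = (conjGateT s V).val.1 • wordOp (conjGateT s V).val.2 := by
  cases V with
  | had a =>
    simp only [conjGateT, bind_val, elem_val, writeT_val]
    refine onQubit_conj ?_
    rw [had_conj]
    cases s a <;> ext i j <;> fin_cases i <;> fin_cases j <;>
      simp [Pauli.mat, Pauli.hadSign, Pauli.hadWord] <;> ring
  | phase a =>
    simp only [conjGateT, bind_val, elem_val, writeT_val]
    refine onQubit_conj ?_
    cases s a <;> ext i j <;> fin_cases i <;> fin_cases j <;>
      simp [Pauli.mat, Pauli.phaseSign, Pauli.phaseWord, Matrix.mul_apply, Fin.sum_univ_two]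
  | cnot a b hab =>
    simp only [conjGateT, bind_val, elem_val, writeT_val]
    ext x y
    rw [cnot_conj]
    simp only [Matrix.smul_apply, smul_eq_mul, wordOp, Matrix.of_apply]
    rw [prod_split_pair hab, prod_split_pair hab]
    simp only [Function.update_self, Function.update_of_ne hab, cnotBits]
    rw [Pauli.cnot_mat, mul_assoc (Pauli.cnotSign _ _)]
    refine congr_arg₂ (· * ·) rfl (congr_arg₂ (· * ·) rfl <| Finset.prod_congr rfl fun q hq => ?_)
    have hb : q ≠ b := Finset.ne_of_mem_erase hq
    have ha : q ≠ a := Finset.ne_of_mem_erase (Finset.mem_of_mem_erase hq)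
    simp [Function.update_of_ne ha, Function.update_of_ne hb]

theorem Clifford.op_unitary (V : Clifford n) : V.opᴴ * V.op = 1 := by
  cases V with
  | had a => exact onQubit_unitary had_unitary
  | phase a => exact onQubit_unitary phase_unitary
  | cnot a b hab =>
    ext x y
    have := cnot_conj hab 1 x y
    rw [mul_one] at this
    rw [this, Matrix.one_apply, Matrix.one_apply]
    have h : cnotBits a b x = cnotBits a b y ↔ x = y :=
      (Function.Involutive.injective (cnotBits_cnotBits hab)).eq_iff
    simp only [h]

theorem Clifford.op_mem_unitary (V : Clifford n) : V.op ∈ unitary (Op n) := by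
  rw [Unitary.mem_iff]
  exact ⟨V.op_unitary, mul_eq_one_comm.mp V.op_unitary⟩

theorem rotation_eq (σ : Word n) (θ : ℝ) :
    rotation σ θ = (Real.cos (θ / 2) : ℂ) • (1 : Op n) -
      (Complex.I * (Real.sin (θ / 2) : ℂ)) • wordOp σ := by
  -- Since `σ² = 1`, this is the functional calculus of `σ`: the first coordinate acts on the
  -- eigenspace of `1`, the second on that of `-1`. A continuous ring homomorphism commutes with
  -- `exp`, which reduces the claim to two scalar exponentials.
  let f : ℂ × ℂ →+* Op n :=
    { toFun := fun p => ((p.1 + p.2) / 2) • 1 + ((p.1 - p.2) / 2) • wordOp σ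
      map_one' := by simp
      map_zero' := by simp
      map_add' := fun p q => by simp only [Prod.fst_add, Prod.snd_add]; module
      map_mul' := fun p q => by
        simp only [Prod.fst_mul, Prod.snd_mul, mul_add, add_mul, smul_mul_assoc, mul_smul_comm,
          one_mul, mul_one, wordOp_mul_self]
        match_scalars <;> ring }
  have hf : Continuous f := by
    change Continuous fun p : ℂ × ℂ => ((p.1 + p.2) / 2) • (1 : Op n) +
      ((p.1 - p.2) / 2) • wordOp σ
    fun_prop
  set z : ℂ := -Complex.I * ((θ / 2 : ℝ) : ℂ) with hz
  have h1 : z • wordOp σ = f (z, -z) := by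
    change _ = ((z + -z) / 2) • (1 : Op n) + ((z - -z) / 2) • wordOp σ
    module
  have h2 : NormedSpace.exp ((z, -z) : ℂ × ℂ) = (Complex.exp z, Complex.exp (-z)) := by
    rw [Complex.exp_eq_exp_ℂ]
    exact Prod.ext (Prod.fst_exp _) (Prod.snd_exp _)
  rw [rotation, ← hz, h1]
  have h5 : NormedSpace.exp (f (z, -z)) = f (NormedSpace.exp (z, -z)) := by
    let _ : NormedRing (Op n) := Matrix.linftyOpNormedRing
    exact (NormedSpace.map_exp f hf _).symm
  rw [h5, h2]
  change ((Complex.exp z + Complex.exp (-z)) / 2) • (1 : Op n) +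
    ((Complex.exp z - Complex.exp (-z)) / 2) • wordOp σ = _
  have h3 : Complex.exp z = (Real.cos (θ / 2) : ℂ) - (Real.sin (θ / 2) : ℂ) * Complex.I := by
    rw [hz, neg_mul, mul_comm, ← neg_mul, ← Complex.ofReal_neg, Complex.exp_mul_I,
      ← Complex.ofReal_cos, ← Complex.ofReal_sin, Real.cos_neg, Real.sin_neg]
    push_cast
    ring
  have h4 : Complex.exp (-z) = (Real.cos (θ / 2) : ℂ) + (Real.sin (θ / 2) : ℂ) * Complex.I := by
    rw [hz, neg_mul, neg_neg, mul_comm, Complex.exp_mul_I, ← Complex.ofReal_cos,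
      ← Complex.ofReal_sin]
  rw [h3, h4]
  module

theorem rotation_conjTranspose (σ : Word n) (θ : ℝ) :
    (rotation σ θ)ᴴ = (Real.cos (θ / 2) : ℂ) • (1 : Op n) +
      (Complex.I * (Real.sin (θ / 2) : ℂ)) • wordOp σ := by
  rw [rotation_eq, Matrix.conjTranspose_sub, Matrix.conjTranspose_smul, Matrix.conjTranspose_smul,
    wordOp_conjTranspose, Matrix.conjTranspose_one]
  simp only [Complex.star_def, map_mul, Complex.conj_ofReal, Complex.conj_I, neg_mul, neg_smul,
    sub_neg_eq_add]

theorem rotation_unitary (σ : Word n) (θ : ℝ) : (rotation σ θ)ᴴ * rotation σ θ = 1 := by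
  rw [rotation_conjTranspose, rotation_eq]
  simp only [mul_sub, add_mul, smul_mul_assoc, mul_smul_comm, one_mul, mul_one, wordOp_mul_self,
    smul_add, smul_smul]
  have h : (Real.cos (θ / 2) : ℂ) ^ 2 + (Real.sin (θ / 2) : ℂ) ^ 2 = 1 := by
    exact_mod_cast Real.cos_sq_add_sin_sq (θ / 2)
  have h' : (Real.cos (θ / 2) : ℂ) * Real.cos (θ / 2) -
      Complex.I * (Real.sin (θ / 2) : ℂ) * (Complex.I * (Real.sin (θ / 2) : ℂ)) = 1 := by
    linear_combination h - (Real.sin (θ / 2) : ℂ) ^ 2 * Complex.I_sq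
  have h1 : (1 : Op n) = (1 : ℂ) • 1 := (one_smul ℂ _).symm
  conv_rhs => rw [h1, ← h']
  module

theorem rotation_mem_unitary (σ : Word n) (θ : ℝ) : rotation σ θ ∈ unitary (Op n) := by
  rw [Unitary.mem_iff]
  exact ⟨rotation_unitary σ θ, mul_eq_one_comm.mp (rotation_unitary σ θ)⟩

theorem rotation_commute {σ : Word n} {A : Op n} (h : Commute (wordOp σ) A) (θ : ℝ) :
    Commute (rotation σ θ) A := by
  rw [rotation_eq]
  exact ((Commute.one_left A).smul_left _).sub_left (h.smul_left _)

theorem rotation_conj_of_commute {σ s : Word n} (h : sgn σ s = 1) (θ : ℝ) :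
    (rotation σ θ)ᴴ * wordOp s * rotation σ θ = wordOp s := by
  have hc : Commute (wordOp σ) (wordOp s) := by
    rw [Commute, SemiconjBy, wordOp_mul_comm, h, one_smul]
  rw [mul_assoc, ← (rotation_commute hc θ).eq, ← mul_assoc, rotation_unitary, one_mul]

/-- Moving `s` past `σ` flips a sign, so the two half-angle factors combine by the double-angle
formulas instead of cancelling. -/
theorem rotation_conj_of_anti {σ s : Word n} (h : sgn σ s = -1) (θ : ℝ) :
    (rotation σ θ)ᴴ * wordOp s * rotation σ θ =
      (Real.cos θ : ℂ) • wordOp s + ((Real.sin θ : ℂ) * Complex.I) • (wordOp σ * wordOp s) := by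
  have hc : wordOp s * wordOp σ = - (wordOp σ * wordOp s) := by
    rw [wordOp_mul_comm, sgn_comm, h, neg_one_smul]
  have hcc : wordOp σ * wordOp s * wordOp σ = - wordOp s := by
    rw [wordOp_conj, h, neg_one_smul]
  rw [rotation_conjTranspose, rotation_eq]
  simp only [mul_sub, add_mul, smul_mul_assoc, mul_smul_comm, one_mul, mul_one, hcc, hc,
    smul_add, smul_smul]
  have h1 : (Real.cos θ : ℂ) = (Real.cos (θ / 2) : ℂ) ^ 2 - (Real.sin (θ / 2) : ℂ) ^ 2 := by
    rw [← Complex.ofReal_pow, ← Complex.ofReal_pow, ← Complex.ofReal_sub, ← Real.cos_two_mul']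
    congr 2; ring
  have h2 : (Real.sin θ : ℂ) = 2 * (Real.sin (θ / 2) : ℂ) * (Real.cos (θ / 2) : ℂ) := by
    rw [← Complex.ofReal_ofNat, ← Complex.ofReal_mul, ← Complex.ofReal_mul, ← Real.sin_two_mul]
    congr 2; ring
  rw [h1, h2]
  have h3 : Complex.I * Complex.I = -1 := Complex.I_mul_I
  generalize (Real.sin (θ / 2) : ℂ) = a
  generalize (Real.cos (θ / 2) : ℂ) = b
  match_scalars
  · linear_combination a ^ 2 * h3
  · ring

end Gates

/-! ### Depolarizing noise is diagonal in the Pauli words. -/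

section Noise

variable {n : ℕ}

theorem depolarizeAt_add (lam : ℝ) (q : Fin n) (φ ψ : Op n) :
    depolarizeAt lam q (φ + ψ) = depolarizeAt lam q φ + depolarizeAt lam q ψ := by
  ext x y
  simp only [depolarizeAt, Matrix.of_apply, Matrix.add_apply, Finset.sum_add_distrib]
  split_ifs <;> ring

theorem depolarizeAt_smul (lam : ℝ) (q : Fin n) (z : ℂ) (φ : Op n) :
    depolarizeAt lam q (z • φ) = z • depolarizeAt lam q φ := by
  ext x y
  simp only [depolarizeAt, Matrix.of_apply, Matrix.smul_apply, smul_eq_mul, ← Finset.mul_sum]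
  split_ifs <;> ring

/-- The depolarizing channel as a linear map. -/
noncomputable def noiseLin (n : ℕ) (lam : ℝ) : Op n →ₗ[ℂ] Op n where
  toFun := noise lam
  map_add' φ ψ := by
    unfold noise
    induction List.finRange n with
    | nil => rfl
    | cons q l ih => simp only [List.foldr_cons, ih, depolarizeAt_add]
  map_smul' z φ := by
    simp only [noise, RingHom.id_apply]
    induction List.finRange n with
    | nil => rfl
    | cons q l ih => simp only [List.foldr_cons, ih, depolarizeAt_smul]

@[simp] theorem noiseLin_apply (lam : ℝ) (φ : Op n) : noiseLin n lam φ = noise lam φ := rfl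

/-- The partial trace over `q` vanishes unless the factor there is the identity, in which case it
restores the part removed by `1 - lam`. -/
theorem depolarizeAt_wordOp (lam : ℝ) (q : Fin n) (w : Word n) :
    depolarizeAt lam q (wordOp w) =
      (if w q ≠ .I then ((1 - lam : ℝ) : ℂ) else 1) • wordOp w := by
  ext x y
  simp only [depolarizeAt, Matrix.of_apply, Matrix.smul_apply, smul_eq_mul, wordOp]
  have hs : ∀ x' y' : Bits n, ∏ r, (w r).mat (x' r) (y' r) = (w q).mat (x' q) (y' q) *
      ∏ r ∈ Finset.univ.erase q, (w r).mat (x' r) (y' r) := fun x' y' =>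
    (Finset.mul_prod_erase _ _ (Finset.mem_univ q)).symm
  have hu : ∀ b : Fin 2, ∏ r ∈ Finset.univ.erase q, (w r).mat (Function.update x q b r)
      (Function.update y q b r) = ∏ r ∈ Finset.univ.erase q, (w r).mat (x r) (y r) := fun b =>
    Finset.prod_congr rfl fun r hr => by
      rw [Function.update_of_ne (Finset.ne_of_mem_erase hr),
        Function.update_of_ne (Finset.ne_of_mem_erase hr)]
  simp only [hs, hu, Function.update_self, ← Finset.sum_mul]
  have ht : ∑ b : Fin 2, (w q).mat b b = if w q = .I then 2 else 0 := Pauli.trace_mat (w q)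
  rw [ht]
  by_cases hw : w q = .I
  · simp only [hw, Pauli.mat, Matrix.one_apply]
    by_cases h : x q = y q
    · simp only [h, if_true, ne_eq, not_true_eq_false, if_false]
      push_cast
      ring
    · simp [h]
  · simp [hw]

theorem noise_wordOp (lam : ℝ) (w : Word n) :
    noise lam (wordOp w) = ((1 - lam : ℝ) : ℂ) ^ weight w • wordOp w := by
  have h : ∀ l : List (Fin n), l.foldr (depolarizeAt lam) (wordOp w) =
      (l.map fun q => if w q ≠ .I then ((1 - lam : ℝ) : ℂ) else 1).prod • wordOp w := by
    intro l
    induction l with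
    | nil => simp
    | cons q l ih =>
      rw [List.foldr_cons, ih, depolarizeAt_smul, depolarizeAt_wordOp, smul_smul, List.map_cons,
        List.prod_cons, mul_comm]
  rw [noise, h, ← Fin.prod_univ_def, ← Finset.prod_filter, Finset.prod_const]
  rfl

theorem noise_normOp (lam : ℝ) (w : Word n) :
    noise lam (normOp w) = ((1 - lam : ℝ) : ℂ) ^ weight w • normOp w := by
  rw [normOp, ← noiseLin_apply, map_smul, noiseLin_apply, noise_wordOp, smul_comm]

theorem noise_zero (φ : Op n) : noise 0 φ = φ := by
  have h : ∀ (q : Fin n) (ψ : Op n), depolarizeAt 0 q ψ = ψ := fun q ψ => by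
    ext x y; simp [depolarizeAt]
  unfold noise
  induction List.finRange n with
  | nil => rfl
  | cons q l ih => rw [List.foldr_cons, ih, h]

end Noise

/-! ### A layer in the Heisenberg picture, and the lists that represent it. -/

section Layers

variable {n : ℕ}

/-- The product of the rotation gates of a layer. -/
noncomputable def Layer.rotOp (l : Layer n) (θ : Fin l.R → ℝ) : Op n :=
  (List.ofFn fun j => rotation (l.word j) (θ j)).prod

theorem Layer.rotOp_mem_unitary (l : Layer n) (θ : Fin l.R → ℝ) :
    l.rotOp θ ∈ _root_.unitary (Op n) := by
  refine Submonoid.list_prod_mem _ fun x hx => ?_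
  obtain ⟨j, rfl⟩ := (List.mem_ofFn' _ _).mp hx
  exact rotation_mem_unitary _ _

theorem Layer.cliffordOp_mem_unitary (l : Layer n) : l.cliffordOp ∈ _root_.unitary (Op n) := by
  refine Submonoid.list_prod_mem _ fun x hx => ?_
  obtain ⟨j, rfl⟩ := (List.mem_ofFn' _ _).mp hx
  exact Clifford.op_mem_unitary _

theorem Layer.unitary_eq (l : Layer n) (θ : Fin l.R → ℝ) :
    l.unitary θ = l.rotOp θ * l.cliffordOp := rfl

theorem Layer.unitary_mem_unitary (l : Layer n) (θ : Fin l.R → ℝ) :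
    l.unitary θ ∈ _root_.unitary (Op n) :=
  mul_mem (l.rotOp_mem_unitary θ) l.cliffordOp_mem_unitary

theorem Layer.unitary_mul_conjTranspose (l : Layer n) (θ : Fin l.R → ℝ) :
    l.unitary θ * (l.unitary θ)ᴴ = 1 := Unitary.mul_star_self_of_mem (l.unitary_mem_unitary θ)

theorem Layer.conjTranspose_mul_unitary (l : Layer n) (θ : Fin l.R → ℝ) :
    (l.unitary θ)ᴴ * l.unitary θ = 1 := Unitary.star_mul_self_of_mem (l.unitary_mem_unitary θ)

/-- The operator of a list of coefficients and words. -/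
noncomputable def listOp (u : List (ℂ × Word n)) : Op n := (u.map fun a => a.1 • wordOp a.2).sum

@[simp] theorem listOp_nil : listOp ([] : List (ℂ × Word n)) = 0 := rfl

@[simp] theorem listOp_cons (a : ℂ × Word n) (u : List (ℂ × Word n)) :
    listOp (a :: u) = a.1 • wordOp a.2 + listOp u := by
  simp [listOp]

/-- A list may repeat a word; pairing with `t` under the trace collects the coefficients of all
copies. This is how sums over lists are turned into sums over all words. -/
theorem sum_map_mul_eq (u : List (ℂ × Word n)) (φ : Word n → ℂ) :
    (u.map fun a => a.1 * φ a.2).sum =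
      ∑ t, ((2 : ℂ) ^ n)⁻¹ * (wordOp t * listOp u).trace * φ t := by
  induction u with
  | nil => simp
  | cons a u ih =>
    simp only [List.map_cons, List.sum_cons, ih, listOp_cons, mul_add, Matrix.trace_add, add_mul,
      Finset.sum_add_distrib, mul_smul_comm, Matrix.trace_smul, trace_wordOp_mul, smul_eq_mul]
    congr 1
    rw [Finset.sum_eq_single a.2]
    · have : (2 : ℂ) ^ n ≠ 0 := by positivity
      rw [if_pos rfl]; field_simp
    · intro t _ ht; rw [if_neg ht]; ring
    · simp

theorem antiT_val (σ s : Word n) : (antiT σ s).val = true ↔ sgn σ s = -1 := by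
  have h : ∀ (l : List (Fin n)) (b : Bool),
      (if l.foldl (fun b q => xor b ((σ q).anti (s q))) b then (-1 : ℂ) else 1) =
        (if b then -1 else 1) * (l.map fun q => (σ q).sgn (s q)).prod := by
    intro l
    induction l with
    | nil => simp
    | cons q l ih =>
      intro b
      rw [List.foldl_cons, ih, List.map_cons, List.prod_cons, ← mul_assoc]
      congr 1
      cases b <;> cases h : (σ q).anti (s q) <;> simp [Pauli.sgn, h]
  have h1 := h (List.finRange n) false
  rw [← Fin.prod_univ_def] at h1
  have h2 : (antiT σ s).val =
      (List.finRange n).foldl (fun b q => xor b ((σ q).anti (s q))) false := by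
    simp [antiT, loop_val]
  rw [← h2] at h1
  have h3 : (if (antiT σ s).val = true then (-1 : ℂ) else 1) = sgn σ s := by
    simpa [sgn] using h1
  rw [← h3]
  split_ifs with h4 <;> simp [h4]
  norm_num

theorem mulWordT_val (σ s : Word n) : (mulWordT σ s).val = wordMul σ s := rfl

theorem foldl_mul_eq {α : Type} (f : α → ℂ) (l : List α) (z : ℂ) :
    l.foldl (fun z q => z * f q) z = z * (l.map f).prod := by
  induction l generalizing z with
  | nil => simp
  | cons q l ih => rw [List.foldl_cons, ih, List.map_cons, List.prod_cons, mul_assoc]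

theorem mulPhaseT_val (σ s : Word n) : (mulPhaseT σ s).val = wordPhase σ s := by
  have : (mulPhaseT σ s).val =
      (List.finRange n).foldl (fun z q => z * (σ q).mulPhase (s q)) 1 := by
    simp [mulPhaseT, loop_val]
  rw [this, foldl_mul_eq (fun q => (σ q).mulPhase (s q)), one_mul, ← Fin.prod_univ_def]
  rfl

theorem listOp_cliffordT (V : Clifford n) (u : List (ℂ × Word n)) :
    listOp (cliffordT V u).val = V.opᴴ * listOp u * V.op := by
  induction u with
  | nil => simp [cliffordT]
  | cons a u ih =>
    simp only [cliffordT, bind_val, elem_val, listOp_cons, ih, mul_add, add_mul, mul_smul_comm,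
      smul_mul_assoc, conjGateT_spec, smul_smul]

theorem rotateT_cons_val (σ : Word n) (θ : ℝ) (a : ℂ × Word n) (u : List (ℂ × Word n)) :
    (rotateT σ θ (a :: u)).val =
      if sgn σ a.2 = -1 then
        (a.1 * (Real.cos θ : ℂ), a.2) ::
          (a.1 * (Real.sin θ : ℂ) * Complex.I * wordPhase σ a.2, wordMul σ a.2) ::
            (rotateT σ θ u).val
      else a :: (rotateT σ θ u).val := by
  by_cases h : sgn σ a.2 = -1
  · have h' := (antiT_val σ a.2).mpr h
    simp [rotateT, h, h', mulPhaseT_val, mulWordT_val]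
  · have h' : ¬ (antiT σ a.2).val = true := fun h' => h ((antiT_val σ a.2).mp h')
    simp [rotateT, h, h']

theorem listOp_rotateT (σ : Word n) (θ : ℝ) (u : List (ℂ × Word n)) :
    listOp (rotateT σ θ u).val = (rotation σ θ)ᴴ * listOp u * rotation σ θ := by
  induction u with
  | nil => simp [rotateT]
  | cons a u ih =>
    rw [rotateT_cons_val]
    split_ifs with h
    · simp only [listOp_cons, ih, mul_add, add_mul, mul_smul_comm, smul_mul_assoc,
        rotation_conj_of_anti h, wordOp_mul, smul_add, smul_smul, mul_assoc, add_assoc]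
    · have h1 : sgn σ a.2 = 1 := (sgn_eq_or σ a.2).resolve_right h
      simp only [listOp_cons, ih, mul_add, add_mul, mul_smul_comm, smul_mul_assoc,
        rotation_conj_of_commute h1]

theorem listOp_foldl {α : Type} (g : List (ℂ × Word n) → α → List (ℂ × Word n)) (A : α → Op n)
    (h : ∀ u a, listOp (g u a) = (A a)ᴴ * listOp u * A a) (l : List α) (u : List (ℂ × Word n)) :
    listOp (l.foldl g u) = (l.map A).prodᴴ * listOp u * (l.map A).prod := by
  induction l generalizing u with
  | nil => simp
  | cons a l ih =>
    rw [List.foldl_cons, ih, h, List.map_cons, List.prod_cons, Matrix.conjTranspose_mul]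
    simp only [mul_assoc]

/-- Rotations are processed before Clifford gates because the rotations are the left factor of the
layer unitary and so act on `s` first under `U† s U`. -/
theorem listOp_candidatesT (l : Layer n) (θ : Fin l.R → ℝ) (s : Word n) :
    listOp (candidatesT l θ s).val = (l.unitary θ)ᴴ * wordOp s * l.unitary θ := by
  simp only [candidatesT, bind_val, elem_val, loop_val]
  rw [listOp_foldl _ (fun k => (l.gate k).op) fun u k => listOp_cliffordT _ u,
    listOp_foldl _ (fun j => rotation (l.word j) (θ j)) fun u j => listOp_rotateT _ _ u]
  simp only [listOp_cons, listOp_nil, one_smul, add_zero, Layer.unitary, Layer.cliffordOp,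
    List.ofFn_eq_map, Matrix.conjTranspose_mul, mul_assoc]

/-- The noiseless transition amplitude of a layer between normalized Pauli words. -/
noncomputable def Layer.transition (l : Layer n) (θ : Fin l.R → ℝ) (s t : Word n) : ℂ :=
  (normOp s * l.unitary θ * normOp t * (l.unitary θ)ᴴ).trace

/-- By cyclicity of the trace the amplitude is the coefficient of `t` in `U† s U`, the quantity that
the candidate list holds. -/
theorem Layer.transition_eq (l : Layer n) (θ : Fin l.R → ℝ) (s t : Word n) :
    l.transition θ s t = ((2 : ℂ) ^ n)⁻¹ *
      (wordOp t * ((l.unitary θ)ᴴ * wordOp s * l.unitary θ)).trace := by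
  rw [transition, normOp, normOp, ← sqrt_two_pow_mul_self]
  simp only [smul_mul_assoc, mul_smul_comm, Matrix.trace_smul, smul_eq_mul, mul_assoc]
  rw [← mul_assoc (wordOp s), Matrix.trace_mul_comm]
  simp only [mul_assoc]

/-- `U 1 U† = 1`, and non-identity words are traceless. This is what makes the pruning rule
lossless. -/
theorem Layer.transition_idWord (l : Layer n) (θ : Fin l.R → ℝ) {s : Word n}
    (hs : s ≠ idWord n) : l.transition θ s (idWord n) = 0 := by
  rw [transition_eq, wordOp_idWord, one_mul, Matrix.trace_mul_comm, ← mul_assoc,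
    l.unitary_mul_conjTranspose, one_mul, trace_wordOp, if_neg hs, mul_zero]

theorem weight_eq_zero {w : Word n} : weight w = 0 ↔ w = idWord n := by
  simp [weight, wordSupport, Finset.filter_eq_empty_iff, funext_iff, idWord]

theorem weightT_val (s : Word n) : (weightT s).val = weight s := by
  have h : ∀ (l : List (Fin n)) (k : ℕ),
      l.foldl (fun k q => if s q = .I then k else k + 1) k =
        k + (l.map fun q => if s q ≠ .I then 1 else 0).sum := by
    intro l
    induction l with
    | nil => simp
    | cons q l ih =>
      intro k
      rw [List.foldl_cons, ih]
      by_cases h : s q = .I <;> simp [h, add_assoc]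
  have h1 : (weightT s).val = (List.finRange n).foldl
      (fun k q => if s q = .I then k else k + 1) 0 := by
    simp only [weightT, loop_val, bind_val, elem_val]
    congr 1
    funext k q
    by_cases h : s q = .I <;> simp [h]
  rw [h1, h, zero_add, ← Fin.sum_univ_def, weight, wordSupport, Finset.card_filter]

theorem expectationT_val (s : Word n) (ρ : StateData n) :
    (expectationT s ρ).val = (wordOp s * stateOp ρ).trace := by
  rw [expectationT, sumLoop_val, stateOp]
  induction ρ with
  | nil => simp
  | cons e ρ ih =>
    rw [List.map_cons, List.sum_cons, List.map_cons, List.sum_cons, mul_add, Matrix.trace_add, ih]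
    congr 1
    rw [loop_val]
    simp only [bind_val, elem_val]
    rw [foldl_mul_eq (fun q => (s q).mat (e.2.2 q) (e.2.1 q)), ← Fin.prod_univ_def,
      Matrix.trace_mul_comm, Matrix.trace_single_mul]
    rfl

end Layers

/-! ### Recursive evaluation of weight-bounded path sums. -/

section PathSums

variable {W : Type} [Fintype W]

theorem sum_snoc {i : ℕ} (f : (Fin (i + 2) → W) → ℂ) :
    ∑ s, f s = ∑ t : W, ∑ s : Fin (i + 1) → W, f (Fin.snoc (α := fun _ => W) s t) := by
  rw [← Fintype.sum_prod_type']
  exact (Fintype.sum_equiv (Fin.snocEquiv fun _ : Fin (i + 2) => W) _ _ fun p => rfl).symm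

/-- The sum over the paths of `i` steps that end in a given word, the preceding words having
total weight at most `m`; a step of index `j` has amplitude `T j` and damping `x ^ wt`. -/
def pathSum (T : ℕ → W → W → ℂ) (r : W → ℂ) (wt : W → ℕ) (x : ℂ) : ℕ → W → ℕ → ℂ
  | 0, s, _ => r s
  | i + 1, s, m => ∑ t, if wt t ≤ m then T i s t * x ^ wt t * pathSum T r wt x i t (m - wt t) else 0

theorem sum_path_eq_sum_pathSum (T : ℕ → W → W → ℂ) (r : W → ℂ) (wt : W → ℕ) (x : ℂ) (i : ℕ)
    (g : W → ℂ) (m : ℕ) :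
    (∑ s : Fin (i + 1) → W, if ∑ j, wt (s j) ≤ m then
      g (s (Fin.last i)) * (∏ j : Fin i, T j (s j.succ) (s j.castSucc) *
        x ^ wt (s j.castSucc)) * r (s 0) else 0) =
      ∑ t, if wt t ≤ m then g t * pathSum T r wt x i t (m - wt t) else 0 := by
  induction i generalizing g m with
  | zero =>
    refine Fintype.sum_equiv (Equiv.funUnique (Fin 1) W) _ _ fun s => ?_
    simp [pathSum]
  | succ i ih =>
    rw [sum_snoc]
    refine Finset.sum_congr rfl fun t _ => ?_
    split_ifs with h
    · rw [pathSum, Finset.mul_sum]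
      -- The boundary function `g` is arbitrary so that it can absorb the factors of the last step.
      have := ih (fun u => g t * (T i t u * x ^ wt u)) (m - wt t)
      refine Eq.trans (Finset.sum_congr rfl fun s _ => ?_) (this.trans ?_)
      · rw [Fin.sum_univ_castSucc]
        simp only [Fin.snoc_castSucc, Fin.snoc_last]
        have h1 : ∑ j, wt (s j) + wt t ≤ m ↔ ∑ j, wt (s j) ≤ m - wt t := by omega
        simp only [h1]
        refine if_congr Iff.rfl ?_ rfl
        rw [Fin.prod_univ_castSucc]
        have h2 : ∀ j : Fin i, (Fin.snoc (α := fun _ => W) s t) j.castSucc.succ = s j.succ :=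
          fun j => by rw [Fin.succ_castSucc, Fin.snoc_castSucc]
        have h3 : (Fin.snoc (α := fun _ => W) s t) 0 = s 0 := by
          rw [← Fin.castSucc_zero, Fin.snoc_castSucc]
        simp only [h2, h3, Fin.succ_last, Fin.snoc_last, Fin.val_castSucc, Fin.val_last]
        ring
      · refine Finset.sum_congr rfl fun u _ => ?_
        split_ifs
        · ring
        · ring
    · refine Finset.sum_eq_zero fun s _ => if_neg fun h1 => h ?_
      rw [Fin.sum_univ_castSucc] at h1
      simp only [Fin.snoc_last] at h1
      omega

/-- A path with non-zero amplitude that ends in a non-identity word has no identity word among its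
`i` earlier words, so these weigh at least `i`. -/
theorem pathSum_eq_zero {T : ℕ → W → W → ℂ} {r : W → ℂ} {wt : W → ℕ} {x : ℂ}
    (h : ∀ i s t, wt t = 0 → wt s ≠ 0 → T i s t = 0) (i : ℕ) {s : W} {m : ℕ}
    (hs : wt s ≠ 0) (hm : m < i) : pathSum T r wt x i s m = 0 := by
  induction i generalizing s m with
  | zero => omega
  | succ i ih =>
    rw [pathSum]
    refine Finset.sum_eq_zero fun t _ => ?_
    split_ifs with h1
    · by_cases ht : wt t = 0
      · rw [h i s t ht hs, zero_mul, zero_mul]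
      · rw [ih ht (by omega), mul_zero]
    · rfl

end PathSums

/-! ### The method computes the truncated cost. -/

section Descend

variable {n L : ℕ}

/-- The transition amplitudes of a circuit, indexed by natural numbers. -/
noncomputable def amplitude (c : Circuit n L) (θ : Params c) (i : ℕ) (s t : Word n) : ℂ :=
  if h : i < L then (c ⟨i, h⟩).transition (θ ⟨i, h⟩) s t else 0

theorem amplitude_eq_zero (c : Circuit n L) (θ : Params c) (i : ℕ) (s t : Word n)
    (ht : weight t = 0) (hs : weight s ≠ 0) : amplitude c θ i s t = 0 := by
  rw [weight_eq_zero] at ht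
  rw [ne_eq, weight_eq_zero] at hs
  unfold amplitude
  split_ifs
  · rw [ht, Layer.transition_idWord _ _ hs]
  · rfl

theorem sum_candidatesT (l : Layer n) (θ : Fin l.R → ℝ) (s : Word n) (φ : Word n → ℂ) :
    ((candidatesT l θ s).val.map fun a => a.1 * φ a.2).sum =
      ∑ t, l.transition θ s t * φ t := by
  simp only [sum_map_mul_eq, listOp_candidatesT, Layer.transition_eq]

theorem keepT_val (M i acc w : ℕ) :
    (keepT M i acc w).val = decide (acc + w + (if w = 0 then 0 else i) ≤ M) := by
  by_cases h : w = 0 <;> simp only [keepT, h, bind_val, elem_val, decide_true, decide_false,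
    if_true, if_false, Bool.false_eq_true] <;> exact Bool.decide_congr Iff.rfl

/-- The sums over paths that the simulation method computes. -/
noncomputable def tailSum (c : Circuit n L) (lam : ℝ) (ρ : StateData n) (θ : Params c) :
    ℕ → Word n → ℕ → ℂ :=
  pathSum (amplitude c θ) (fun s => (wordOp s * stateOp ρ).trace) weight ((1 - lam : ℝ) : ℂ)

/-- Pruning is lossless: a partial path that is discarded has no completion within the budget. -/
theorem keep_tailSum (c : Circuit n L) (lam : ℝ) (ρ : StateData n) (θ : Params c)
    (M i acc : ℕ) (t : Word n) (y : ℂ) :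
    (if (keepT M i acc (weight t)).val then
      y * tailSum c lam ρ θ i t (M - (acc + weight t)) else 0) =
    if acc + weight t ≤ M then y * tailSum c lam ρ θ i t (M - (acc + weight t)) else 0 := by
  rw [keepT_val]
  by_cases h : acc + weight t ≤ M
  · rw [if_pos h]
    by_cases h1 : acc + weight t + (if weight t = 0 then 0 else i) ≤ M
    · rw [if_pos (decide_eq_true h1)]
    · rw [if_neg (by simpa using h1)]
      by_cases hw : weight t = 0
      · rw [if_pos hw] at h1; omega
      · rw [if_neg hw] at h1
        rw [tailSum, pathSum_eq_zero (amplitude_eq_zero c θ) i hw (by omega), mul_zero]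
  · rw [if_neg h, if_neg]
    simp only [decide_eq_true_eq]
    omega

/-- The number `z` carries only undamped factors; the damping of the words chosen so far enters at
the leaf through the accumulated weight, whence the power `acc` here. -/
theorem descend_val (c : Circuit n L) (lam : ℝ) (ρ : StateData n) (M : ℕ) (θ : Params c)
    (i : ℕ) (hi : i ≤ L) (acc : ℕ) (s : Word n) (z : ℂ) (hacc : acc ≤ M) :
    (descend c lam ρ M θ i hi acc s z).val =
      z * ((1 - lam : ℝ) : ℂ) ^ acc * tailSum c lam ρ θ i s (M - acc) := by
  induction i generalizing acc s z with
  | zero => simp [descend, power_val, expectationT_val, tailSum, pathSum]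
  | succ i ih =>
    have hstep : ∀ a : ℂ × Word n,
        (do
          let w ← weightT a.2
          if ← keepT M i acc w then do
            let acc' ← elem (acc + w)
            let z' ← elem (z * a.1)
            descend c lam ρ M θ i (Nat.le_of_succ_le hi) acc' a.2 z'
          else elem 0 : Timed ℂ).val = a.1 * (if acc + weight a.2 ≤ M then
            z * ((1 - lam : ℝ) : ℂ) ^ (acc + weight a.2) *
              tailSum c lam ρ θ i a.2 (M - (acc + weight a.2)) else 0) := by
      intro a
      have hk := keep_tailSum c lam ρ θ M i acc a.2
        (z * ((1 - lam : ℝ) : ℂ) ^ (acc + weight a.2))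
      rw [← hk]
      simp only [bind_val, weightT_val]
      by_cases h : (keepT M i acc (weight a.2)).val = true
      · have h' : acc + weight a.2 ≤ M := by
          rw [keepT_val, decide_eq_true_eq] at h; omega
        rw [if_pos h, if_pos h]
        simp only [bind_val, elem_val]
        rw [ih _ _ _ _ h']
        ring
      · rw [if_neg h, if_neg h]
        simp
    rw [descend, bind_val, sumLoop_val]
    simp only [hstep]
    rw [sum_candidatesT (c ⟨i, hi⟩) (θ ⟨i, hi⟩) s fun t => if acc + weight t ≤ M then
            z * ((1 - lam : ℝ) : ℂ) ^ (acc + weight t) *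
              tailSum c lam ρ θ i t (M - (acc + weight t)) else 0]
    rw [tailSum, pathSum, Finset.mul_sum]
    refine Finset.sum_congr rfl fun t _ => ?_
    have h1 : acc + weight t ≤ M ↔ weight t ≤ M - acc := by omega
    rw [if_congr h1 rfl rfl, Nat.sub_add_eq, amplitude, dif_pos (show i < L from hi)]
    split_ifs
    · rw [pow_add]; ring
    · ring

theorem hamOp_eq_listOp (H : HamData n) :
    hamOp H = listOp (H.map fun a => ((a.1 : ℂ), a.2)) := by
  simp [hamOp, listOp, Function.comp_def]

/-- The normalizations of the first and the last word combine to `2 ^ (-n)`; those of the inner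
words are part of the transitions. -/
theorem noisyTerm_eq (c : Circuit n L) (lam : ℝ) (H ρ : Op n) (θ : Params c) (s : Path n L) :
    noisyTerm c lam H ρ θ s = ((2 : ℂ) ^ n)⁻¹ * (wordOp (s (Fin.last L)) * H).trace *
      ((1 - lam : ℝ) : ℂ) ^ weight (s (Fin.last L)) *
      (∏ i : Fin L, (c i).transition (θ i) (s i.succ) (s i.castSucc) *
        ((1 - lam : ℝ) : ℂ) ^ weight (s i.castSucc)) * (wordOp (s 0) * ρ).trace := by
  rw [noisyTerm, ← sqrt_two_pow_mul_self]
  have h : ∀ i : Fin L, (normOp (s i.succ) * (c i).unitary (θ i) *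
      noise lam (normOp (s i.castSucc)) * ((c i).unitary (θ i))ᴴ).trace =
      (c i).transition (θ i) (s i.succ) (s i.castSucc) *
        ((1 - lam : ℝ) : ℂ) ^ weight (s i.castSucc) := fun i => by
    rw [noise_normOp, mul_smul_comm, smul_mul_assoc, Matrix.trace_smul, smul_eq_mul, mul_comm]
    rfl
  rw [Finset.prod_congr rfl fun i _ => h i, noise_normOp, Matrix.trace_mul_comm H]
  simp only [normOp, smul_mul_assoc, Matrix.trace_smul, smul_eq_mul]
  ring

theorem truncatedCost_eq (c : Circuit n L) (lam : ℝ) (H : Op n) (ρ : StateData n) (M : ℕ)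
    (θ : Params c) : truncatedCost c lam H (stateOp ρ) M θ =
      ∑ t, if weight t ≤ M then ((2 : ℂ) ^ n)⁻¹ * (wordOp t * H).trace *
        ((1 - lam : ℝ) : ℂ) ^ weight t * tailSum c lam ρ θ L t (M - weight t) else 0 := by
  rw [tailSum, ← sum_path_eq_sum_pathSum (amplitude c θ)
    (fun s => (wordOp s * stateOp ρ).trace) weight ((1 - lam : ℝ) : ℂ) L (fun t =>
      ((2 : ℂ) ^ n)⁻¹ * (wordOp t * H).trace * ((1 - lam : ℝ) : ℂ) ^ weight t) M,
    truncatedCost, Finset.sum_filter]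
  refine Finset.sum_congr rfl fun s _ => ?_
  rw [pathWeight, noisyTerm_eq]
  simp only [amplitude, Fin.is_lt, dif_pos]

theorem truncatedCost_hamOp (c : Circuit n L) (lam : ℝ) (H : HamData n) (ρ : StateData n) (M : ℕ)
    (θ : Params c) : truncatedCost c lam (hamOp H) (stateOp ρ) M θ =
      (H.map fun a => (a.1 : ℂ) * if weight a.2 ≤ M then
        ((1 - lam : ℝ) : ℂ) ^ weight a.2 * tailSum c lam ρ θ L a.2 (M - weight a.2) else 0).sum := by
  have := sum_map_mul_eq (H.map fun a => ((a.1 : ℂ), a.2)) fun t =>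
    if weight t ≤ M then ((1 - lam : ℝ) : ℂ) ^ weight t *
      tailSum c lam ρ θ L t (M - weight t) else 0
  rw [List.map_map, ← hamOp_eq_listOp] at this
  rw [truncatedCost_eq]
  refine (this.trans (Finset.sum_congr rfl fun t _ => ?_)).symm
  split_ifs
  · ring
  · ring

theorem method_val (c : Circuit n L) (lam : ℝ) (H : HamData n) (ρ : StateData n) (M : ℕ)
    (θ : Params c) : (method c lam H ρ M θ).val =
      truncatedCost c lam (hamOp H) (stateOp ρ) M θ := by
  have hstep : ∀ a : ℝ × Word n,
      (do
        let w ← weightT a.2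
        if ← keepT M L 0 w then descend c lam ρ M θ L le_rfl w a.2 (a.1 : ℂ)
        else elem 0 : Timed ℂ).val = (a.1 : ℂ) * (if weight a.2 ≤ M then
          ((1 - lam : ℝ) : ℂ) ^ weight a.2 *
            tailSum c lam ρ θ L a.2 (M - weight a.2) else 0) := by
    intro a
    have hk := keep_tailSum c lam ρ θ M L 0 a.2 (((1 - lam : ℝ) : ℂ) ^ weight a.2)
    rw [zero_add] at hk
    rw [← hk]
    simp only [bind_val, weightT_val]
    by_cases h : (keepT M L 0 (weight a.2)).val = true
    · have h' : weight a.2 ≤ M := by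
        rw [keepT_val, decide_eq_true_eq] at h; omega
      rw [if_pos h, if_pos h, descend_val _ _ _ _ _ _ _ _ _ _ h']
      ring
    · rw [if_neg h, if_neg h]
      simp
  rw [method, sumLoop_val]
  simp only [hstep]
  rw [truncatedCost_hamOp]

end Descend

/-! ### The noisy cost as a sum over all Pauli paths. -/

section Expansion

variable {n L : ℕ}

/-- General linear maps `K` in place of layers let the induction drop the last step; its output is
expanded in the orthonormal words. -/
theorem foldl_noise_eq_sum (lam : ℝ) (L : ℕ) (K : Fin L → Op n →ₗ[ℂ] Op n) (ρ : Op n) :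
    Fin.foldl L (fun φ i => noise lam (K i φ)) (noise lam ρ) =
      ∑ s : Path n L, ((∏ i : Fin L, (normOp (s i.succ) *
        K i (noise lam (normOp (s i.castSucc)))).trace) * (normOp (s 0) * ρ).trace) •
          noise lam (normOp (s (Fin.last L))) := by
  induction L with
  | zero =>
    rw [Fin.foldl_zero]
    conv_lhs => rw [← sum_trace_normOp_smul ρ, ← noiseLin_apply, map_sum]
    refine (Fintype.sum_equiv (Equiv.funUnique (Fin 1) (Word n)) _ _ fun s => ?_).symm
    simp
  | succ L ih =>
    rw [Fin.foldl_succ_last, ih fun i => K i.castSucc]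
    have hs := (Fin.snocEquiv fun _ : Fin (L + 2) => Word n).sum_comp fun s : Path n (L + 1) =>
      ((∏ i : Fin (L + 1), (normOp (s i.succ) *
        K i (noise lam (normOp (s i.castSucc)))).trace) * (normOp (s 0) * ρ).trace) •
          noise lam (normOp (s (Fin.last (L + 1))))
    rw [← hs, Fintype.sum_prod_type_right, map_sum, ← noiseLin_apply, map_sum]
    refine Finset.sum_congr rfl fun s _ => ?_
    rw [map_smul, map_smul]
    conv_lhs => rw [← sum_trace_normOp_smul
      (K (Fin.last L) (noise lam (normOp (s (Fin.last L))))), map_sum, Finset.smul_sum]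
    refine Finset.sum_congr rfl fun t _ => ?_
    have h2 : ∀ j : Fin L, (Fin.snoc (α := fun _ => Word n) s t) j.castSucc.succ = s j.succ :=
      fun j => by rw [Fin.succ_castSucc, Fin.snoc_castSucc]
    have h3 : (Fin.snoc (α := fun _ => Word n) s t) 0 = s 0 := by
      rw [← Fin.castSucc_zero, Fin.snoc_castSucc]
    rw [map_smul, smul_smul, noiseLin_apply]
    simp only [Fin.snocEquiv, Equiv.coe_fn_mk, Fin.snoc_last, Fin.prod_univ_castSucc, h2, h3,
      Fin.snoc_castSucc, Fin.succ_last]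
    congr 1
    ring

/-- The noisy cost function is the sum over all Pauli paths. -/
theorem noisyCost_eq_sum (c : Circuit n L) (lam : ℝ) (H ρ : Op n) (θ : Params c) :
    noisyCost c lam H ρ θ = ∑ s, noisyTerm c lam H ρ θ s := by
  have h := foldl_noise_eq_sum lam L (fun i => (LinearMap.mulRight ℂ ((c i).unitary (θ i))ᴴ).comp
    (LinearMap.mulLeft ℂ ((c i).unitary (θ i)))) ρ
  simp only [LinearMap.comp_apply, LinearMap.mulLeft_apply, LinearMap.mulRight_apply] at h
  rw [noisyCost, h, Finset.mul_sum, Matrix.trace_sum]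
  refine Finset.sum_congr rfl fun s _ => ?_
  rw [mul_smul_comm, Matrix.trace_smul, smul_eq_mul, noisyTerm]
  simp only [mul_assoc]
  ring

theorem truncatedCost_eq_noisyCost (c : Circuit n L) (lam : ℝ) (H ρ : Op n) (θ : Params c)
    {M : ℕ} (hM : (L + 1) * n ≤ M) : truncatedCost c lam H ρ M θ = noisyCost c lam H ρ θ := by
  rw [noisyCost_eq_sum, truncatedCost, Finset.filter_true_of_mem]
  intro s _
  refine le_trans ?_ hM
  calc pathWeight s ≤ ∑ _i : Fin (L + 1), n := Finset.sum_le_sum fun i _ =>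
        (Finset.card_le_univ _).trans (by simp)
    _ = (L + 1) * n := by simp

end Expansion

/-! ### Symmetries of the angle law, and integrability. -/

section AngleLaw

/-- The law of a single angle, uniform on `(-π, π]`. -/
noncomputable abbrev angleLaw : Measure ℝ :=
  ProbabilityTheory.cond (volume : Measure ℝ) (Set.Ioc (-Real.pi) Real.pi)

instance : IsProbabilityMeasure angleLaw :=
  ProbabilityTheory.cond_isProbabilityMeasure_of_finite
    (by simp [Real.pi_pos]) (by simp)

instance {n L : ℕ} (c : Circuit n L) : IsProbabilityMeasure (paramLaw c) := by
  unfold paramLaw; infer_instance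

theorem measurePreserving_neg_angleLaw : MeasurePreserving (fun x : ℝ => -x) angleLaw angleLaw := by
  unfold angleLaw ProbabilityTheory.cond
  refine MeasurePreserving.smul_measure ?_ _
  -- The half-open interval is not symmetric under negation; the open one is, and they differ by a
  -- null set.
  rw [← Measure.restrict_congr_set (μ := volume) (Ioo_ae_eq_Ioc (a := -Real.pi) (b := Real.pi))]
  have := (Measure.measurePreserving_neg (volume : Measure ℝ)).restrict_preimage
    (s := Set.Ioo (-Real.pi) Real.pi) measurableSet_Ioo
  simpa using this

/-- The rotation by `π` of the angles in `(-π, π]`. -/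
noncomputable def halfTurn (x : ℝ) : ℝ := if x ≤ 0 then x + Real.pi else x - Real.pi

theorem measurable_halfTurn : Measurable halfTurn :=
  Measurable.ite measurableSet_Iic (measurable_id.add_const _) (measurable_id.sub_const _)

theorem measurePreserving_halfTurn : MeasurePreserving halfTurn angleLaw angleLaw := by
  unfold angleLaw ProbabilityTheory.cond
  refine MeasurePreserving.smul_measure ⟨measurable_halfTurn, ?_⟩ _
  ext s hs
  have hpi := Real.pi_pos
  rw [Measure.map_apply measurable_halfTurn hs, Measure.restrict_apply (measurable_halfTurn hs),
    Measure.restrict_apply hs]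
  -- The map exchanges the two halves of the interval, acting on each as a translation.
  have h1 : halfTurn ⁻¹' s ∩ Set.Ioc (-Real.pi) Real.pi =
      ((fun x => x + Real.pi) ⁻¹' (s ∩ Set.Ioc 0 Real.pi)) ∪
        ((fun x => x + -Real.pi) ⁻¹' (s ∩ Set.Ioc (-Real.pi) 0)) := by
    ext x
    simp only [Set.mem_inter_iff, Set.mem_preimage, Set.mem_union, Set.mem_Ioc, halfTurn]
    constructor
    · rintro ⟨h, h2, h3⟩
      split_ifs at h with h4
      · exact Or.inl ⟨h, by linarith, by linarith⟩
      · exact Or.inr ⟨h, by linarith, by linarith⟩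
    · rintro (⟨h, h2, h3⟩ | ⟨h, h2, h3⟩)
      · rw [if_pos (by linarith)]
        exact ⟨h, by linarith, by linarith⟩
      · rw [if_neg (by linarith)]
        exact ⟨h, by linarith, by linarith⟩
  have h2 : s ∩ Set.Ioc (-Real.pi) Real.pi =
      (s ∩ Set.Ioc 0 Real.pi) ∪ (s ∩ Set.Ioc (-Real.pi) 0) := by
    rw [← Set.inter_union_distrib_left, Set.union_comm, Set.Ioc_union_Ioc_eq_Ioc] <;> linarith
  rw [h1, h2, measure_union _ (measurable_add_const _ (hs.inter measurableSet_Ioc)),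
    measure_union _ (hs.inter measurableSet_Ioc), measure_preimage_add_right,
    measure_preimage_add_right]
  · refine Set.disjoint_left.mpr fun x hx hx' => ?_
    have := hx.2.1; have := hx'.2.2
    linarith
  · refine Set.disjoint_left.mpr fun x hx hx' => ?_
    have := hx.2.2; have := hx'.2.1
    simp only at *
    linarith

/-- Maps of the single angles that preserve the angle law preserve the law of the parameters. -/
theorem measurePreserving_params {n L : ℕ} (c : Circuit n L) (e : ∀ i, Fin (c i).R → ℝ → ℝ)
    (he : ∀ i j, MeasurePreserving (e i j) angleLaw angleLaw) :
    MeasurePreserving (fun (θ : Params c) i j => e i j (θ i j)) (paramLaw c) (paramLaw c) :=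
  measurePreserving_pi _ _ fun i => measurePreserving_pi _ _ fun j => he i j

theorem measure_compl_cube {n L : ℕ} (c : Circuit n L) :
    paramLaw c (Set.univ.pi fun i => Set.univ.pi fun _ : Fin (c i).R =>
      Set.Icc (-Real.pi) Real.pi)ᶜ = 0 := by
  rw [prob_compl_eq_zero_iff (MeasurableSet.univ_pi fun i => MeasurableSet.univ_pi fun _ =>
    measurableSet_Icc), paramLaw, Measure.pi_pi]
  refine Finset.prod_eq_one fun i _ => ?_
  rw [Measure.pi_pi]
  refine Finset.prod_eq_one fun j _ => ?_
  refine le_antisymm prob_le_one ?_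
  have h1 : angleLaw (Set.Ioc (-Real.pi) Real.pi) = 1 :=
    ProbabilityTheory.cond_apply_self (by simp [Real.pi_pos]) (by simp)
  rw [← h1]
  exact measure_mono Set.Ioc_subset_Icc_self

/-- The law lives on a compact cube. -/
theorem integrable_of_continuous {n L : ℕ} {c : Circuit n L} {E : Type*} [NormedAddCommGroup E]
    {f : Params c → E} (hf : Continuous f) : Integrable f (paramLaw c) := by
  set K : Set (Params c) := Set.univ.pi fun i => Set.univ.pi fun _ : Fin (c i).R =>
      Set.Icc (-Real.pi) Real.pi
  have hK : IsCompact K := isCompact_univ_pi fun i => isCompact_univ_pi fun _ => isCompact_Icc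
  have h := hf.continuousOn.integrableOn_compact (μ := paramLaw c) hK
  rwa [IntegrableOn, Measure.restrict_eq_self_of_ae_mem] at h
  rw [ae_iff]
  exact measure_compl_cube c

end AngleLaw

/-! ### Continuity in the angles. -/

section Continuity

variable {n L : ℕ}

theorem continuous_rotation (σ : Word n) : Continuous (rotation σ) := by
  have : rotation σ = fun θ : ℝ => (Real.cos (θ / 2) : ℂ) • (1 : Op n) -
      (Complex.I * (Real.sin (θ / 2) : ℂ)) • wordOp σ := funext fun θ => rotation_eq σ θ
  rw [this]
  fun_prop

theorem Layer.continuous_unitary (l : Layer n) : Continuous l.unitary := by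
  refine Continuous.mul ?_ continuous_const
  simp only [List.ofFn_eq_map]
  exact continuous_list_prod _ fun j _ => (continuous_rotation _).comp (continuous_apply j)

theorem Layer.continuous_transition (l : Layer n) (s t : Word n) :
    Continuous fun θ => l.transition θ s t := by
  have := l.continuous_unitary
  unfold Layer.transition
  exact Continuous.matrix_trace (((continuous_const.mul this).mul continuous_const).mul
    this.matrix_conjTranspose)

theorem continuous_noisyTerm (c : Circuit n L) (lam : ℝ) (H ρ : Op n) (s : Path n L) :
    Continuous fun θ => noisyTerm c lam H ρ θ s := by
  simp only [noisyTerm_eq]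
  refine (continuous_const.mul (continuous_finsetProd _ fun i _ => ?_)).mul continuous_const
  exact (((c i).continuous_transition _ _).comp (continuous_apply i)).mul continuous_const

theorem continuous_noisyCost (c : Circuit n L) (lam : ℝ) (H ρ : Op n) :
    Continuous fun θ => noisyCost c lam H ρ θ := by
  simp only [noisyCost_eq_sum]
  exact continuous_finsetSum _ fun s _ => continuous_noisyTerm c lam H ρ s

theorem continuous_sqError (c : Circuit n L) (lam : ℝ) (H ρ : Op n) (M : ℕ) :
    Continuous (sqError c lam H ρ M) := by
  unfold sqError truncatedCost
  exact ((continuous_finsetSum _ fun s _ => continuous_noisyTerm c lam H ρ s).sub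
    (continuous_noisyCost c lam H ρ)).norm.pow 2

end Continuity

/-! ### Sign changes of path contributions under half turns and reflections. -/

section Symmetries

variable {n L : ℕ}

theorem rotation_add_pi (σ : Word n) (x : ℝ) :
    rotation σ (x + Real.pi) = rotation σ x * (-Complex.I • wordOp σ) := by
  have h : (x + Real.pi) / 2 = x / 2 + Real.pi / 2 := by ring
  rw [rotation_eq, rotation_eq, h, Real.cos_add_pi_div_two, Real.sin_add_pi_div_two, sub_mul,
    smul_mul_smul_comm, smul_mul_smul_comm, one_mul, wordOp_mul_self]
  have := Complex.I_mul_I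
  generalize Real.cos (x / 2) = a
  generalize Real.sin (x / 2) = b
  push_cast
  match_scalars
  · linear_combination (-b : ℂ) * this
  · ring

/-- The phase is `-i` or `i` according to the direction of the turn; only its modulus matters, since
it cancels under conjugation. -/
theorem rotation_halfTurn (σ : Word n) (x : ℝ) :
    ∃ z : ℂ, star z * z = 1 ∧ rotation σ (halfTurn x) = rotation σ x * (z • wordOp σ) := by
  unfold halfTurn
  split_ifs
  · exact ⟨-Complex.I, by simp, rotation_add_pi σ x⟩
  · refine ⟨Complex.I, by simp, ?_⟩
    have h := rotation_add_pi σ (x - Real.pi)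
    rw [sub_add_cancel] at h
    rw [h, mul_assoc, smul_mul_smul_comm, wordOp_mul_self]
    simp

theorem list_prod_map_mul {α M : Type*} [Monoid M] (f g : α → M) (l : List α)
    (h : ∀ a b, Commute (g a) (f b)) :
    (l.map fun a => f a * g a).prod = (l.map f).prod * (l.map g).prod := by
  induction l with
  | nil => simp
  | cons a l ih =>
    have hc : Commute (g a) (l.map f).prod :=
      Commute.list_prod_right _ _ fun x hx => by
        obtain ⟨b, _, rfl⟩ := List.mem_map.mp hx
        exact h a b
    simp only [List.map_cons, List.prod_cons, ih]
    rw [mul_assoc, ← mul_assoc (g a), hc.eq]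
    simp only [mul_assoc]

theorem Layer.word_commute (l : Layer n) (j k : Fin l.R) :
    Commute (wordOp (l.word j)) (wordOp (l.word k)) := by
  by_cases h : j = k
  · rw [h]
  · exact wordOp_commute_of_disjoint (l.rot_disjoint j k h)

theorem onQubit_commute {a : Fin n} {u : Matrix (Fin 2) (Fin 2) ℂ} {s : Word n}
    (h : s a = .I) : Commute (onQubit a u) (wordOp s) := by
  rw [Commute, SemiconjBy, onQubit_eq_tens, wordOp_eq_tens, tens_mul, tens_mul]
  congr 1
  funext q
  by_cases hq : q = a
  · subst hq; simp [h, Pauli.mat]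
  · simp [Function.update_of_ne hq]

/-- Operators that permute the Pauli words by conjugation, up to phases. -/
structure IsCliffordOp (A : Op n) : Prop where
  mem_unitary : A ∈ unitary (Op n)
  conj : ∀ P : Word n, ∃ (z : ℂ) (Q : Word n), Aᴴ * wordOp P * A = z • wordOp Q

theorem IsCliffordOp.exists_phase {A : Op n} (hA : IsCliffordOp A) (P : Word n) :
    ∃ (z : ℂ) (Q : Word n), star z * z = 1 ∧ Aᴴ * wordOp P * A = z • wordOp Q := by
  obtain ⟨z, Q, h⟩ := hA.conj P
  refine ⟨z, Q, ?_, h⟩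
  have h1 : (Aᴴ * wordOp P * A)ᴴ * (Aᴴ * wordOp P * A) = 1 := by
    have h2 : A * Aᴴ = 1 := Unitary.mul_star_self_of_mem hA.mem_unitary
    have h3 : Aᴴ * A = 1 := Unitary.star_mul_self_of_mem hA.mem_unitary
    simp only [Matrix.conjTranspose_mul, Matrix.conjTranspose_conjTranspose, wordOp_conjTranspose]
    calc Aᴴ * (wordOp P * A) * (Aᴴ * wordOp P * A)
        = Aᴴ * wordOp P * (A * Aᴴ) * wordOp P * A := by simp only [mul_assoc]
      _ = Aᴴ * (wordOp P * wordOp P) * A := by rw [h2, mul_one]; simp only [mul_assoc]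
      _ = 1 := by rw [wordOp_mul_self, mul_one, h3]
  rw [h, Matrix.conjTranspose_smul, wordOp_conjTranspose, smul_mul_smul_comm,
    wordOp_mul_self] at h1
  -- A scalar multiple of the identity is determined by a single diagonal entry.
  have := congrFun (congrFun h1 fun _ => 0) fun _ => 0
  simpa using this

theorem isCliffordOp_one : IsCliffordOp (1 : Op n) :=
  ⟨one_mem _, fun P => ⟨1, P, by simp⟩⟩

theorem IsCliffordOp.mul {A B : Op n} (hA : IsCliffordOp A) (hB : IsCliffordOp B) :
    IsCliffordOp (A * B) := by
  refine ⟨mul_mem hA.mem_unitary hB.mem_unitary, fun P => ?_⟩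
  obtain ⟨z, Q, h⟩ := hA.conj P
  obtain ⟨z', Q', h'⟩ := hB.conj Q
  refine ⟨z * z', Q', ?_⟩
  calc (A * B)ᴴ * wordOp P * (A * B) = Bᴴ * (Aᴴ * wordOp P * A) * B := by
        simp only [Matrix.conjTranspose_mul, mul_assoc]
    _ = (z * z') • wordOp Q' := by rw [h, mul_smul_comm, smul_mul_assoc, h', smul_smul]

theorem isCliffordOp_list_prod {l : List (Op n)} (h : ∀ A ∈ l, IsCliffordOp A) :
    IsCliffordOp l.prod := by
  induction l with
  | nil => exact isCliffordOp_one
  | cons A l ih =>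
    rw [List.prod_cons]
    exact (h A (by simp)).mul (ih fun B hB => h B (by simp [hB]))

theorem Layer.isCliffordOp (l : Layer n) : IsCliffordOp l.cliffordOp :=
  isCliffordOp_list_prod fun A hA => by
    obtain ⟨j, rfl⟩ := (List.mem_ofFn' _ _).mp hA
    exact ⟨Clifford.op_mem_unitary _, fun P => ⟨_, _, conjGateT_spec _ _⟩⟩

theorem Clifford.commute_of_disjoint {V : Clifford n} {s : Word n}
    (h : Disjoint (wordSupport s) V.support) : Commute V.op (wordOp s) := by
  have hI : ∀ a ∈ V.support, s a = .I := fun a ha => by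
    by_contra hs
    exact Finset.disjoint_left.mp h (Finset.mem_filter.mpr ⟨Finset.mem_univ a, hs⟩) ha
  cases V with
  | had a => exact onQubit_commute (hI a (by simp [Clifford.support]))
  | phase a => exact onQubit_commute (hI a (by simp [Clifford.support]))
  | cnot a b hab =>
    have ha := hI a (by simp [Clifford.support])
    have hb := hI b (by simp [Clifford.support])
    have hs := conjGateT_spec (.cnot a b hab) s
    have h1 : (conjGateT s (.cnot a b hab)).val = (1, s) := by
      simp [conjGateT, writeT_val, ha, hb, Pauli.cnotSign, Pauli.cnotWord, Pauli.cnotControl,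
        Pauli.cnotTarget, Pauli.mulPhase, Pauli.mul]
      rw [← ha, Function.update_eq_self, ha, ← hb, Function.update_eq_self]
    rw [h1, one_smul] at hs
    have hu : (Clifford.cnot a b hab).op * (Clifford.cnot a b hab).opᴴ = 1 :=
      Unitary.mul_star_self_of_mem (Clifford.op_mem_unitary _)
    rw [Commute, SemiconjBy]
    conv_lhs => rw [← hs, ← mul_assoc, ← mul_assoc, hu, one_mul]

theorem Layer.cliffordOp_commute (l : Layer n) (j : Fin l.R) :
    Commute l.cliffordOp (wordOp (l.word j)) :=
  Commute.list_prod_left _ _ fun A hA => by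
    obtain ⟨k, rfl⟩ := (List.mem_ofFn' _ _).mp hA
    exact Clifford.commute_of_disjoint (l.rot_gate_disjoint j k)

/-- Transition amplitudes transform with signs when the layer is multiplied with words. -/
theorem Layer.transition_of_unitary_eq (l : Layer n) (θ θ' : Fin l.R → ℝ) (P Q : Word n) (z : ℂ)
    (hz : star z * z = 1) (h : l.unitary θ' = wordOp P * l.unitary θ * (z • wordOp Q))
    (s t : Word n) :
    l.transition θ' s t = sgn P s * sgn Q t * l.transition θ s t := by
  have h1 : wordOp s * (wordOp P * l.unitary θ * (z • wordOp Q)) * wordOp t *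
      (wordOp P * l.unitary θ * (z • wordOp Q))ᴴ = (star z * z) •
      (wordOp s * wordOp P * (l.unitary θ * (wordOp Q * wordOp t * wordOp Q) *
        (l.unitary θ)ᴴ) * wordOp P) := by
    simp only [Matrix.conjTranspose_mul, Matrix.conjTranspose_smul, wordOp_conjTranspose,
      mul_smul_comm, smul_mul_assoc, smul_smul, mul_assoc]
  have h2 : (wordOp s * (wordOp P * l.unitary θ * (z • wordOp Q)) * wordOp t *
      (wordOp P * l.unitary θ * (z • wordOp Q))ᴴ).trace = sgn P s * sgn Q t *
      (wordOp s * l.unitary θ * wordOp t * (l.unitary θ)ᴴ).trace := by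
    rw [h1, hz, one_smul, wordOp_conj, Matrix.trace_mul_comm, ← mul_assoc (wordOp P),
      ← mul_assoc (wordOp P), wordOp_conj]
    simp only [smul_mul_assoc, mul_smul_comm, Matrix.trace_smul, smul_eq_mul, mul_assoc]
    exact mul_left_comm _ _ _
  rw [transition, transition, h]
  generalize wordOp P * l.unitary θ * (z • wordOp Q) = U at h2 ⊢
  simp only [normOp, smul_mul_assoc, mul_smul_comm, Matrix.trace_smul, smul_eq_mul]
  rw [h2]
  ring

/-- The turn inserts a factor `σ`, up to phase. It commutes with the other rotations and with the
disjoint Clifford gates, so it moves to the right end of the layer, where it conjugates `t`. -/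
theorem Layer.transition_halfTurn (l : Layer n) (θ : Fin l.R → ℝ) (j : Fin l.R) (s t : Word n) :
    l.transition (fun k => if k = j then halfTurn (θ k) else θ k) s t =
      sgn (l.word j) t * l.transition θ s t := by
  obtain ⟨z, hz, h⟩ := rotation_halfTurn (l.word j) (θ j)
  rw [l.transition_of_unitary_eq θ _ (idWord n) (l.word j) z hz]
  · have : sgn (idWord n) s = 1 := Finset.prod_eq_one fun q _ => Pauli.I_sgn _
    rw [this, one_mul]
  · rw [wordOp_idWord, one_mul, unitary_eq, unitary_eq, mul_smul_comm, mul_assoc,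
      (l.cliffordOp_commute j).eq, ← mul_assoc, ← smul_mul_assoc, ← mul_smul_comm]
    congr 1
    let g : Fin l.R → Op n := fun k => if k = j then z • wordOp (l.word j) else 1
    have h1 : ∀ k, rotation (l.word k) (if k = j then halfTurn (θ k) else θ k) =
        rotation (l.word k) (θ k) * g k := fun k => by
      by_cases hk : k = j
      · subst hk; simp [g, h]
      · simp [g, hk]
    have h2 : ∀ k m, Commute (g k) (rotation (l.word m) (θ m)) := fun k m => by
      by_cases hk : k = j
      · simp only [g, hk, if_true]
        exact ((rotation_commute (l.word_commute m j) _).symm).smul_left z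
      · simp [g, hk]
    simp only [rotOp, List.ofFn_eq_map, h1]
    rw [list_prod_map_mul _ _ _ h2, List.prod_map_eq_pow_single j g
      (fun k hk _ => by simp [g, hk]), List.count_eq_one_of_mem (List.nodup_finRange _)
      (List.mem_finRange j), pow_one]
    simp [g]

/-- Reflection of the angle of a rotation that anti-commutes with a word. -/
noncomputable def reflect (P σ : Word n) (x : ℝ) : ℝ := if sgn P σ = -1 then -x else x

theorem rotation_reflect (P σ : Word n) (x : ℝ) :
    rotation σ (reflect P σ x) = wordOp P * rotation σ x * wordOp P := by
  rw [rotation_eq, rotation_eq, mul_sub, sub_mul, mul_smul_comm, mul_smul_comm, smul_mul_assoc,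
    smul_mul_assoc, mul_one, wordOp_mul_self, wordOp_conj, reflect]
  split_ifs with h
  · rw [h, neg_div, Real.cos_neg, Real.sin_neg]
    push_cast
    module
  · rw [(sgn_eq_or P σ).resolve_right h, one_smul]

theorem list_prod_map_conj {α M : Type*} [Monoid M] (p : M) (hp : p * p = 1) (f : α → M)
    (l : List α) : (l.map fun a => p * f a * p).prod = p * (l.map f).prod * p := by
  induction l with
  | nil => simp [hp]
  | cons a l ih =>
    simp only [List.map_cons, List.prod_cons, ih]
    calc p * f a * p * (p * (l.map f).prod * p)
        = p * f a * (p * p) * (l.map f).prod * p := by simp only [mul_assoc]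
      _ = p * (f a * (l.map f).prod) * p := by rw [hp, mul_one]; simp only [mul_assoc]

/-- Reflecting the angles conjugates the rotation part by `P`. The left copy of `P` meets `s`; the
right copy is carried through the Clifford part, becomes `Q` up to phase, and meets `t`. -/
theorem Layer.transition_reflect (l : Layer n) (θ : Fin l.R → ℝ) (P Q : Word n) (z : ℂ)
    (hz : star z * z = 1) (h : l.cliffordOpᴴ * wordOp P * l.cliffordOp = z • wordOp Q)
    (s t : Word n) :
    l.transition (fun k => reflect P (l.word k) (θ k)) s t =
      sgn P s * sgn Q t * l.transition θ s t := by
  refine l.transition_of_unitary_eq θ _ P Q z hz ?_ s t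
  have hV : l.cliffordOp * l.cliffordOpᴴ = 1 := Unitary.mul_star_self_of_mem
    l.cliffordOp_mem_unitary
  rw [← h, unitary_eq, unitary_eq]
  have h1 : l.rotOp (fun k => reflect P (l.word k) (θ k)) =
      wordOp P * l.rotOp θ * wordOp P := by
    simp only [rotOp, List.ofFn_eq_map, rotation_reflect]
    exact list_prod_map_conj _ (wordOp_mul_self P) _ _
  rw [h1]
  calc wordOp P * l.rotOp θ * wordOp P * l.cliffordOp
      = wordOp P * l.rotOp θ * 1 * wordOp P * l.cliffordOp := by rw [mul_one]
    _ = _ := by rw [← hV]; simp only [mul_assoc]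

theorem noisyTerm_of_transition (c : Circuit n L) (lam : ℝ) (H ρ : Op n) (θ θ' : Params c)
    (s : Path n L) (i : Fin L) (χ : ℂ) (hne : ∀ k, k ≠ i → θ' k = θ k)
    (h : (c i).transition (θ' i) (s i.succ) (s i.castSucc) =
      χ * (c i).transition (θ i) (s i.succ) (s i.castSucc)) :
    noisyTerm c lam H ρ θ' s = χ * noisyTerm c lam H ρ θ s := by
  rw [noisyTerm_eq, noisyTerm_eq, ← Finset.mul_prod_erase _ _ (Finset.mem_univ i),
    ← Finset.mul_prod_erase _ _ (Finset.mem_univ i), h]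
  rw [Finset.prod_congr rfl fun k hk => by rw [hne k (Finset.ne_of_mem_erase hk)]]
  ring

/-- Two contributions that transform with opposite signs under a symmetry are orthogonal. -/
theorem integral_eq_zero_of_sign (c : Circuit n L) (lam : ℝ) (H ρ : Op n) (s s' : Path n L)
    (e : ∀ i, Fin (c i).R → ℝ → ℝ) (he : ∀ i j, MeasurePreserving (e i j) angleLaw angleLaw)
    (χ χ' : ℂ) (hχ : χ * star χ' = -1)
    (hs : ∀ θ, noisyTerm c lam H ρ (fun i j => e i j (θ i j)) s = χ * noisyTerm c lam H ρ θ s)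
    (hs' : ∀ θ, noisyTerm c lam H ρ (fun i j => e i j (θ i j)) s' =
      χ' * noisyTerm c lam H ρ θ s') :
    ∫ θ, noisyTerm c lam H ρ θ s * star (noisyTerm c lam H ρ θ s') ∂(paramLaw c) = 0 := by
  have hm := measurePreserving_params c e he
  have hc : Continuous fun θ => noisyTerm c lam H ρ θ s * star (noisyTerm c lam H ρ θ s') :=
    (continuous_noisyTerm c lam H ρ s).mul (continuous_noisyTerm c lam H ρ s').star
  have h1 := integral_map (μ := paramLaw c) hm.measurable.aemeasurable
    (f := fun θ => noisyTerm c lam H ρ θ s * star (noisyTerm c lam H ρ θ s'))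
    hc.aestronglyMeasurable
  rw [hm.map_eq] at h1
  have h2 : ∀ θ : Params c, noisyTerm c lam H ρ (fun i j => e i j (θ i j)) s *
      star (noisyTerm c lam H ρ (fun i j => e i j (θ i j)) s') =
      -(noisyTerm c lam H ρ θ s * star (noisyTerm c lam H ρ θ s')) := fun θ => by
    rw [hs, hs', star_mul', neg_eq_neg_one_mul, ← hχ]
    ring
  simp only [h2, integral_neg] at h1
  -- The change of variables preserves the measure and negates the integrand.
  exact self_eq_neg.mp h1

end Symmetries

/-! ### Orthogonality of Pauli paths and the mean-square error. -/

section Orthogonality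

variable {n L : ℕ}

theorem star_sgn (v w : Word n) : star (sgn v w) = sgn v w := by
  rcases sgn_eq_or v w with h | h <;> simp [h]

theorem ne_zero_of_sgn (v w : Word n) : sgn v w ≠ 0 := by
  rcases sgn_eq_or v w with h | h <;> simp [h]

/-- The product of the Clifford parts of the first `k` layers. -/
noncomputable def cliffordPrefix (c : Circuit n L) (k : ℕ) : Op n :=
  (((List.ofFn fun i => (c i).cliffordOp).take k).reverse).prod

theorem cliffordPrefix_succ (c : Circuit n L) (i : Fin L) :
    cliffordPrefix c (i + 1) = (c i).cliffordOp * cliffordPrefix c i := by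
  unfold cliffordPrefix
  rw [List.take_add_one, List.reverse_append, List.prod_append]
  simp

theorem wordOp_mul_mul_comm (w v v' : Word n) :
    wordOp w * (wordOp v * wordOp v') = (sgn w v * sgn w v') • (wordOp v * wordOp v' * wordOp w) := by
  rw [← mul_assoc, wordOp_mul_comm w v, smul_mul_assoc, mul_assoc, wordOp_mul_comm w v',
    mul_smul_comm, smul_smul, mul_assoc]

theorem commute_mul_iff (w v v' : Word n) :
    Commute (wordOp w) (wordOp v * wordOp v') ↔ sgn w v * sgn w v' = 1 := by
  constructor
  · intro h
    have h1 := wordOp_mul_mul_comm w v v'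
    rw [h.eq] at h1
    -- The product of the three words is invertible, so the scalar in `h1` can be read off.
    have h2 : wordOp v * wordOp v' * wordOp w * (wordOp w * wordOp v' * wordOp v) = 1 := by
      calc wordOp v * wordOp v' * wordOp w * (wordOp w * wordOp v' * wordOp v)
          = wordOp v * (wordOp v' * (wordOp w * wordOp w) * wordOp v') * wordOp v := by
            simp only [mul_assoc]
        _ = 1 := by rw [wordOp_mul_self, mul_one, wordOp_mul_self, mul_one, wordOp_mul_self]
    have h3 := congrArg (· * (wordOp w * wordOp v' * wordOp v)) h1
    simp only [smul_mul_assoc, h2] at h3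
    have := congrFun (congrFun h3 fun _ => 0) fun _ => 0
    simpa using this.symm
  · intro h
    rw [Commute, SemiconjBy, wordOp_mul_mul_comm, h, one_smul]

/-- In a generating circuit a Pauli path is determined by its signs under the symmetries. -/
theorem path_eq_of_signs {c : Circuit n L} (hc : Generates c) {s s' : Path n L}
    (h1 : ∀ (i : Fin L) (j : Fin (c i).R),
      sgn ((c i).word j) (s i.castSucc) * sgn ((c i).word j) (s' i.castSucc) = 1)
    (h2 : ∀ (i : Fin L) (P Q : Word n) (z : ℂ), star z * z = 1 →
      (c i).cliffordOpᴴ * wordOp P * (c i).cliffordOp = z • wordOp Q →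
      sgn P (s i.succ) * sgn Q (s i.castSucc) * (sgn P (s' i.succ) * sgn Q (s' i.castSucc)) = 1) :
    s = s' := by
  -- The reflection signs carry the comparison of `s k` with `s' k` through `P` back to a comparison
  -- at time `0` through the pulled-back word.
  have key : ∀ (k : ℕ) (hk : k < L + 1) (P : Word n), ∃ (z : ℂ) (Q : Word n),
      (cliffordPrefix c k)ᴴ * wordOp P * cliffordPrefix c k = z • wordOp Q ∧
      sgn P (s ⟨k, hk⟩) * sgn P (s' ⟨k, hk⟩) = sgn Q (s 0) * sgn Q (s' 0) := by
    intro k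
    induction k with
    | zero => exact fun hk P => ⟨1, P, by simp [cliffordPrefix], rfl⟩
    | succ k ih =>
      intro hk P
      have hkL : k < L := by omega
      obtain ⟨z, Q, hz, hQ⟩ := (c ⟨k, hkL⟩).isCliffordOp.exists_phase P
      obtain ⟨z', Q', hQ', hs⟩ := ih (by omega) Q
      refine ⟨z * z', Q', ?_, ?_⟩
      · have := cliffordPrefix_succ c ⟨k, hkL⟩
        simp only at this
        rw [this, Matrix.conjTranspose_mul]
        calc (cliffordPrefix c k)ᴴ * (c ⟨k, hkL⟩).cliffordOpᴴ * wordOp P *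
              ((c ⟨k, hkL⟩).cliffordOp * cliffordPrefix c k)
            = (cliffordPrefix c k)ᴴ * ((c ⟨k, hkL⟩).cliffordOpᴴ * wordOp P *
              (c ⟨k, hkL⟩).cliffordOp) * cliffordPrefix c k := by simp only [mul_assoc]
          _ = _ := by rw [hQ, mul_smul_comm, smul_mul_assoc, hQ', smul_smul]
      · have h3 := h2 ⟨k, hkL⟩ P Q z hz hQ
        rw [← hs]
        simp only [Fin.succ_mk, Fin.castSucc_mk] at h3
        have h4 := sgn_mul_self Q (s ⟨k, by omega⟩)
        have h5 := sgn_mul_self Q (s' ⟨k, by omega⟩)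
        generalize sgn Q (s ⟨k, _⟩) = a at *
        generalize sgn Q (s' ⟨k, _⟩) = b at *
        generalize sgn P (s ⟨k + 1, _⟩) = d at *
        generalize sgn P (s' ⟨k + 1, _⟩) = f at *
        have : d * f = d * f * (a * a) * (b * b) := by rw [h4, h5]; ring
        rw [this]
        linear_combination a * b * h3
  -- The half-turn signs, carried back by `key`, say that each effected word commutes with `s 0 * s'
  -- 0`; the commutant is closed under products.
  have hgen : ∀ A ∈ Submonoid.closure {A : Op n | ∃ i j, A = effectedWord c i j},
      Commute A (wordOp (s 0) * wordOp (s' 0)) := by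
    intro A hA
    induction hA using Submonoid.closure_induction with
    | mem A hA =>
      obtain ⟨i, j, rfl⟩ := hA
      obtain ⟨z, Q, hQ, hs⟩ := key i (by omega) ((c i).word j)
      have h3 : sgn Q (s 0) * sgn Q (s' 0) = 1 := by
        rw [← hs]; exact h1 i j
      have h4 : effectedWord c i j = z • wordOp Q := hQ
      rw [h4]
      exact ((commute_mul_iff _ _ _).mpr h3).smul_left z
    | one => exact Commute.one_left _
    | mul A B _ _ hA hB => exact hA.mul_left hB
  have h0 : ∀ w : Word n, sgn w (s 0) * sgn w (s' 0) = 1 := by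
    intro w
    obtain ⟨k, hk⟩ := hc w
    have h3 := hgen _ hk
    rw [← commute_mul_iff]
    have h4 := h3.smul_left (Complex.I ^ k)⁻¹
    rwa [smul_smul, inv_mul_cancel₀ (pow_ne_zero _ Complex.I_ne_zero), one_smul] at h4
  funext i
  refine eq_of_sgn fun P => ?_
  obtain ⟨z, Q, -, hs⟩ := key i i.isLt P
  rw [h0] at hs
  have h5 := sgn_mul_self P (s' i)
  have h6 := ne_zero_of_sgn P (s' i)
  exact mul_right_cancel₀ h6 (hs.trans h5.symm)

/-- In a generating circuit the contributions of distinct Pauli paths are orthogonal. -/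
theorem integral_noisyTerm_mul {c : Circuit n L} (hc : Generates c) (lam : ℝ) (H ρ : Op n)
    {s s' : Path n L} (hne : s ≠ s') :
    ∫ θ, noisyTerm c lam H ρ θ s * star (noisyTerm c lam H ρ θ s') ∂(paramLaw c) = 0 := by
  have hid : MeasurePreserving (fun x : ℝ => x) angleLaw angleLaw := MeasurePreserving.id angleLaw
  by_contra hint
  -- A non-zero integral forbids opposite signs under any symmetry, so the two paths agree in all
  -- signs.
  refine hne (path_eq_of_signs hc (fun i j => ?_) fun i P Q z hz hQ => ?_)
  · by_contra hs
    have hs1 : sgn ((c i).word j) (s i.castSucc) * sgn ((c i).word j) (s' i.castSucc) = -1 := by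
      rcases sgn_eq_or ((c i).word j) (s i.castSucc) with h | h <;>
        rcases sgn_eq_or ((c i).word j) (s' i.castSucc) with h' | h' <;> simp_all
    -- The type of gate indices depends on the layer, so layer and gate are compared as a pair.
    let e : ∀ k, Fin (c k).R → ℝ → ℝ := fun k m x =>
      if (⟨k, m⟩ : Σ k, Fin (c k).R) = ⟨i, j⟩ then halfTurn x else x
    have hT : ∀ (θ : Params c) (t : Path n L),
        noisyTerm c lam H ρ (fun k m => e k m (θ k m)) t =
          sgn ((c i).word j) (t i.castSucc) * noisyTerm c lam H ρ θ t := fun θ t => by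
      refine noisyTerm_of_transition c lam H ρ θ _ t i _ (fun k hk => ?_) ?_
      · funext m
        simp only [e, Sigma.mk.injEq, hk, false_and, if_false]
      · rw [← Layer.transition_halfTurn]
        simp [e]
    refine hint (integral_eq_zero_of_sign c lam H ρ s s' e (fun k m => ?_) _ _ ?_
      (fun θ => hT θ s) fun θ => hT θ s')
    · by_cases h : (⟨k, m⟩ : Σ k, Fin (c k).R) = ⟨i, j⟩
      · simpa [e, h] using measurePreserving_halfTurn
      · simpa [e, h] using hid
    · rw [star_sgn, hs1]
  · by_contra hs
    have hs1 : sgn P (s i.succ) * sgn Q (s i.castSucc) *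
        (sgn P (s' i.succ) * sgn Q (s' i.castSucc)) = -1 := by
      rcases sgn_eq_or P (s i.succ) with h | h <;>
        rcases sgn_eq_or P (s' i.succ) with h' | h' <;>
        rcases sgn_eq_or Q (s i.castSucc) with h'' | h'' <;>
        rcases sgn_eq_or Q (s' i.castSucc) with h''' | h''' <;> simp_all
    let e : ∀ k, Fin (c k).R → ℝ → ℝ := fun k m x =>
      if k = i then reflect P ((c k).word m) x else x
    have hT : ∀ (θ : Params c) (t : Path n L),
        noisyTerm c lam H ρ (fun k m => e k m (θ k m)) t =
          sgn P (t i.succ) * sgn Q (t i.castSucc) * noisyTerm c lam H ρ θ t := fun θ t => by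
      refine noisyTerm_of_transition c lam H ρ θ _ t i _ (fun k hk => ?_) ?_
      · funext m
        simp only [e, hk, if_false]
      · rw [← Layer.transition_reflect _ _ P Q z hz hQ]
        simp [e]
    refine hint (integral_eq_zero_of_sign c lam H ρ s s' e (fun k m => ?_) _ _ ?_
      (fun θ => hT θ s) fun θ => hT θ s')
    · by_cases h : k = i
      · by_cases h' : sgn P ((c k).word m) = -1
        · simp only [e, h, if_true]
          subst h
          simpa only [reflect, h', if_true] using measurePreserving_neg_angleLaw
        · simp only [e, h, if_true]
          subst h
          simpa only [reflect, h', if_false] using hid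
      · simpa only [e, h, if_false] using hid
    · rw [star_mul', star_sgn, star_sgn, hs1]

theorem noisyTerm_eq_pow (c : Circuit n L) (lam : ℝ) (H ρ : Op n) (θ : Params c)
    (s : Path n L) : noisyTerm c lam H ρ θ s =
      ((1 - lam : ℝ) : ℂ) ^ pathWeight s * noisyTerm c 0 H ρ θ s := by
  rw [noisyTerm_eq, noisyTerm_eq, pathWeight, Fin.sum_univ_castSucc, pow_add,
    ← Finset.prod_pow_eq_pow_sum, Finset.prod_mul_distrib]
  simp only [sub_zero, Complex.ofReal_one, one_pow, mul_one]
  ring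

/-- Pythagoras for the contributions of Pauli paths. -/
theorem integral_norm_sq_sum {c : Circuit n L} (hc : Generates c) (lam : ℝ) (H ρ : Op n)
    (S : Finset (Path n L)) :
    ∫ θ, ‖∑ s ∈ S, noisyTerm c lam H ρ θ s‖ ^ 2 ∂(paramLaw c) =
      ∑ s ∈ S, ∫ θ, ‖noisyTerm c lam H ρ θ s‖ ^ 2 ∂(paramLaw c) := by
  have h1 : ∀ z : ℂ, ((‖z‖ ^ 2 : ℝ) : ℂ) = z * star z := fun z => by
    rw [Complex.star_def, Complex.mul_conj, Complex.normSq_eq_norm_sq]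
  have hint : ∀ s s' : Path n L, Integrable (fun θ =>
      noisyTerm c lam H ρ θ s * star (noisyTerm c lam H ρ θ s')) (paramLaw c) := fun s s' =>
    integrable_of_continuous
      ((continuous_noisyTerm c lam H ρ s).mul (continuous_noisyTerm c lam H ρ s').star)
  have h2 : ∀ θ, ((‖∑ s ∈ S, noisyTerm c lam H ρ θ s‖ ^ 2 : ℝ) : ℂ) =
      ∑ s ∈ S, ∑ s' ∈ S, noisyTerm c lam H ρ θ s * star (noisyTerm c lam H ρ θ s') := fun θ => by
    rw [h1, star_sum, Finset.sum_mul_sum]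
  apply Complex.ofReal_injective
  rw [← integral_complex_ofReal, Complex.ofReal_sum]
  simp only [← integral_complex_ofReal, h2, h1]
  rw [integral_finsetSum _ fun s _ => integrable_finsetSum _ fun s' _ => hint s s']
  refine Finset.sum_congr rfl fun s hs => ?_
  rw [integral_finsetSum _ fun s' _ => hint s s', Finset.sum_eq_single s]
  · intro s' _ hne
    exact integral_noisyTerm_mul hc lam H ρ hne.symm
  · intro h; exact absurd hs h

theorem sqError_eq (c : Circuit n L) (lam : ℝ) (H ρ : Op n) (M : ℕ) (θ : Params c) :
    sqError c lam H ρ M θ =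
      ‖∑ s ∈ Finset.univ.filter (fun s : Path n L => ¬ pathWeight s ≤ M),
        noisyTerm c lam H ρ θ s‖ ^ 2 := by
  rw [sqError, noisyCost_eq_sum, truncatedCost,
    ← Finset.sum_filter_add_sum_filter_not Finset.univ (fun s : Path n L => pathWeight s ≤ M)
      (fun s => noisyTerm c lam H ρ θ s), sub_add_cancel_left, norm_neg]

/-- The truncation error is exponentially small in the cutoff. -/
theorem mse_le {c : Circuit n L} (hc : Generates c) {lam : ℝ} (hlam : lam ∈ Set.Icc (0 : ℝ) 1)
    (H ρ : Op n) (M : ℕ) :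
    mse c lam H ρ M ≤
      ((1 - lam) ^ 2) ^ (M + 1) * ∫ θ, ‖noisyCost c 0 H ρ θ‖ ^ 2 ∂(paramLaw c) := by
  have h0 : 0 ≤ 1 - lam := sub_nonneg.mpr hlam.2
  have h1 : 1 - lam ≤ 1 := by linarith [hlam.1]
  simp only [mse, sqError_eq, noisyCost_eq_sum]
  -- Pythagoras is used twice: for the discarded noisy paths, and in reverse to reassemble all
  -- noiseless paths into the noiseless cost. In between, each discarded path is compared with its
  -- noiseless version.
  rw [integral_norm_sq_sum hc, integral_norm_sq_sum hc, Finset.mul_sum, Finset.sum_filter]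
  refine Finset.sum_le_sum fun s _ => ?_
  have hI : 0 ≤ ∫ θ, ‖noisyTerm c 0 H ρ θ s‖ ^ 2 ∂(paramLaw c) :=
    integral_nonneg fun θ => by positivity
  split_ifs with h
  · exact mul_nonneg (by positivity) hI
  · have h2 : ∀ θ, ‖noisyTerm c lam H ρ θ s‖ ^ 2 =
        ((1 - lam) ^ 2) ^ pathWeight s * ‖noisyTerm c 0 H ρ θ s‖ ^ 2 := fun θ => by
      rw [noisyTerm_eq_pow, norm_mul, norm_pow, mul_pow, Complex.norm_real,
        Real.norm_of_nonneg h0, pow_right_comm]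
    simp only [h2]
    rw [integral_const_mul]
    exact mul_le_mul_of_nonneg_right (pow_le_pow_of_le_one (by positivity)
      (pow_le_one₀ h0 h1) (by omega)) hI

end Orthogonality

/-! ### The noiseless cost is bounded by the operator norm. -/

section OperatorNorm

variable {n L : ℕ}

/-- A density matrix is a sum of `v v*` with total squared norm `1`, so the trace becomes a sum of
the values `⟨v, H v⟩`, bounded by Cauchy–Schwarz. -/
theorem norm_trace_mul_le {H φ : Op n} (hφ : IsDensity φ) : ‖(H * φ).trace‖ ≤ opNorm H := by
  obtain ⟨m, v, hv⟩ := Matrix.posSemidef_iff_eq_sum_vecMulVec.mp hφ.1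
  let w : Fin m → EuclideanSpace ℂ (Bits n) := fun i => WithLp.toLp 2 (v i)
  have hinner : ∀ i, (H * Matrix.vecMulVec (v i) (star (v i))).trace =
      inner ℂ (w i) (Matrix.toEuclideanCLM (n := Bits n) (𝕜 := ℂ) H (w i)) := fun i => by
    rw [Matrix.mul_vecMulVec, Matrix.trace_vecMulVec]
    rfl
  have hnorm : ∑ i, ‖w i‖ ^ 2 = 1 := by
    have h := hφ.2
    rw [hv, Matrix.trace_sum] at h
    have h1 : ∀ i, (Matrix.vecMulVec (v i) (star (v i))).trace = ((‖w i‖ ^ 2 : ℝ) : ℂ) :=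
      fun i => by
        rw [Matrix.trace_vecMulVec]
        have := inner_self_eq_norm_sq_to_K (𝕜 := ℂ) (w i)
        rw [Complex.ofReal_pow]
        exact this
    simp only [h1] at h
    exact_mod_cast h
  rw [hv, Finset.mul_sum, Matrix.trace_sum]
  calc ‖∑ i, (H * Matrix.vecMulVec (v i) (star (v i))).trace‖
      ≤ ∑ i, ‖(H * Matrix.vecMulVec (v i) (star (v i))).trace‖ := norm_sum_le _ _
    _ ≤ ∑ i, opNorm H * ‖w i‖ ^ 2 := Finset.sum_le_sum fun i _ => by
        rw [hinner]
        refine (norm_inner_le_norm _ _).trans ?_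
        have := (Matrix.toEuclideanCLM (n := Bits n) (𝕜 := ℂ) H).le_opNorm (w i)
        calc _ ≤ ‖w i‖ * (opNorm H * ‖w i‖) := mul_le_mul_of_nonneg_left this (norm_nonneg _)
          _ = _ := by ring
    _ = opNorm H := by rw [← Finset.mul_sum, hnorm, mul_one]

theorem isDensity_conj {U φ : Op n} (hU : Uᴴ * U = 1) (hφ : IsDensity φ) :
    IsDensity (U * φ * Uᴴ) := by
  refine ⟨hφ.1.mul_mul_conjTranspose_same U, ?_⟩
  rw [Matrix.trace_mul_comm, ← mul_assoc, hU, one_mul, hφ.2]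

theorem norm_noisyCost_zero_le (c : Circuit n L) {H ρ : Op n} (hρ : IsDensity ρ) (θ : Params c) :
    ‖noisyCost c 0 H ρ θ‖ ≤ opNorm H := by
  refine norm_trace_mul_le ?_
  simp only [noise_zero]
  have h : ∀ (L : ℕ) (U : Fin L → Op n), (∀ i, (U i)ᴴ * U i = 1) →
      IsDensity (Fin.foldl L (fun φ i => U i * φ * (U i)ᴴ) ρ) := by
    intro L U hU
    induction L with
    | zero => simpa using hρ
    | succ L ih =>
      rw [Fin.foldl_succ_last]
      exact isDensity_conj (hU _) (ih (fun i => U i.castSucc) fun i => hU _)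
  exact h L (fun i => (c i).unitary (θ i)) fun i => (c i).conjTranspose_mul_unitary (θ i)

theorem opNorm_nonneg (A : Op n) : 0 ≤ opNorm A := norm_nonneg _

theorem mse_le_opNorm {c : Circuit n L} (hc : Generates c) {lam : ℝ}
    (hlam : lam ∈ Set.Icc (0 : ℝ) 1) (H : Op n) {ρ : Op n} (hρ : IsDensity ρ) (M : ℕ) :
    mse c lam H ρ M ≤ ((1 - lam) ^ 2) ^ (M + 1) * opNorm H ^ 2 := by
  refine (mse_le hc hlam H ρ M).trans (mul_le_mul_of_nonneg_left ?_ (by positivity))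
  have h1 : ∫ _θ, opNorm H ^ 2 ∂(paramLaw c) = opNorm H ^ 2 := by simp
  rw [← h1]
  refine integral_mono (integrable_of_continuous ((continuous_noisyCost c 0 H ρ).norm.pow 2))
    (integrable_const _) fun θ => ?_
  exact pow_le_pow_left₀ (norm_nonneg _) (norm_noisyCost_zero_le c hρ θ) 2

end OperatorNorm

/-! ### Step counts of loops. -/

section LoopSteps

/-- The invariant sees the elements still to be processed, so it can count the branchings that are
yet to come. -/
theorem loop_steps_le {α β : Type} {g : β → α → Timed β} (Inv : List α → β → Prop) {K : ℕ}
    (hstep : ∀ a l b, Inv (a :: l) b → (g b a).steps ≤ K ∧ Inv l (g b a).val)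
    (l : List α) (b : β) (h : Inv l b) :
    (loop g l b).steps ≤ l.length * (K + 1) + 1 ∧ Inv [] (loop g l b).val := by
  induction l generalizing b with
  | nil => exact ⟨by simp [loop], h⟩
  | cons a l ih =>
    obtain ⟨h1, h2⟩ := hstep a l b h
    obtain ⟨h3, h4⟩ := ih _ h2
    simp only [loop, bind_steps, bind_val, elem_val, elem_steps, List.length_cons]
    refine ⟨?_, h4⟩
    rw [Nat.succ_mul]
    omega

theorem loop_steps_le_of_forall {α β : Type} {g : β → α → Timed β} {K : ℕ}
    (h : ∀ b a, (g b a).steps ≤ K) (l : List α) (b : β) :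
    (loop g l b).steps ≤ l.length * (K + 1) + 1 :=
  (loop_steps_le (fun _ _ => True) (fun a _ b _ => ⟨h b a, trivial⟩) l b trivial).1

theorem sumLoop_steps_le {α : Type} {g : α → Timed ℂ} {K : ℕ} {l : List α}
    (h : ∀ a ∈ l, (g a).steps ≤ K) : (sumLoop g l).steps ≤ l.length * (K + 2) + 1 := by
  induction l with
  | nil => simp [sumLoop]
  | cons a l ih =>
    have h1 := h a (by simp)
    have h2 := ih fun b hb => h b (by simp [hb])
    simp only [sumLoop, bind_steps, elem_val, elem_steps, List.length_cons]
    rw [Nat.succ_mul]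
    omega

theorem le_sumLoop_steps {α : Type} (g : α → Timed ℂ) (l : List α) :
    (l.map fun a => (g a).steps).sum ≤ (sumLoop g l).steps := by
  induction l with
  | nil => simp
  | cons a l ih =>
    simp only [sumLoop, bind_steps, elem_val, elem_steps, List.map_cons, List.sum_cons]
    omega

theorem power_steps (x : ℂ) (k : ℕ) : (power x k).steps = k + 1 := by
  induction k with
  | zero => rfl
  | succ k ih => simp [power, ih]

end LoopSteps

/-! ### Step counts and list lengths within one layer. -/

section WordSteps

variable {n : ℕ}

theorem weightT_steps_le (s : Word n) : (weightT s).steps ≤ 4 * n + 1 := by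
  refine (loop_steps_le_of_forall (K := 3) (fun k q => ?_) _ _).trans (by simp; omega)
  by_cases h : s q = .I <;> simp [h]

theorem antiT_steps_le (σ s : Word n) : (antiT σ s).steps ≤ 5 * n + 1 := by
  refine (loop_steps_le_of_forall (K := 4) (fun k q => ?_) _ _).trans (by simp; omega)
  simp

theorem mulWordT_steps (σ s : Word n) : (mulWordT σ s).steps = 4 * n := by
  simp [mulWordT, tabulate, mul_comm]

theorem mulPhaseT_steps_le (σ s : Word n) : (mulPhaseT σ s).steps ≤ 5 * n + 1 := by
  refine (loop_steps_le_of_forall (K := 4) (fun k q => ?_) _ _).trans (by simp; omega)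
  simp

theorem writeT_steps (s : Word n) (a : Fin n) (p : Pauli) : (writeT s a p).steps = 3 * n := by
  have : (writeT s a p).steps = ∑ _q : Fin n, 3 := by
    simp only [writeT, tabulate]
    refine Finset.sum_congr rfl fun q _ => ?_
    by_cases h : q = a <;> simp [h]
  rw [this]
  simp [mul_comm]

theorem conjGateT_steps_le (s : Word n) (V : Clifford n) : (conjGateT s V).steps ≤ 6 * n + 5 := by
  cases V <;> simp [conjGateT, writeT_steps] <;> omega

theorem cliffordT_steps_le (V : Clifford n) (u : List (ℂ × Word n)) :
    (cliffordT V u).steps ≤ u.length * (6 * n + 9) + 1 := by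
  induction u with
  | nil => simp [cliffordT]
  | cons a u ih =>
    have := conjGateT_steps_le a.2 V
    simp only [cliffordT, bind_steps, elem_val, elem_steps, List.length_cons]
    rw [Nat.succ_mul]
    omega

theorem length_cliffordT (V : Clifford n) (u : List (ℂ × Word n)) :
    (cliffordT V u).val.length = u.length := by
  induction u with
  | nil => simp [cliffordT]
  | cons a u ih => simp [cliffordT, ih]

theorem rotateT_steps_le (σ : Word n) (θ : ℝ) (u : List (ℂ × Word n)) :
    (rotateT σ θ u).steps ≤ u.length * (14 * n + 14) + 1 := by
  induction u with
  | nil => simp [rotateT]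
  | cons a u ih =>
    have h1 := antiT_steps_le σ a.2
    have h2 := mulPhaseT_steps_le σ a.2
    have h3 := mulWordT_steps σ a.2
    simp only [rotateT, bind_steps, elem_val, elem_steps, List.length_cons]
    rw [Nat.succ_mul]
    by_cases h : (antiT σ a.2).val = true
    · simp only [h, if_true, bind_steps, elem_val, elem_steps]
      omega
    · simp only [h, if_false, elem_steps, Bool.false_eq_true]
      omega

theorem length_rotateT_of_anti (σ : Word n) (θ : ℝ) (u : List (ℂ × Word n))
    (h : ∀ t ∈ u, sgn σ t.2 = -1) : (rotateT σ θ u).val.length = u.length * 2 := by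
  induction u with
  | nil => simp [rotateT]
  | cons a u ih =>
    rw [rotateT_cons_val, if_pos (h a (by simp))]
    simp only [List.length_cons, ih fun t ht => h t (by simp [ht])]
    omega

theorem rotateT_of_commute (σ : Word n) (θ : ℝ) (u : List (ℂ × Word n))
    (h : ∀ t ∈ u, sgn σ t.2 ≠ -1) : (rotateT σ θ u).val = u := by
  induction u with
  | nil => simp [rotateT]
  | cons a u ih =>
    rw [rotateT_cons_val, if_neg (h a (by simp)), ih fun t ht => h t (by simp [ht])]

theorem mem_rotateT {σ : Word n} {θ : ℝ} {u : List (ℂ × Word n)} {t : ℂ × Word n}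
    (h : t ∈ (rotateT σ θ u).val) : ∃ t₀ ∈ u, t.2 = t₀.2 ∨ t.2 = wordMul σ t₀.2 := by
  induction u with
  | nil => simp [rotateT] at h
  | cons a u ih =>
    rw [rotateT_cons_val] at h
    split_ifs at h with hs
    · simp only [List.mem_cons] at h
      rcases h with rfl | rfl | h
      · exact ⟨a, by simp, Or.inl rfl⟩
      · exact ⟨a, by simp, Or.inr rfl⟩
      · obtain ⟨t₀, h0, h1⟩ := ih h
        exact ⟨t₀, by simp [h0], h1⟩
    · simp only [List.mem_cons] at h
      rcases h with rfl | h
      · exact ⟨t, by simp, Or.inl rfl⟩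
      · obtain ⟨t₀, h0, h1⟩ := ih h
        exact ⟨t₀, by simp [h0], h1⟩

theorem sum_card_inter_le {k : ℕ} {S : Fin k → Finset (Fin n)}
    (h : ∀ i j, i ≠ j → Disjoint (S i) (S j)) (T : Finset (Fin n)) :
    ∑ i, (S i ∩ T).card ≤ T.card := by
  rw [← Finset.card_biUnion fun i _ j _ hij => (h i j hij).mono Finset.inter_subset_left
    Finset.inter_subset_left]
  exact Finset.card_le_card (Finset.biUnion_subset.mpr fun i _ => Finset.inter_subset_right)

theorem le_of_disjoint_nonempty {k : ℕ} {S : Fin k → Finset (Fin n)}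
    (h : ∀ i j, i ≠ j → Disjoint (S i) (S j)) (hne : ∀ i, (S i).Nonempty) : k ≤ n := by
  have h1 := sum_card_inter_le h Finset.univ
  simp only [Finset.inter_univ, Finset.card_univ, Fintype.card_fin] at h1
  calc k = ∑ _i : Fin k, 1 := by simp
    _ ≤ ∑ i, (S i).card := Finset.sum_le_sum fun i _ => (hne i).card_pos
    _ ≤ n := h1

theorem Layer.R_le (l : Layer n) : l.R ≤ n :=
  le_of_disjoint_nonempty l.rot_disjoint fun j => by
    rw [← Finset.card_pos, Nat.pos_iff_ne_zero]
    exact fun h => l.word_ne j (weight_eq_zero.mp h)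

theorem Layer.C_le (l : Layer n) : l.C ≤ n :=
  le_of_disjoint_nonempty l.gate_disjoint fun k => by
    cases l.gate k <;> simp [Clifford.support]

/-- The number of rotation gates in a list that anti-commute with a word. -/
noncomputable def Layer.antiCount (l : Layer n) (s : Word n) (js : List (Fin l.R)) : ℕ :=
  (js.map fun j => if sgn (l.word j) s = -1 then 1 else 0).sum

/-- A gate that anti-commutes with `s` meets the support of `s`, and the gates have disjoint
supports. -/
theorem Layer.antiCount_le (l : Layer n) (s : Word n) :
    l.antiCount s (List.finRange l.R) ≤ weight s := by
  rw [antiCount, ← Fin.sum_univ_def]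
  refine le_trans (Finset.sum_le_sum fun j _ => ?_)
    (sum_card_inter_le l.rot_disjoint (wordSupport s))
  split_ifs with h
  · rw [Nat.one_le_iff_ne_zero, ne_eq, Finset.card_eq_zero, ← Finset.disjoint_iff_inter_eq_empty]
    intro hd
    rw [sgn_eq_one_of_disjoint hd] at h
    norm_num at h
  · exact Nat.zero_le _

theorem rotations_steps_le (l : Layer n) (θ : Fin l.R → ℝ) (s : Word n) :
    (loop (fun u j => do
      let σ ← elem (l.word j)
      let t ← elem (θ j)
      rotateT σ t u) (List.finRange l.R) [((1 : ℂ), s)]).steps ≤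
        n * (2 ^ weight s * (14 * n + 14) + 4) + 1 ∧
    (loop (fun u j => do
      let σ ← elem (l.word j)
      let t ← elem (θ j)
      rotateT σ t u) (List.finRange l.R) [((1 : ℂ), s)]).val.length ≤ 2 ^ weight s := by
  have h := loop_steps_le (g := fun u j => do
      let σ ← elem (l.word j)
      let t ← elem (θ j)
      rotateT σ t u) (K := 2 ^ weight s * (14 * n + 14) + 3)
    -- Length times `2` to the number of anti-commuting gates left is non-increasing: such a gate
    -- doubles the list and leaves the count. Multiplying by its word changes no sign with the
    -- remaining gates, as their supports are disjoint, so each gate branches on all entries or on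
    -- none.
    (fun js u => js.Nodup ∧ u.length * 2 ^ l.antiCount s js ≤ 2 ^ weight s ∧
      ∀ t ∈ u, ∀ j ∈ js, sgn (l.word j) t.2 = sgn (l.word j) s) ?_ (List.finRange l.R)
      [((1 : ℂ), s)] ⟨List.nodup_finRange _, ?_, ?_⟩
  · refine ⟨h.1.trans ?_, ?_⟩
    · rw [List.length_finRange]
      gcongr
      exact l.R_le
    · have := h.2.2.1
      simpa [Layer.antiCount] using this
  · rintro j js u ⟨hnd, hlen, hu⟩
    have hlen' : u.length ≤ 2 ^ weight s := le_trans (Nat.le_mul_of_pos_right _ (by positivity)) hlen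
    rw [List.nodup_cons] at hnd
    simp only [bind_steps, bind_val, elem_val, elem_steps]
    refine ⟨?_, hnd.2, ?_, ?_⟩
    · have h1 := rotateT_steps_le (l.word j) (θ j) u
      have h2 : u.length * (14 * n + 14) ≤ 2 ^ weight s * (14 * n + 14) :=
        Nat.mul_le_mul_right _ hlen'
      omega
    · have hc : l.antiCount s (j :: js) =
          (if sgn (l.word j) s = -1 then 1 else 0) + l.antiCount s js := by
        simp [Layer.antiCount]
      rw [hc] at hlen
      by_cases hs : sgn (l.word j) s = -1
      · rw [length_rotateT_of_anti _ _ _ fun t ht => (hu t ht j (by simp)).trans hs]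
        rw [if_pos hs, pow_add, pow_one, ← mul_assoc] at hlen
        exact hlen
      · rw [rotateT_of_commute _ _ _ fun t ht h => hs ((hu t ht j (by simp)).symm.trans h)]
        rwa [if_neg hs, zero_add] at hlen
    · intro t ht k hk
      obtain ⟨t₀, h0, h1⟩ := mem_rotateT ht
      have h2 := hu t₀ h0 k (by simp [hk])
      rcases h1 with h1 | h1
      · rw [h1, h2]
      · have hkj : k ≠ j := fun h => hnd.1 (h ▸ hk)
        rw [h1, sgn_wordMul, sgn_eq_one_of_disjoint (l.rot_disjoint k j hkj), one_mul, h2]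
  · simpa using Nat.pow_le_pow_right (by norm_num) (l.antiCount_le s)
  · intro t ht j _
    rw [List.mem_singleton] at ht
    rw [ht]

theorem candidatesT_steps_le (l : Layer n) (θ : Fin l.R → ℝ) (s : Word n) :
    (candidatesT l θ s).steps ≤ 2 ^ weight s * (30 * (n + 1) ^ 2) ∧
      (candidatesT l θ s).val.length ≤ 2 ^ weight s := by
  obtain ⟨h1, h2⟩ := rotations_steps_le l θ s
  have h3 := loop_steps_le (g := fun u k => do
      let V ← elem (l.gate k)
      cliffordT V u) (K := 2 ^ weight s * (6 * n + 9) + 2)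
      (fun _ u => u.length ≤ 2 ^ weight s) (fun k _ u hu => by
        simp only [bind_steps, bind_val, elem_val, elem_steps, length_cliffordT]
        have h4 := cliffordT_steps_le (l.gate k) u
        have h5 : u.length * (6 * n + 9) ≤ 2 ^ weight s * (6 * n + 9) :=
          Nat.mul_le_mul_right _ hu
        exact ⟨by omega, hu⟩) (List.finRange l.C) _ h2
  simp only [candidatesT, bind_steps, bind_val, elem_val, elem_steps]
  refine ⟨?_, h3.2⟩
  have h4 := h3.1
  rw [List.length_finRange] at h4
  have h5 : l.C * (2 ^ weight s * (6 * n + 9) + 2 + 1) ≤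
      n * (2 ^ weight s * (6 * n + 9) + 2 + 1) := Nat.mul_le_mul_right _ l.C_le
  have h6 : 1 ≤ 2 ^ weight s := Nat.one_le_two_pow
  have h7 : n ≤ n * 2 ^ weight s := Nat.le_mul_of_pos_right _ h6
  have h8 : 2 ^ weight s * (30 * (n + 1) ^ 2) = n * (2 ^ weight s * (14 * n + 14)) +
    n * (2 ^ weight s * (6 * n + 9)) + 10 * n * (n * 2 ^ weight s) + 37 * (n * 2 ^ weight s) +
      30 * 2 ^ weight s := by ring
  have h9 : 0 ≤ 10 * n * (n * 2 ^ weight s) := Nat.zero_le _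
  rw [h8]
  nlinarith

theorem expectationT_steps_le (s : Word n) (ρ : StateData n) :
    (expectationT s ρ).steps ≤ ρ.length * (6 * n + 3) + 1 := by
  refine (sumLoop_steps_le (K := 6 * n + 1) fun e _ => ?_).trans le_rfl
  refine (loop_steps_le_of_forall (K := 5) (fun z q => ?_) _ _).trans (by simp; omega)
  simp

theorem keepT_steps (M i acc w : ℕ) : (keepT M i acc w).steps = 5 := rfl

end WordSteps

/-! ### Step count of the whole method. -/

section MethodSteps

variable {n L : ℕ}

/-- A kept candidate of weight `w` costs at most `Q (i + 1) 2 ^ w * 2 ^ (M - acc - w)`: its own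
branching is paid for by the budget that it uses up. All candidates thus share the bound with `2 ^
(M - acc)`, and there are at most `2 ^ weight s` of them. Each level adds one more `Q`, which
dominates the overhead of a node and the work at a leaf. -/
theorem descend_steps_le (c : Circuit n L) (lam : ℝ) (ρ : StateData n) (M : ℕ) (θ : Params c)
    {Q : ℕ} (hQ : M + (ρ.length * (6 * n + 3) + 1) + 30 * (n + 1) ^ 2 + (4 * n + 12) ≤ Q)
    (i : ℕ) (hi : i ≤ L) (acc : ℕ) (s : Word n) (z : ℂ) (hacc : acc ≤ M) :
    (descend c lam ρ M θ i hi acc s z).steps ≤ Q * (i + 1) * (2 ^ weight s * 2 ^ (M - acc)) := by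
  induction i generalizing acc s z with
  | zero =>
    have h1 := expectationT_steps_le s ρ
    have h2 : 1 ≤ 2 ^ weight s * 2 ^ (M - acc) := Nat.one_le_iff_ne_zero.mpr (by positivity)
    simp only [descend, bind_steps, elem_steps, elem_val, power_steps]
    calc _ ≤ Q := by omega
      _ ≤ Q * (0 + 1) * (2 ^ weight s * 2 ^ (M - acc)) := by
        rw [zero_add, mul_one]; exact Nat.le_mul_of_pos_right _ h2
  | succ i ih =>
    obtain ⟨h1, h2⟩ := candidatesT_steps_le (c ⟨i, hi⟩) (θ ⟨i, hi⟩) s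
    rw [descend, bind_steps]
    have h3 := sumLoop_steps_le (g := fun a : ℂ × Word n => (do
        let w ← weightT a.2
        if ← keepT M i acc w then do
          let acc' ← elem (acc + w)
          let z' ← elem (z * a.1)
          descend c lam ρ M θ i (Nat.le_of_succ_le hi) acc' a.2 z'
        else elem 0 : Timed ℂ)) (K := 4 * n + 8 + Q * (i + 1) * 2 ^ (M - acc))
        (l := (candidatesT (c ⟨i, hi⟩) (θ ⟨i, hi⟩) s).val) (fun a _ => by
      have h4 := weightT_steps_le a.2
      simp only [bind_steps, weightT_val, keepT_steps]
      by_cases h : (keepT M i acc (weight a.2)).val = true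
      · rw [if_pos h]
        have h' : acc + weight a.2 ≤ M := by
          rw [keepT_val, decide_eq_true_eq] at h; omega
        have h5 := ih (Nat.le_of_succ_le hi) (acc + weight a.2) a.2 (z * a.1) h'
        have h6 : 2 ^ weight a.2 * 2 ^ (M - (acc + weight a.2)) = 2 ^ (M - acc) := by
          rw [← pow_add]; congr 1; omega
        rw [h6] at h5
        simp only [bind_steps, elem_val, elem_steps]
        omega
      · rw [if_neg h, elem_steps]
        omega)
    have h7 : 1 ≤ 2 ^ (M - acc) := Nat.one_le_two_pow
    have h8 : 1 ≤ 2 ^ weight s := Nat.one_le_two_pow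
    generalize (sumLoop _ _).steps = S at *
    have h9 := h3.trans (Nat.add_le_add_right (Nat.mul_le_mul_right _ h2) 1)
    calc _ ≤ 2 ^ weight s * (30 * (n + 1) ^ 2) + (2 ^ weight s *
          (4 * n + 8 + Q * (i + 1) * 2 ^ (M - acc) + 2) + 1) := Nat.add_le_add h1 h9
      _ ≤ 2 ^ weight s * (30 * (n + 1) ^ 2) + (2 ^ weight s *
          (4 * n + 8 + Q * (i + 1) * 2 ^ (M - acc) + 2) + 2 ^ weight s) := by omega
      _ = 2 ^ weight s * (30 * (n + 1) ^ 2 + 4 * n + 11 + Q * (i + 1) * 2 ^ (M - acc)) := by ring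
      _ ≤ 2 ^ weight s * (Q * 2 ^ (M - acc) + Q * (i + 1) * 2 ^ (M - acc)) := by
        refine Nat.mul_le_mul_left _ (Nat.add_le_add_right ?_ _)
        calc _ ≤ Q := by omega
          _ ≤ _ := Nat.le_mul_of_pos_right _ h7
      _ = _ := by ring

/-- The number of steps of the simulation method. -/
theorem method_steps_le (c : Circuit n L) (lam : ℝ) (H : HamData n) (ρ : StateData n) (M : ℕ)
    (θ : Params c) :
    (method c lam H ρ M θ).steps ≤ (H.length + 1) * ((M + (ρ.length * (6 * n + 3) + 1) +
      30 * (n + 1) ^ 2 + (4 * n + 12)) * (L + 2) * 2 ^ M) := by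
  set Q := M + (ρ.length * (6 * n + 3) + 1) + 30 * (n + 1) ^ 2 + (4 * n + 12) with hQ
  have h1 := sumLoop_steps_le (g := fun a : ℝ × Word n => (do
      let w ← weightT a.2
      if ← keepT M L 0 w then descend c lam ρ M θ L le_rfl w a.2 (a.1 : ℂ)
      else elem 0 : Timed ℂ)) (K := 4 * n + 7 + Q * (L + 1) * 2 ^ M) (l := H) (fun a _ => by
    have h4 := weightT_steps_le a.2
    simp only [bind_steps, weightT_val, keepT_steps]
    by_cases h : (keepT M L 0 (weight a.2)).val = true
    · rw [if_pos h]
      have h' : weight a.2 ≤ M := by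
        rw [keepT_val, decide_eq_true_eq] at h; omega
      have h5 := descend_steps_le c lam ρ M θ hQ.ge L le_rfl (weight a.2) a.2 (a.1 : ℂ) h'
      have h6 : 2 ^ weight a.2 * 2 ^ (M - weight a.2) = 2 ^ M := by
        rw [← pow_add]; congr 1; omega
      rw [h6] at h5
      omega
    · rw [if_neg h, elem_steps]
      omega)
  have h7 : 1 ≤ 2 ^ M := Nat.one_le_two_pow
  have h8 : 4 * n + 9 + Q * (L + 1) * 2 ^ M ≤ Q * (L + 2) * 2 ^ M := by
    calc _ ≤ Q * 2 ^ M + Q * (L + 1) * 2 ^ M := by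
          refine Nat.add_le_add_right ?_ _
          calc _ ≤ Q := by omega
            _ ≤ _ := Nat.le_mul_of_pos_right _ h7
      _ = _ := by ring
  refine h1.trans ?_
  rw [Nat.add_mul H.length 1, one_mul]
  refine Nat.add_le_add (Nat.mul_le_mul_left _ (le_trans (by omega) h8)) (le_trans (by omega) h8)

end MethodSteps

/-! ### The ansatz is generating; its state and Hamiltonian. -/

section AnsatzSetting

variable {n : ℕ}

theorem wordPhase_eq_I_pow (v w : Word n) : ∃ k : ℕ, wordPhase v w = Complex.I ^ k := by
  have h : ∀ p r : Pauli, ∃ k : ℕ, p.mulPhase r = Complex.I ^ k := by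
    have h3 : Complex.I ^ 3 = -Complex.I := by rw [pow_succ, Complex.I_sq]; ring
    intro p r
    cases p <;> cases r <;>
      first
        | exact ⟨0, (pow_zero _).symm⟩
        | exact ⟨1, (pow_one _).symm⟩
        | exact ⟨3, h3.symm⟩
  choose f hf using h
  exact ⟨∑ q, f (v q) (w q), by simp only [wordPhase, hf, Finset.prod_pow_eq_pow_sum]⟩

/-- Membership of a word in a monoid of operators, up to a phase. -/
def MemUpToPhase (S : Submonoid (Op n)) (w : Word n) : Prop :=
  ∃ k : ℕ, Complex.I ^ k • wordOp w ∈ S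

theorem MemUpToPhase.mul {S : Submonoid (Op n)} {v w : Word n} (hv : MemUpToPhase S v)
    (hw : MemUpToPhase S w) : MemUpToPhase S (wordMul v w) := by
  obtain ⟨k, hk⟩ := hv
  obtain ⟨k', hk'⟩ := hw
  obtain ⟨m, hm⟩ := wordPhase_eq_I_pow v w
  refine ⟨k + k' + m, ?_⟩
  have := S.mul_mem hk hk'
  rwa [smul_mul_smul_comm, wordOp_mul, hm, smul_smul, ← pow_add, ← pow_add] at this

theorem memUpToPhase_of_single {S : Submonoid (Op n)}
    (hX : ∀ q, wordOp (singleWord q .X) ∈ S) (hZ : ∀ q, wordOp (singleWord q .Z) ∈ S)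
    (w : Word n) : MemUpToPhase S w := by
  have hI : MemUpToPhase S (idWord n) := ⟨0, by simp [wordOp_idWord, S.one_mem]⟩
  have hX' : ∀ q, MemUpToPhase S (singleWord q .X) := fun q => ⟨0, by simpa using hX q⟩
  have hZ' : ∀ q, MemUpToPhase S (singleWord q .Z) := fun q => ⟨0, by simpa using hZ q⟩
  have hs : ∀ q p, MemUpToPhase S (singleWord q p) := by
    intro q p
    cases p with
    | I =>
      have : singleWord q .I = idWord n := Function.update_eq_self q (idWord n)
      rwa [this]
    | X => exact hX' q
    | Z => exact hZ' q
    | Y =>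
      have := (hX' q).mul (hZ' q)
      convert this using 1
      funext r
      by_cases hr : r = q
      · subst hr; simp [wordMul, singleWord, Pauli.mul]
      · simp [wordMul, singleWord, Function.update_of_ne hr, idWord, Pauli.mul]
  -- The word is assembled one qubit at a time.
  have h : ∀ T : Finset (Fin n), MemUpToPhase S fun q => if q ∈ T then w q else .I := by
    intro T
    induction T using Finset.induction_on with
    | empty =>
      simp only [Finset.notMem_empty, if_false]
      exact hI
    | insert a T ha ih =>
      convert (hs a (w a)).mul ih using 1
      funext r
      by_cases hr : r = a
      · subst hr
        have : ∀ p : Pauli, p = p.mul .I := fun p => by cases p <;> rfl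
        simp [wordMul, singleWord, ha, ← this]
      · have : ∀ p : Pauli, p = Pauli.mul .I p := fun p => by cases p <;> rfl
        simp [wordMul, singleWord, idWord, hr, ← this]
  simpa using h Finset.univ

theorem ansatzLayer_cliffordOp (n : ℕ) [NeZero n] (i : ℕ) : (ansatzLayer n i).cliffordOp = 1 := by
  match i with
  | 0 => rfl
  | 1 => rfl
  | _ + 2 => rfl

theorem ansatz_effectedWord (n L : ℕ) [NeZero n] (i : Fin L) (j : Fin (ansatz n L i).R) :
    effectedWord (ansatz n L) i j = wordOp ((ansatz n L i).word j) := by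
  have : cliffordBefore (ansatz n L) i = 1 := by
    refine List.prod_eq_one fun A hA => ?_
    obtain ⟨k, rfl⟩ := (List.mem_ofFn' _ _).mp (List.mem_of_mem_take (List.mem_reverse.mp hA))
    exact ansatzLayer_cliffordOp n k
  rw [effectedWord, this]
  simp

theorem generates_ansatz (n L : ℕ) [NeZero n] (hL : 2 ≤ L) : Generates (ansatz n L) := by
  intro w
  refine memUpToPhase_of_single (fun q => Submonoid.subset_closure ?_)
    (fun q => Submonoid.subset_closure ?_) w
  · exact ⟨⟨1, by omega⟩, q, (ansatz_effectedWord n L ⟨1, by omega⟩ q).symm⟩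
  · exact ⟨⟨0, by omega⟩, q, (ansatz_effectedWord n L ⟨0, by omega⟩ q).symm⟩

theorem stateOp_zeroState (n : ℕ) :
    stateOp (zeroState n) = Matrix.single (fun _ => 0) (fun _ => 0) 1 := by
  simp [stateOp, zeroState]

theorem isDensity_zeroState (n : ℕ) : IsDensity (stateOp (zeroState n)) := by
  rw [stateOp_zeroState]
  refine ⟨?_, by simp⟩
  have h := Matrix.posSemidef_vecMulVec_self_star (Pi.single (fun _ => 0) 1 : Bits n → ℂ)
  convert h using 1
  ext x y
  simp only [Matrix.single_apply, Matrix.vecMulVec_apply, Pi.single_apply, Pi.star_apply, eq_comm]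
  split_ifs <;> simp_all

/-- `Z` and `Y` anti-commute, so the cross terms of the square cancel and leave `2`; the C*-identity
turns this into the norm. -/
theorem opNorm_ansatzH (n : ℕ) [NeZero n] : opNorm (hamOp (ansatzH n)) = Real.sqrt 2 := by
  have hA : hamOp (ansatzH n) = wordOp (singleWord 0 .Z) + wordOp (singleWord 0 .Y) := by
    simp [hamOp, ansatzH]
  set A := hamOp (ansatzH n) with hAdef
  have h1 : star A * A = (2 : ℂ) • 1 := by
    rw [Matrix.star_eq_conjTranspose, hA, Matrix.conjTranspose_add, wordOp_conjTranspose,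
      wordOp_conjTranspose, add_mul, mul_add, mul_add, wordOp_mul_self, wordOp_mul_self,
      wordOp_mul_comm (singleWord 0 .Z) (singleWord 0 .Y), sgn_singleWord]
    have : Pauli.sgn .Z (singleWord (0 : Fin n) .Y 0) = -1 := by
      simp [singleWord, Pauli.sgn, Pauli.anti]
    rw [this]
    module
  have h2 := CStarRing.norm_star_mul_self (x := Matrix.toEuclideanCLM (n := Bits n) (𝕜 := ℂ) A)
  rw [← map_star, ← map_mul, h1, map_smul, map_one, norm_smul, norm_one] at h2
  rw [opNorm, eq_comm, Real.sqrt_eq_iff_mul_self_eq (by norm_num) (norm_nonneg _), ← h2]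
  simp

end AnsatzSetting

/-! ### Words supported on one qubit. -/

section SingleWords

variable {n : ℕ}

theorem weight_singleWord (q : Fin n) {p : Pauli} (hp : p ≠ .I) : weight (singleWord q p) = 1 := by
  refine le_antisymm ((Finset.card_le_card (wordSupport_singleWord q p)).trans (by simp)) ?_
  rw [Nat.one_le_iff_ne_zero, ne_eq, weight_eq_zero]
  exact singleWord_ne q hp

theorem foldl_rotateT_of_commute {α : Type} (σ : α → Word n) (θ : α → ℝ) (l : List α)
    (u : List (ℂ × Word n)) (h : ∀ a ∈ l, ∀ t ∈ u, sgn (σ a) t.2 ≠ -1) :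
    l.foldl (fun u a => (rotateT (σ a) (θ a) u).val) u = u := by
  induction l with
  | nil => rfl
  | cons a l ih =>
    rw [List.foldl_cons, rotateT_of_commute _ _ _ (h a (by simp)),
      ih fun b hb => h b (by simp [hb])]

theorem wordMul_singleWord (q : Fin n) (p r : Pauli) :
    wordMul (singleWord q p) (singleWord q r) = singleWord q (p.mul r) := by
  funext k
  by_cases hk : k = q
  · subst hk; simp [wordMul, singleWord]
  · simp [wordMul, singleWord, Function.update_of_ne hk, idWord, Pauli.mul]

theorem wordPhase_singleWord (q : Fin n) (p r : Pauli) :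
    wordPhase (singleWord q p) (singleWord q r) = p.mulPhase r := by
  rw [wordPhase, Finset.prod_eq_single q]
  · simp [singleWord]
  · intro k _ hk
    simp [singleWord, Function.update_of_ne hk, idWord, Pauli.mulPhase]
  · simp

theorem candidatesT_val_of_C_eq_zero (l : Layer n) (hC : l.C = 0) (θ : Fin l.R → ℝ)
    (s : Word n) : (candidatesT l θ s).val = (List.finRange l.R).foldl
      (fun u j => (rotateT (l.word j) (θ j) u).val) [((1 : ℂ), s)] := by
  have : List.finRange l.C = [] := by
    rw [← List.length_eq_zero_iff, List.length_finRange, hC]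
  simp only [candidatesT, bind_val, elem_val, loop_val, this, List.foldl_nil]

theorem finRange_eq_cons {k : ℕ} (hk : 0 < k) : ∃ t : List (Fin k),
    List.finRange k = ⟨0, hk⟩ :: t ∧ ∀ j ∈ t, j ≠ ⟨0, hk⟩ := by
  obtain ⟨m, rfl⟩ := Nat.exists_eq_succ_of_ne_zero hk.ne'
  refine ⟨_, List.finRange_succ, fun j hj => ?_⟩
  obtain ⟨k, _, rfl⟩ := List.mem_map.mp hj
  exact Fin.succ_ne_zero k

/-- The other gates are trivial on `q`, so they commute with every word supported there and never
branch. -/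
theorem candidatesT_of_single {l : Layer n} (hC : l.C = 0) (hR : 0 < l.R) {q : Fin n} {p : Pauli}
    (hp : l.word ⟨0, hR⟩ = singleWord q p) (hne : ∀ j, j ≠ ⟨0, hR⟩ → l.word j q = .I)
    (θ : Fin l.R → ℝ) (r : Pauli) :
    (candidatesT l θ (singleWord q r)).val =
      (rotateT (singleWord q p) (θ ⟨0, hR⟩) [((1 : ℂ), singleWord q r)]).val := by
  obtain ⟨t, ht, ht'⟩ := finRange_eq_cons hR
  rw [candidatesT_val_of_C_eq_zero l hC, ht, List.foldl_cons, hp]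
  refine foldl_rotateT_of_commute l.word θ _ _ fun j hj a ha => ?_
  obtain ⟨a₀, h0, h1⟩ := mem_rotateT ha
  rw [List.mem_singleton] at h0
  have h2 : ∃ r', a.2 = singleWord q r' := by
    rcases h1 with h1 | h1
    · exact ⟨r, by rw [h1, h0]⟩
    · exact ⟨p.mul r, by rw [h1, h0, wordMul_singleWord]⟩
  obtain ⟨r', h2⟩ := h2
  rw [h2, sgn_comm, sgn_singleWord, hne j (ht' j hj), Pauli.sgn_I]
  norm_num

theorem rotateT_singleWord {q : Fin n} {p r : Pauli} (h : p.sgn r = -1) (x : ℝ) :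
    (rotateT (singleWord q p) x [((1 : ℂ), singleWord q r)]).val =
      [((Real.cos x : ℂ), singleWord q r),
        ((Real.sin x : ℂ) * Complex.I * p.mulPhase r, singleWord q (p.mul r))] := by
  rw [rotateT_cons_val, if_pos]
  · simp [rotateT, wordPhase_singleWord, wordMul_singleWord]
  · rw [sgn_singleWord]
    simpa [singleWord] using h

end SingleWords

/-! ### Transitions of the ansatz on the first qubit. -/

section AnsatzPaths

variable {n : ℕ} [NeZero n]

theorem ansatzLayer_R_pos (n : ℕ) [NeZero n] (i : ℕ) : 0 < (ansatzLayer n i).R := by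
  match i with
  | 0 => exact NeZero.pos n
  | 1 => exact NeZero.pos n
  | _ + 2 => exact Nat.one_pos

theorem ansatzLayer_C (n : ℕ) [NeZero n] (i : ℕ) : (ansatzLayer n i).C = 0 := by
  match i with
  | 0 => rfl
  | 1 => rfl
  | _ + 2 => rfl

theorem fullLayer_word_zero {p : Pauli} (hp : p ≠ .I) (hR : 0 < (fullLayer n p hp).R) :
    (fullLayer n p hp).word ⟨0, hR⟩ = singleWord 0 p :=
  congrArg (singleWord · p) (Fin.ext rfl : (⟨0, hR⟩ : Fin n) = 0)

theorem fullLayer_word_ne {p : Pauli} (hp : p ≠ .I) (hR : 0 < (fullLayer n p hp).R)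
    (j : Fin (fullLayer n p hp).R) (hj : j ≠ ⟨0, hR⟩) : (fullLayer n p hp).word j 0 = .I := by
  have h : (0 : Fin n) ≠ (show Fin n from j) := fun h => hj (Fin.ext (congrArg Fin.val h).symm)
  change Function.update (idWord n) (show Fin n from j) p 0 = _
  rw [Function.update_of_ne h]
  rfl

theorem candidatesT_ansatzLayer_zero (θ : Fin (ansatzLayer n 0).R → ℝ) (r : Pauli) :
    (candidatesT (ansatzLayer n 0) θ (singleWord 0 r)).val =
      (rotateT (singleWord 0 .Z) (θ ⟨0, ansatzLayer_R_pos n 0⟩)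
        [((1 : ℂ), singleWord 0 r)]).val :=
  candidatesT_of_single (ansatzLayer_C n 0) (ansatzLayer_R_pos n 0)
    (fullLayer_word_zero (by decide) _) (fullLayer_word_ne (by decide) _) θ r

theorem candidatesT_ansatzLayer_zero_Z (θ : Fin (ansatzLayer n 0).R → ℝ) :
    (candidatesT (ansatzLayer n 0) θ (singleWord 0 .Z)).val = [((1 : ℂ), singleWord 0 .Z)] := by
  refine (candidatesT_ansatzLayer_zero θ .Z).trans (rotateT_of_commute _ _ _ fun t ht => ?_)
  rw [List.mem_singleton.mp ht, sgn_singleWord]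
  simp [singleWord, Pauli.sgn, Pauli.anti]
  norm_num

theorem candidatesT_ansatzLayer_zero_Y (θ : Fin (ansatzLayer n 0).R → ℝ) : ∃ x y : ℂ,
    (candidatesT (ansatzLayer n 0) θ (singleWord 0 .Y)).val =
      [(x, singleWord 0 .Y), (y, singleWord 0 .X)] :=
  ⟨_, _, (candidatesT_ansatzLayer_zero θ .Y).trans (rotateT_singleWord rfl _)⟩

theorem candidatesT_ansatzLayer_succ (i : ℕ) (θ : Fin (ansatzLayer n (i + 1)).R → ℝ) {r : Pauli}
    (hr : Pauli.sgn .X r = -1) :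
    (candidatesT (ansatzLayer n (i + 1)) θ (singleWord 0 r)).val =
      [((Real.cos (θ ⟨0, ansatzLayer_R_pos n (i + 1)⟩) : ℂ), singleWord 0 r),
        ((Real.sin (θ ⟨0, ansatzLayer_R_pos n (i + 1)⟩) : ℂ) * Complex.I * Pauli.mulPhase .X r,
          singleWord 0 (Pauli.mul .X r))] := by
  rw [← rotateT_singleWord hr]
  refine candidatesT_of_single (ansatzLayer_C n (i + 1)) (ansatzLayer_R_pos n (i + 1)) ?_ ?_ θ r
  · match i with
    | 0 => exact fullLayer_word_zero (by decide) _
    | _ + 1 => rfl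
  · match i with
    | 0 => exact fullLayer_word_ne (by decide) _
    | _ + 1 => exact fun j hj => absurd (Fin.ext (Nat.lt_one_iff.mp j.isLt)) hj

theorem trace_singleWord_zeroState (p : Pauli) :
    (wordOp (singleWord (0 : Fin n) p) * stateOp (zeroState n)).trace = p.mat 0 0 := by
  rw [stateOp_zeroState, Matrix.trace_mul_comm, Matrix.trace_single_mul]
  simp only [smul_eq_mul, one_mul, wordOp, Matrix.of_apply]
  rw [Finset.prod_eq_single 0]
  · simp [singleWord]
  · intro k _ hk
    simp [singleWord, Function.update_of_ne hk, idWord, Pauli.mat]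
  · simp

end AnsatzPaths

/-! ### The cost and the truncation error of the ansatz. -/

section AnsatzValue

variable {n L : ℕ}

theorem tailSum_succ (c : Circuit n L) (lam : ℝ) (ρ : StateData n) (θ : Params c)
    {i : ℕ} (hi : i < L) (s : Word n) (m : ℕ) :
    tailSum c lam ρ θ (i + 1) s m = ((candidatesT (c ⟨i, hi⟩) (θ ⟨i, hi⟩) s).val.map fun a =>
      a.1 * if weight a.2 ≤ m then
        ((1 - lam : ℝ) : ℂ) ^ weight a.2 * tailSum c lam ρ θ i a.2 (m - weight a.2) else 0).sum := by
  rw [sum_candidatesT (c ⟨i, hi⟩) (θ ⟨i, hi⟩) s fun t => if weight t ≤ m then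
        ((1 - lam : ℝ) : ℂ) ^ weight t * tailSum c lam ρ θ i t (m - weight t) else 0]
  rw [tailSum, pathSum]
  refine Finset.sum_congr rfl fun t _ => ?_
  rw [amplitude, dif_pos hi]
  split_ifs
  · ring
  · ring

variable [NeZero n]

/-- The angle of the rotation on the first qubit in a layer of the ansatz. -/
noncomputable def ansatzAngle (θ : Params (ansatz n L)) (i : ℕ) : ℝ :=
  if h : i < L then θ ⟨i, h⟩ ⟨0, ansatzLayer_R_pos n i⟩ else 0

/-- The total angle of the `R_X` rotations on the first qubit in the layers `1, …, i - 1`. -/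
noncomputable def totalAngle (θ : Params (ansatz n L)) (i : ℕ) : ℝ :=
  ∑ k ∈ Finset.Ico 1 i, ansatzAngle θ k

theorem totalAngle_succ (θ : Params (ansatz n L)) {i : ℕ} (hi : 1 ≤ i) :
    totalAngle θ (i + 1) = totalAngle θ i + ansatzAngle θ i :=
  Finset.sum_Ico_succ_top hi _

/-- Each `R_X` rotates the plane of `Z` and `Y`, so the angles add up. In the layer `0`, `Z` is
fixed, while `Y` leads to `Y` and `X`, which vanish on the zero state. The bound on `m` leaves
weight one for each of the `i + 1` earlier words, so nothing is truncated. -/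
theorem tailSum_ansatz (lam : ℝ) (θ : Params (ansatz n L)) (i : ℕ) (hi : i + 1 ≤ L) (m : ℕ)
    (hm : i + 1 ≤ m) :
    tailSum (ansatz n L) lam (zeroState n) θ (i + 1) (singleWord 0 .Z) m =
        ((1 - lam : ℝ) : ℂ) ^ (i + 1) * (Real.cos (totalAngle θ (i + 1)) : ℂ) ∧
      tailSum (ansatz n L) lam (zeroState n) θ (i + 1) (singleWord 0 .Y) m =
        -(((1 - lam : ℝ) : ℂ) ^ (i + 1) * (Real.sin (totalAngle θ (i + 1)) : ℂ)) := by
  have hwX : weight (singleWord (0 : Fin n) .X) = 1 := weight_singleWord 0 (by decide)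
  have hwY : weight (singleWord (0 : Fin n) .Y) = 1 := weight_singleWord 0 (by decide)
  have hwZ : weight (singleWord (0 : Fin n) .Z) = 1 := weight_singleWord 0 (by decide)
  induction i generalizing m with
  | zero =>
    have h0 : ∀ p m, tailSum (ansatz n L) lam (zeroState n) θ 0 (singleWord 0 p) m = p.mat 0 0 :=
      fun p m => trace_singleWord_zeroState p
    have ht : totalAngle θ (0 + 1) = 0 := by simp [totalAngle]
    rw [tailSum_succ _ _ _ _ (by omega), tailSum_succ _ _ _ _ (by omega), ht]
    constructor
    · have h := candidatesT_ansatzLayer_zero_Z (θ ⟨0, by omega⟩)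
      rw [show (candidatesT (ansatz n L ⟨0, by omega⟩) (θ ⟨0, by omega⟩) (singleWord 0 .Z)).val =
        [((1 : ℂ), singleWord 0 .Z)] from h]
      simp only [List.map_cons, List.map_nil, List.sum_cons, List.sum_nil, hwZ, h0]
      rw [if_pos (by omega)]
      simp [Pauli.mat]
    · obtain ⟨x, y, h⟩ := candidatesT_ansatzLayer_zero_Y (θ ⟨0, by omega⟩)
      rw [show (candidatesT (ansatz n L ⟨0, by omega⟩) (θ ⟨0, by omega⟩) (singleWord 0 .Y)).val =
        [(x, singleWord 0 .Y), (y, singleWord 0 .X)] from h]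
      simp only [List.map_cons, List.map_nil, List.sum_cons, List.sum_nil, hwY, hwX, h0]
      simp [Pauli.mat]
  | succ i ih =>
    obtain ⟨ihZ, ihY⟩ := ih (by omega) (m - 1) (by omega)
    have hang : θ ⟨i + 1, hi⟩ ⟨0, ansatzLayer_R_pos n (i + 1)⟩ = ansatzAngle θ (i + 1) := by
      rw [ansatzAngle, dif_pos (show i + 1 < L from hi)]
    rw [tailSum_succ _ _ _ _ hi, tailSum_succ _ _ _ _ hi, totalAngle_succ θ (by omega)]
    have hcand : ∀ r : Pauli, Pauli.sgn .X r = -1 →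
        (candidatesT (ansatz n L ⟨i + 1, hi⟩) (θ ⟨i + 1, hi⟩) (singleWord 0 r)).val =
      [((Real.cos (ansatzAngle θ (i + 1)) : ℂ), singleWord 0 r),
        ((Real.sin (ansatzAngle θ (i + 1)) : ℂ) * Complex.I * Pauli.mulPhase .X r,
          singleWord 0 (Pauli.mul .X r))] := fun r hr => by
      rw [← hang]
      exact candidatesT_ansatzLayer_succ i (θ ⟨i + 1, hi⟩) hr
    rw [hcand .Z rfl, hcand .Y rfl]
    have hI := Complex.I_mul_I
    simp only [List.map_cons, List.map_nil, List.sum_cons, List.sum_nil, Pauli.mul,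
      Pauli.mulPhase, hwY, hwZ, show 1 ≤ m by omega, if_true, ihZ, ihY, Real.cos_add, Real.sin_add]
    generalize ((1 - lam : ℝ) : ℂ) = x
    simp only [Complex.ofReal_sub, Complex.ofReal_add, Complex.ofReal_mul]
    generalize (Real.cos (ansatzAngle θ (i + 1)) : ℂ) = a
    generalize (Real.sin (ansatzAngle θ (i + 1)) : ℂ) = b
    generalize (Real.cos (totalAngle θ (i + 1)) : ℂ) = a'
    generalize (Real.sin (totalAngle θ (i + 1)) : ℂ) = b'
    constructor
    · linear_combination x ^ (i + 2) * b * b' * hI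
    · linear_combination x ^ (i + 2) * b * a' * hI

theorem noisyCost_ansatz (hL : 1 ≤ L) (lam : ℝ) (θ : Params (ansatz n L)) :
    noisyCost (ansatz n L) lam (hamOp (ansatzH n)) (stateOp (zeroState n)) θ =
      (((1 - lam) ^ (L + 1) * (Real.cos (totalAngle θ L) - Real.sin (totalAngle θ L)) : ℝ) : ℂ) := by
  -- From `(L + 1) * n` on the truncation is exact; the summand `L + 1` only makes it plain that the
  -- budget of `tailSum_ansatz` is met.
  rw [← truncatedCost_eq_noisyCost _ _ _ _ _ (M := (L + 1) * n + (L + 1)) (by omega),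
    truncatedCost_hamOp]
  have hwY : weight (singleWord (0 : Fin n) .Y) = 1 := weight_singleWord 0 (by decide)
  have hwZ : weight (singleWord (0 : Fin n) .Z) = 1 := weight_singleWord 0 (by decide)
  obtain ⟨i, rfl⟩ : ∃ i, L = i + 1 := ⟨L - 1, by omega⟩
  obtain ⟨hZ, hY⟩ := tailSum_ansatz lam θ i le_rfl ((i + 1 + 1) * n + (i + 1 + 1) - 1) (by omega)
  simp only [ansatzH, List.map_cons, List.map_nil, List.sum_cons, List.sum_nil, hwY, hwZ,
    show 1 ≤ (i + 1 + 1) * n + (i + 1 + 1) by omega, if_true, hZ, hY]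
  push_cast
  ring

/-- A contributing path has `L + 1` non-identity words, so its weight exceeds `L`. -/
theorem truncatedCost_ansatz_eq_zero (lam : ℝ) {M : ℕ} (hM : M ≤ L) (θ : Params (ansatz n L)) :
    truncatedCost (ansatz n L) lam (hamOp (ansatzH n)) (stateOp (zeroState n)) M θ = 0 := by
  have hwY : weight (singleWord (0 : Fin n) .Y) = 1 := weight_singleWord 0 (by decide)
  have hwZ : weight (singleWord (0 : Fin n) .Z) = 1 := weight_singleWord 0 (by decide)
  have h : ∀ p : Pauli, weight (singleWord (0 : Fin n) p) = 1 → 1 ≤ M →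
      tailSum (ansatz n L) lam (zeroState n) θ L (singleWord 0 p) (M - 1) = 0 := fun p hp hM' =>
    pathSum_eq_zero (amplitude_eq_zero _ θ) L (by omega) (by omega)
  rw [truncatedCost_hamOp]
  simp only [ansatzH, List.map_cons, List.map_nil, List.sum_cons, List.sum_nil, hwY, hwZ]
  split_ifs with h1
  · rw [h .Z hwZ h1, h .Y hwY h1]; simp
  · simp

theorem continuous_totalAngle (i : ℕ) :
    Continuous fun θ : Params (ansatz n L) => totalAngle θ i := by
  refine continuous_finsetSum _ fun k _ => ?_
  unfold ansatzAngle
  split_ifs with h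
  · exact (continuous_apply _).comp (continuous_apply _)
  · exact continuous_const

/-- The integrand is odd under negation of all angles. -/
theorem integral_sin_two_totalAngle (i : ℕ) :
    ∫ θ : Params (ansatz n L), Real.sin (2 * totalAngle θ i) ∂(paramLaw (ansatz n L)) = 0 := by
  have hm := measurePreserving_params (ansatz n L) (fun _ _ x => -x)
    fun _ _ => measurePreserving_neg_angleLaw
  have hc : Continuous fun θ : Params (ansatz n L) => Real.sin (2 * totalAngle θ i) :=
    Real.continuous_sin.comp (continuous_const.mul (continuous_totalAngle i))
  have h1 := integral_map (μ := paramLaw (ansatz n L)) hm.measurable.aemeasurable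
    (f := fun θ => Real.sin (2 * totalAngle θ i)) hc.aestronglyMeasurable
  have h2 : ∀ θ : Params (ansatz n L), totalAngle (fun i j => -θ i j : Params (ansatz n L)) i =
      -totalAngle θ i := fun θ => by
    rw [totalAngle, totalAngle, ← Finset.sum_neg_distrib]
    refine Finset.sum_congr rfl fun k _ => ?_
    unfold ansatzAngle
    split_ifs
    · rfl
    · simp
  rw [hm.map_eq] at h1
  simp only [h2, mul_neg, Real.sin_neg, integral_neg] at h1
  linarith

/-- Below weight `L + 1` the truncation of the ansatz misses the whole cost function. -/
theorem mse_ansatz (hL : 1 ≤ L) (lam : ℝ) {M : ℕ} (hM : M ≤ L) :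
    mse (ansatz n L) lam (hamOp (ansatzH n)) (stateOp (zeroState n)) M =
      ((1 - lam) ^ 2) ^ (L + 1) := by
  have h : ∀ θ, sqError (ansatz n L) lam (hamOp (ansatzH n)) (stateOp (zeroState n)) M θ =
      ((1 - lam) ^ 2) ^ (L + 1) * (1 - Real.sin (2 * totalAngle θ L)) := fun θ => by
    -- The error is the whole cost, and `(cos x - sin x)² = 1 - sin 2x`.
    rw [sqError, truncatedCost_ansatz_eq_zero lam hM, noisyCost_ansatz hL, zero_sub, norm_neg,
      Complex.norm_real, Real.norm_eq_abs, sq_abs, Real.sin_two_mul]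
    have := Real.cos_sq_add_sin_sq (totalAngle θ L)
    rw [mul_pow, pow_right_comm]
    linear_combination ((1 - lam) ^ 2) ^ (L + 1) * this
  have hc : Continuous fun θ : Params (ansatz n L) => Real.sin (2 * totalAngle θ L) :=
    Real.continuous_sin.comp (continuous_const.mul (continuous_totalAngle L))
  simp only [mse, h]
  rw [integral_const_mul, integral_sub (integrable_const _) (integrable_of_continuous hc),
    integral_sin_two_totalAngle]
  simp

end AnsatzValue

/-! ### Exponential lower bound on the steps for the ansatz. -/

section AnsatzSteps

variable {n L : ℕ} [NeZero n]

/-- The hypothesis `hacc` is the pruning test for words of weight one, and it persists along the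
descent. An `R_X` layer sends `Z` and `Y` to both of them, so the search tree is binary down to the
layer `0`, for which a single step is counted. -/
theorem le_descend_steps_ansatz (lam : ℝ) (ρ : StateData n) (M : ℕ) (θ : Params (ansatz n L))
    (i : ℕ) (hi : i + 1 ≤ L) (acc : ℕ) (hacc : acc + (i + 1) ≤ M) (r : Pauli)
    (hr : r = .Z ∨ r = .Y) (z : ℂ) :
    2 ^ i ≤ (descend (ansatz n L) lam ρ M θ (i + 1) hi acc (singleWord 0 r) z).steps := by
  induction i generalizing acc r z with
  | zero =>
    simp only [descend, candidatesT, bind_steps, elem_steps]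
    omega
  | succ i ih =>
    have hsgn : Pauli.sgn .X r = -1 := by rcases hr with rfl | rfl <;> rfl
    have hcand : (candidatesT (ansatz n L ⟨i + 1, hi⟩) (θ ⟨i + 1, hi⟩) (singleWord 0 r)).val = _ :=
      candidatesT_ansatzLayer_succ i (θ ⟨i + 1, hi⟩) hsgn
    have hbody : ∀ a : ℂ × Word n, ∀ r', (r' = .Z ∨ r' = .Y) → a.2 = singleWord 0 r' → 2 ^ i ≤
        (do
          let w ← weightT a.2
          if ← keepT M (i + 1) acc w then do
            let acc' ← elem (acc + w)
            let z' ← elem (z * a.1)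
            descend (ansatz n L) lam ρ M θ (i + 1) (Nat.le_of_succ_le hi) acc' a.2 z'
          else elem 0 : Timed ℂ).steps := by
      intro a r' hr' ha
      have hw : weight a.2 = 1 := by
        rw [ha]
        exact weight_singleWord 0 (by rcases hr' with rfl | rfl <;> decide)
      have hk : (keepT M (i + 1) acc 1).val = true := by
        rw [keepT_val, decide_eq_true_eq, if_neg one_ne_zero]; omega
      simp only [bind_steps, weightT_val, hw, hk, if_true, elem_val, elem_steps]
      have := ih (Nat.le_of_succ_le hi) (acc + 1) (by omega) r' hr' (z * a.1)
      rw [ha]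
      omega
    rw [descend, bind_steps]
    refine le_trans ?_ (Nat.le_add_left _ _)
    refine le_trans ?_ (le_sumLoop_steps _ _)
    rw [hcand]
    simp only [List.map_cons, List.map_nil, List.sum_cons, List.sum_nil]
    rw [pow_succ, mul_two]
    exact Nat.add_le_add (hbody (_, singleWord 0 r) r hr rfl)
      (hbody (_, singleWord 0 (Pauli.mul .X r)) (Pauli.mul .X r)
        (by rcases hr with rfl | rfl <;> simp [Pauli.mul]) rfl)

/-- Beyond weight `L` the simulation of the ansatz takes exponentially many steps. -/
theorem le_method_steps_ansatz (hL : 1 ≤ L) (lam : ℝ) (ρ : StateData n) {M : ℕ} (hM : L < M)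
    (θ : Params (ansatz n L)) :
    2 ^ (L - 1) ≤ (method (ansatz n L) lam (ansatzH n) ρ M θ).steps := by
  obtain ⟨i, rfl⟩ : ∃ i, L = i + 1 := ⟨L - 1, by omega⟩
  refine le_trans ?_ (le_sumLoop_steps _ _)
  simp only [ansatzH, List.map_cons, List.map_nil, List.sum_cons]
  refine le_trans ?_ (Nat.le_add_right _ _)
  have hw : weight (singleWord (0 : Fin n) .Z) = 1 := weight_singleWord 0 (by decide)
  have hk : (keepT M (i + 1) 0 1).val = true := by
    rw [keepT_val, decide_eq_true_eq, if_neg one_ne_zero]; omega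
  simp only [bind_steps, weightT_val, hw, hk, if_true]
  have := le_descend_steps_ansatz lam ρ M θ i le_rfl 1 (by omega) .Z (Or.inl rfl) ((1 : ℝ) : ℂ)
  rw [Nat.add_sub_cancel]
  omega

end AnsatzSteps

/-! ### Estimates for the cutoff and the noise rate. -/

section Cutoff

/-- The exponent is at most `⌈a / κ⌉ log L + 1`; the `1` comes from rounding up and gives the factor
`2`, and `2 ≤ e` bounds the rest by a power of `L`. -/
theorem two_pow_ceil_le {a κ lam : ℝ} (ha : 0 ≤ a) (hκ : 0 < κ) {L : ℕ} (hL : 2 ≤ L)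
    (hlam : κ / Real.log L ≤ lam) : 2 ^ ⌈a / lam⌉₊ ≤ 2 * L ^ ⌈a / κ⌉₊ := by
  have hlog : 0 < Real.log L := Real.log_pos (by exact_mod_cast hL)
  have hlam0 : 0 < lam := (div_pos hκ hlog).trans_le hlam
  have h1 : a / lam ≤ ⌈a / κ⌉₊ * Real.log L := by
    rw [div_le_iff₀ hlam0]
    have h2 : κ ≤ Real.log L * lam := by rwa [div_le_iff₀' hlog] at hlam
    have h3 : a ≤ ⌈a / κ⌉₊ * κ := by rw [← div_le_iff₀ hκ]; exact Nat.le_ceil _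
    calc a ≤ ⌈a / κ⌉₊ * κ := h3
      _ ≤ ⌈a / κ⌉₊ * (Real.log L * lam) := mul_le_mul_of_nonneg_left h2 (Nat.cast_nonneg _)
      _ = _ := by ring
  have h4 : (⌈a / lam⌉₊ : ℝ) ≤ ⌈a / κ⌉₊ * Real.log L + 1 :=
    (Nat.ceil_lt_add_one (by positivity)).le.trans (by linarith)
  have h5 : (0 : ℝ) ≤ ⌈a / κ⌉₊ * Real.log L := by positivity
  have h6 : (2 : ℝ) ^ ⌈a / lam⌉₊ ≤ 2 * (L : ℝ) ^ ⌈a / κ⌉₊ := by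
    calc (2 : ℝ) ^ ⌈a / lam⌉₊ = (2 : ℝ) ^ (⌈a / lam⌉₊ : ℝ) := (Real.rpow_natCast _ _).symm
      _ ≤ (2 : ℝ) ^ (⌈a / κ⌉₊ * Real.log L + 1) :=
        Real.rpow_le_rpow_of_exponent_le (by norm_num) h4
      _ = 2 * (2 : ℝ) ^ (⌈a / κ⌉₊ * Real.log L) := by
        rw [Real.rpow_add (by norm_num), Real.rpow_one, mul_comm]
      _ ≤ 2 * (Real.exp 1) ^ (⌈a / κ⌉₊ * Real.log L) := by
        refine mul_le_mul_of_nonneg_left (Real.rpow_le_rpow (by norm_num) ?_ h5) (by norm_num)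
        linarith [Real.add_one_le_exp 1]
      _ = 2 * (L : ℝ) ^ ⌈a / κ⌉₊ := by
        rw [Real.exp_one_rpow, Real.exp_nat_mul, Real.exp_log (by positivity)]
  exact_mod_cast h6

/-- Uses `1 - lam ≤ exp (-lam)`. Taking `B² + 1` in place of `B²` keeps the logarithm meaningful for
`B = 0` and makes the final inequality strict. -/
theorem pow_mul_sq_lt {B ν a lam b : ℝ} (hν : 0 < ν) (ha : Real.log ((B ^ 2 + 1) / ν) ≤ 2 * a)
    (hlam : lam ∈ Set.Icc (0 : ℝ) 1) (hlam0 : 0 < lam) (hb : 0 ≤ b) (hbB : b ≤ B) :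
    ((1 - lam) ^ 2) ^ (⌈a / lam⌉₊ + 1) * b ^ 2 < ν := by
  have h0 : 0 ≤ 1 - lam := sub_nonneg.mpr hlam.2
  have h1 : a ≤ lam * (⌈a / lam⌉₊ + 1 : ℕ) := by
    have := (div_le_iff₀' hlam0).mp (Nat.le_ceil (a / lam))
    push_cast
    linarith
  have h2 : ((1 - lam) ^ 2) ^ (⌈a / lam⌉₊ + 1) ≤ ν / (B ^ 2 + 1) := by
    rw [← pow_mul]
    calc (1 - lam) ^ (2 * (⌈a / lam⌉₊ + 1)) ≤ (Real.exp (-lam)) ^ (2 * (⌈a / lam⌉₊ + 1)) :=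
          pow_le_pow_left₀ h0 (by linarith [Real.add_one_le_exp (-lam)]) _
      _ = Real.exp (-(2 * (lam * (⌈a / lam⌉₊ + 1 : ℕ)))) := by
        rw [← Real.exp_nat_mul]; congr 1; push_cast; ring
      _ ≤ Real.exp (-Real.log ((B ^ 2 + 1) / ν)) := Real.exp_le_exp.mpr (by linarith)
      _ = ν / (B ^ 2 + 1) := by
        rw [Real.exp_neg, Real.exp_log (by positivity), inv_div]
  have h3 : b ^ 2 ≤ B ^ 2 := pow_le_pow_left₀ hb hbB 2
  calc ((1 - lam) ^ 2) ^ (⌈a / lam⌉₊ + 1) * b ^ 2 ≤ ν / (B ^ 2 + 1) * B ^ 2 :=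
        mul_le_mul h2 h3 (by positivity) (by positivity)
    _ < ν / (B ^ 2 + 1) * (B ^ 2 + 1) :=
        mul_lt_mul_of_pos_left (by linarith) (by positivity)
    _ = ν := div_mul_cancel₀ _ (by positivity)

/-- For `lam ≤ 1 / 2` one has `1 - lam ≥ exp (-2 lam)`, and the total exponent is `4 lam (L + 1) ≤ 8
lam L ≤ 8 K`. -/
theorem exp_neg_le_pow {K lam : ℝ} {L : ℕ} (hL : 1 ≤ L) (hKL : 2 * K ≤ L) (hlam0 : 0 ≤ lam)
    (hlam : lam ≤ K / L) : Real.exp (-(8 * K)) ≤ ((1 - lam) ^ 2) ^ (L + 1) := by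
  have hL0 : (0 : ℝ) < L := by exact_mod_cast hL
  have hL1 : (1 : ℝ) ≤ L := by exact_mod_cast hL
  have h1 : lam * L ≤ K := (le_div_iff₀ hL0).mp hlam
  have h2 : lam ≤ 1 / 2 := hlam.trans (by rw [div_le_iff₀ hL0]; linarith)
  have h3 : Real.exp (-(2 * lam)) ≤ 1 - lam := by
    rw [Real.exp_neg]
    have h4 : 1 + 2 * lam ≤ Real.exp (2 * lam) := by linarith [Real.add_one_le_exp (2 * lam)]
    rw [inv_le_comm₀ (Real.exp_pos _) (by linarith)]
    refine le_trans ?_ h4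
    rw [inv_le_iff_one_le_mul₀ (by linarith)]
    nlinarith
  rw [← pow_mul]
  calc Real.exp (-(8 * K)) ≤ Real.exp (-(2 * lam)) ^ (2 * (L + 1)) := by
        rw [← Real.exp_nat_mul, Real.exp_le_exp]
        push_cast
        nlinarith
    _ ≤ _ := pow_le_pow_left₀ (Real.exp_pos _).le h3 _

theorem steps_polynomial_bound {A d p n L M h r : ℕ} (hL : 2 ≤ L) (hh : h ≤ A * (n + 1) ^ d)
    (hr : r ≤ A * (n + 1) ^ d) (hM : 2 ^ M ≤ 2 * L ^ p) :
    (h + 1) * ((M + (r * (6 * n + 3) + 1) + 30 * (n + 1) ^ 2 + (4 * n + 12)) * (L + 2) * 2 ^ M) ≤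
      ((A + 1) * ((2 + 6 * A + 47) * 2 * 2)) * ((n + 1) * (L + 1)) ^ (2 * d + 2 * p + 3) := by
  set N := (n + 1) * (L + 1) with hN
  have hN1 : 1 ≤ N := Nat.one_le_iff_ne_zero.mpr (by positivity)
  have hn : n + 1 ≤ N := Nat.le_mul_of_pos_right _ (by omega)
  have hLN : L + 1 ≤ N := Nat.le_mul_of_pos_left _ (by omega)
  have hpow : ∀ a b, a ≤ b → N ^ a ≤ N ^ b := fun a b hab => Nat.pow_le_pow_right hN1 hab
  have h1 : h + 1 ≤ (A + 1) * N ^ d := by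
    have := Nat.mul_le_mul_left A (Nat.pow_le_pow_left hn d)
    have := Nat.one_le_pow d N hN1
    rw [Nat.add_mul, one_mul]
    omega
  have h2 : 2 ^ M ≤ 2 * N ^ p :=
    hM.trans (Nat.mul_le_mul_left _ (Nat.pow_le_pow_left (by omega) p))
  have h3 : L + 2 ≤ 2 * N := by omega
  have h4 : M + (r * (6 * n + 3) + 1) + 30 * (n + 1) ^ 2 + (4 * n + 12) ≤
      (2 + 6 * A + 47) * N ^ (p + d + 2) := by
    -- The cutoff also enters linearly; `M < 2 ^ M` makes that factor polynomial as well.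
    have h5 : M ≤ 2 * N ^ (p + d + 2) := Nat.lt_two_pow_self.le.trans
      (h2.trans (Nat.mul_le_mul_left _ (hpow _ _ (by omega))))
    have h6 : r * (6 * n + 3) ≤ 6 * A * N ^ (p + d + 2) := by
      calc r * (6 * n + 3) ≤ (A * N ^ d) * (6 * N) := Nat.mul_le_mul
            (hr.trans (Nat.mul_le_mul_left _ (Nat.pow_le_pow_left hn d))) (by omega)
        _ = 6 * A * N ^ (d + 1) := by ring
        _ ≤ _ := Nat.mul_le_mul_left _ (hpow _ _ (by omega))
    have h7 : 30 * (n + 1) ^ 2 ≤ 30 * N ^ (p + d + 2) := Nat.mul_le_mul_left _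
      ((Nat.pow_le_pow_left hn 2).trans (hpow _ _ (by omega)))
    have h8 : N ≤ N ^ (p + d + 2) := Nat.le_self_pow (by omega) N
    have h9 : 1 + (4 * n + 12) ≤ 17 * N ^ (p + d + 2) := by omega
    calc _ = M + r * (6 * n + 3) + 30 * (n + 1) ^ 2 + (1 + (4 * n + 12)) := by ring
      _ ≤ 2 * N ^ (p + d + 2) + 6 * A * N ^ (p + d + 2) + 30 * N ^ (p + d + 2) +
          17 * N ^ (p + d + 2) := by omega
      _ = _ := by ring
  calc _ ≤ (A + 1) * N ^ d * ((2 + 6 * A + 47) * N ^ (p + d + 2) * (2 * N) * (2 * N ^ p)) :=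
        Nat.mul_le_mul h1 (Nat.mul_le_mul (Nat.mul_le_mul h4 h3) h2)
    _ = ((A + 1) * ((2 + 6 * A + 47) * 2 * 2)) * N ^ (2 * d + 2 * p + 3) := by ring

end Cutoff

end PauliPath

/-! ### Assembly of the two regimes. -/

open PauliPath in
theorem proposition2 :
    -- noise rate `λ = Ω(1 / log L)`: time `Poly(n, L)`
    (∀ (A d : ℕ) (B ν κ : ℝ), 0 < ν → 0 < κ →
      ∃ (C k : ℕ) (M : ℝ → ℕ), ∀ (n L : ℕ) (c : Circuit n L) (H : HamData n)
        (ρ : StateData n) (lam : ℝ),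
        2 ≤ L → Generates c →
        H.length ≤ A * (n + 1) ^ d → ρ.length ≤ A * (n + 1) ^ d →
        IsDensity (stateOp ρ) → opNorm (hamOp H) ≤ B →
        lam ∈ Set.Icc (0 : ℝ) 1 → κ / Real.log L ≤ lam →
          (∀ θ : Params c,
            (method c lam H ρ (M lam) θ).val =
              truncatedCost c lam (hamOp H) (stateOp ρ) (M lam) θ) ∧
          (∀ θ : Params c,
            (method c lam H ρ (M lam) θ).steps ≤ C * ((n + 1) * (L + 1)) ^ k) ∧
          MeasureTheory.Integrable (sqError c lam (hamOp H) (stateOp ρ) (M lam)) (paramLaw c) ∧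
          mse c lam (hamOp H) (stateOp ρ) (M lam) < ν) ∧
    -- noise rate `λ = O(1 / L)`: a family of instances that takes exponential time
    (∀ K : ℝ, 0 < K →
      ∃ (ν₀ : ℝ) (L₀ : ℕ), 0 < ν₀ ∧ ∀ (n L : ℕ) [NeZero n] (lam : ℝ),
        2 ≤ L → L₀ ≤ L → lam ∈ Set.Icc (0 : ℝ) 1 → lam ≤ K / L →
          Generates (ansatz n L) ∧
          IsDensity (stateOp (zeroState n)) ∧
          opNorm (hamOp (ansatzH n)) = Real.sqrt 2 ∧
          ν₀ ≤ mse (ansatz n L) lam (hamOp (ansatzH n)) (stateOp (zeroState n)) L ∧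
          (∀ (M : ℕ) (θ : Params (ansatz n L)),
            (method (ansatz n L) lam (ansatzH n) (zeroState n) M θ).val =
              truncatedCost (ansatz n L) lam (hamOp (ansatzH n)) (stateOp (zeroState n)) M θ) ∧
          ∀ M : ℕ, mse (ansatz n L) lam (hamOp (ansatzH n)) (stateOp (zeroState n)) M < ν₀ →
            ∀ θ : Params (ansatz n L),
              2 ^ (L - 1) ≤
                (method (ansatz n L) lam (ansatzH n) (zeroState n) M θ).steps) := by
  refine ⟨fun A d B ν κ hν hκ => ?_, fun K hK => ?_⟩
  -- With `M = ⌈a / lam⌉` the damping `exp (-2 a)` is at most `ν / (B² + 1)`. The maximum with `0`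
  -- covers a large `ν`, for which the logarithm is negative.
  · set a : ℝ := max 0 (Real.log ((B ^ 2 + 1) / ν) / 2) with ha
    have ha0 : 0 ≤ a := le_max_left _ _
    have ha1 : Real.log ((B ^ 2 + 1) / ν) ≤ 2 * a := by
      have := le_max_right 0 (Real.log ((B ^ 2 + 1) / ν) / 2)
      linarith
    refine ⟨_, _, fun lam => ⌈a / lam⌉₊,
      fun n L c H ρ lam hL hc hH hρlen hρ hB hlam hκlam => ⟨fun θ => method_val _ _ _ _ _ _,
        fun θ => (method_steps_le _ _ _ _ _ _).trans (steps_polynomial_bound hL hH hρlen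
          (two_pow_ceil_le ha0 hκ hL hκlam)),
        integrable_of_continuous (continuous_sqError _ _ _ _ _),
        (mse_le_opNorm hc hlam _ hρ _).trans_lt ?_⟩⟩
    have hlog : 0 < Real.log L := Real.log_pos (by exact_mod_cast hL)
    exact pow_mul_sq_lt hν ha1 hlam ((div_pos hκ hlog).trans_le hκlam) (opNorm_nonneg _) hB
  -- `L ≥ 2 K` ensures `lam ≤ 1 / 2`, as needed for the lower bound `exp (-8 K)`.
  · refine ⟨Real.exp (-(8 * K)), ⌈2 * K⌉₊, Real.exp_pos _, fun n L _ lam hL hL₀ hlam hlamK => ?_⟩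
    have hL1 : 1 ≤ L := by omega
    have hbound := exp_neg_le_pow hL1 (Nat.ceil_le.mp hL₀) hlam.1 hlamK
    refine ⟨generates_ansatz n L hL, isDensity_zeroState n, opNorm_ansatzH n, ?_,
      fun M θ => method_val _ _ _ _ _ _, fun M hM θ => ?_⟩
    · rwa [mse_ansatz hL1 lam le_rfl]
    -- Every cutoff `M ≤ L` has the same error, which is at least `exp (-8 K)`; a smaller error thus
    -- forces `L < M`.
    · refine le_method_steps_ansatz hL1 lam _ (lt_of_not_ge fun hML => ?_) θ
      rw [mse_ansatz hL1 lam hML] at hM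
      exact absurd hbound (not_le.mpr hM)
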